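/- **Setting.** Let $\mathfrak g$ be a symmetrizable Kac–Moody algebra over $\mathbb C$ with finite, indecomposable generalized Cartan matrix $\mathbf A=(a_{ij})_{i,j\in\mathbf I}$ and realization $(\mathfrak h,\{\alpha_i\},\{\alpha_i^\vee\})$, $\alpha_j(\alpha_i^\vee)=a_{ij}$, $\dim\mathfrak h=2|\mathbf I|-\operatorname{rank}\mathbf A$. Let $(\cdot,\cdot)$ be the invariant form normalized so that the numbers $d_i=(\alpha_i,\alpha_i)/2$ are positive, relatively prime integers; set $d_{ij}=(\alpha_i,\alpha_j)/2=d_ia_{ij}/2$. With the Chevalley generators $e_i,f_i$ put $x_i^+=\sqrt{d_i}\,e_i$, $x_i^-=\sqrt{d_i}\,f_i$. *The Yangian.* $Y_\hbar\mathfrak g$ is the unital associative $\mathbb C[\hbar]$-algebra generated by $h\in\mathfrak h$ (linearly in $h$) and $x_{ir}^\pm,h_{ir}$ ($i\in\mathbf I$, $r\in\mathbb N=\{0,1,2,\dots\}$) with the relations $$h_{i0}=d_i\alpha_i^\vee,\quad [h_{ir},h_{js}]=[h_{ir},h]=[h,h']=0,\quad [h,x_{js}^\pm]=\pm\alpha_j(h)x_{js}^\pm,\quad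 [x_{ir}^+,x_{js}^-]=\delta_{ij}h_{i,r+s},$$ $$[h_{i,r+1},x_{js}^\pm]-[h_{ir},x_{j,s+1}^\pm]=\pm\hbar d_{ij}(h_{ir}x_{js}^\pm+x_{js}^\pm h_{ir}),$$ $$[x^\pm_{i,r+1},x_{js}^\pm]-[x^\pm_{ir},x_{j,s+1}^\pm]=\pm\hbar d_{ij}(x^\pm_{ir}x_{js}^\pm+x_{js}^\pm x^\pm_{ir}),$$ $$\sum_{\pi\in S_m}\bigl[x^\pm_{i,r_{\pi(1)}},[x^\pm_{i,r_{\pi(2)}},\cdots,[x^\pm_{i,r_{\pi(m)}},x^\pm_{js}]\cdots]\bigr]=0\qquad(i\ne j,\ m=1-a_{ij}).$$ It is $\mathbb N$-graded by $\deg\hbar=1$, $\deg\mathfrak h=0$, $\deg x_{ir}^\pm=\deg h_{ir}=r$, with components $Y_k$. Put $\widehat{Y_\hbar\mathfrak g}=\prod_{k\ge0}Y_k$, a $\mathbb C[\![\hbar]\!]$-algebra, and $\widehat{Y_\hbar\mathfrak g}_+=\prod_{k\ge1}Y_k$. For $c\in\mathbb C$ the shift homomorphism $\tau_c$ of $Y_\hbar\mathfrak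 g$ is given by $\tau_c(h)=h$, $\tau_c(x_{ir}^\pm)=\sum_{k=0}^r\binom rk c^{r-k}x_{ik}^\pm$, $\tau_c(h_{ir})=\sum_{k=0}^r\binom rk c^{r-k}h_{ik}$. *The Yangian double.* $\mathrm DY_\hbar\mathfrak g$ is the $\mathbb C[\![\hbar]\!]$-algebra topologically generated (for the $\hbar$-adic topology) by $h\in\mathfrak h$ and $\mathcal X_{ir}^\pm,\mathcal H_{ir}$ ($i\in\mathbf I$, $r\in\mathbb Z$) with the same relations, the modes now ranging over $\mathbb Z$. Let $\iota:Y_\hbar\mathfrak g\to\mathrm DY_\hbar\mathfrak g$ be the natural homomorphism, and $\Gamma=\iota\circ\tau_{-1}$. *The homomorphism $\Phi_c$.* For $c\in\mathbb C^\times$, $\Phi_c:\mathrm DY_\hbar\mathfrak g\to\widehat{Y_\hbar\mathfrak g}$ is the $\mathbb C[\![\hbar]\!]$-algebra homomorphism with $$\Phi_c(h)=h,\qquad \Phi_c(\mathcal X_{ir}^\pm)=\sum_{n\ge0}\binom rn c^{\,r-n}x_{in}^\pm,\qquad \Phi_c(\mathcal H_{ir})=\sum_{n\ge0}\binom rn c^{\,r-n}h_{in}.$$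 *Gradation automorphisms.* For $a\in\mathbb C^\times$, $\chi_a$ denotes the $\mathbb C$-algebra automorphism of $\mathrm DY_\hbar\mathfrak g$ with $\hbar\mapsto a\hbar$, $h\mapsto h$, $\mathcal X^\pm_{ir}\mapsto a^r\mathcal X^\pm_{ir}$, $\mathcal H_{ir}\mapsto a^r\mathcal H_{ir}$, and $\chi_a^{\iota}$ that of $\widehat{Y_\hbar\mathfrak g}$ given by $\sum_k y_k\mapsto\sum_k a^ky_k$ ($y_k\in Y_k$). *Evaluation ideals and completions.* For $c\in\mathbb C^\times$, the evaluation ideal $\mathcal J_c\subset\mathrm DY_\hbar\mathfrak g$ is the kernel of the homomorphism $\mathrm DY_\hbar\mathfrak g\to U(\mathfrak g)$ which specializes $\hbar\mapsto0$ and then evaluates at $t=c$, that is, $\hbar\mapsto0$, $h\mapsto h$, $\mathcal X^\pm_{ir}\mapsto c^rx_i^\pm$, $\mathcal H_{ir}\mapsto c^rd_i\alpha_i^\vee$. Let $\widehat{\mathrm DY_\hbar\mathfrak g}_c=\varprojlim_n\mathrm DY_\hbar\mathfrak g/\mathcal J_c^n$. The equality $\chi_a(\mathcal J_{ab})=\mathcal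 J_b$ yields isomorphisms $\widehat\chi_a:\widehat{\mathrm DY_\hbar\mathfrak g}_{ab}\to\widehat{\mathrm DY_\hbar\mathfrak g}_b$. **Statement.** Fix $c\in\mathbb C^\times$. 1. $\Phi_c(\mathcal J_c)\subset\widehat{Y_\hbar\mathfrak g}_+$. Hence $\Phi_c$ induces homomorphisms $\mathrm DY_\hbar\mathfrak g/\mathcal J_c^n\to\widehat{Y_\hbar\mathfrak g}/\prod_{k\ge n}Y_k$ ($n\ge0$) and, in the limit, a $\mathbb C[\![\hbar]\!]$-algebra homomorphism $\widehat\Phi_c:\widehat{\mathrm DY_\hbar\mathfrak g}_c\to\widehat{Y_\hbar\mathfrak g}$. Write $\widehat\Phi=\widehat\Phi_1$. 2. $\Gamma(Y_n)\subset\mathcal J_1^n$ for all $n\ge0$, so that $\Gamma$ induces $\widehat\Gamma:\widehat{Y_\hbar\mathfrak g}\to\widehat{\mathrm DY_\hbar\mathfrak g}_1$, $\sum_ky_k\mapsto\sum_k\Gamma(y_k)$. The homomorphism $\widehat\Phi_c$ is an isomorphism of $\mathbb C[\![\hbar]\!]$-algebras, and $$\widehat\Phi_c=\chi^{\iota}_{1/c}\circ\widehat\Phi\circ\widehat\chi_c,\qquad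 \widehat\Phi_c^{-1}=\widehat\chi_{1/c}\circ\widehat\Gamma\circ\chi^{\iota}_c .$$ Moreover $\Phi_c=\chi^{\iota}_{a/c}\circ\Phi_a\circ\chi_{c/a}$ for all $a,c\in\mathbb C^\times$. -/

import Mathlib

open scoped Polynomial PowerSeries

noncomputable section

namespace YD

universe u v w

/-! ### Kac-Moody data -/

/-- A symmetrizable indecomposable generalized Cartan matrix `A`, a realization
`(𝔥, {α_i}, {α_i^∨})` of it, and the normalized symmetrizing integers `d_i`.
In terms of the standard invariant form, `(α_i, α_j) = d_i a_{ij}`; the normalization is the one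
for which the `d_i = (α_i, α_i) / 2` are positive, relatively prime integers. -/
structure KacMoodyDatum (I : Type u) (𝔥 : Type v) [Fintype I] [DecidableEq I]
    [AddCommGroup 𝔥] [Module ℂ 𝔥] where
  /-- the generalized Cartan matrix -/
  A : Matrix I I ℤ
  diag : ∀ i, A i i = 2
  offDiag_nonpos : ∀ i j, i ≠ j → A i j ≤ 0
  zero_symm : ∀ i j, A i j = 0 → A j i = 0
  indecomposable : ∀ s : Set I, s.Nonempty → sᶜ.Nonempty → ∃ i ∈ s, ∃ j ∈ sᶜ, A i j ≠ 0
  /-- the symmetrizing integers -/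
  d : I → ℕ
  d_pos : ∀ i, 0 < d i
  d_coprime : Finset.univ.gcd d = 1
  d_symm : ∀ i j, (d i : ℤ) * A i j = (d j : ℤ) * A j i
  /-- the simple roots -/
  root : I → Module.Dual ℂ 𝔥
  /-- the simple coroots -/
  coroot : I → 𝔥
  finiteDimensional : FiniteDimensional ℂ 𝔥
  root_linearIndependent : LinearIndependent ℂ root
  coroot_linearIndependent : LinearIndependent ℂ coroot
  root_coroot : ∀ i j, root j (coroot i) = (A i j : ℂ)
  finrank_add_rank :
    Module.finrank ℂ 𝔥 + (A.map (Int.cast : ℤ → ℂ)).rank = 2 * Fintype.card I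

variable {I : Type u} {𝔥 : Type v} [Fintype I] [DecidableEq I] [AddCommGroup 𝔥] [Module ℂ 𝔥]

/-- `d_{ij} = (α_i, α_j) / 2 = d_i a_{ij} / 2`, so that `d_{ii} = d_i`. -/
def KacMoodyDatum.dd (K : KacMoodyDatum I 𝔥) (i j : I) : ℂ := (K.d i : ℂ) * (K.A i j : ℂ) / 2

/-- The exponent `m = 1 - a_{ij}` of the Serre relations (for `i ≠ j`). -/
def KacMoodyDatum.serreExp (K : KacMoodyDatum I 𝔥) (i j : I) : ℕ := (1 - K.A i j).toNat

/-! ### The Kac-Moody algebra -/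

/-- Chevalley generators: `h ∈ 𝔥`, `e 1 i = e_i` and `e (-1) i = f_i`. -/
inductive KMGen (I : Type u) (𝔥 : Type v)
  | h : 𝔥 → KMGen I 𝔥
  | e : ℤˣ → I → KMGen I 𝔥

/-- The generator `h ∈ 𝔥` of the free Lie algebra. -/
def freeH (I : Type u) {𝔥 : Type v} (a : 𝔥) : FreeLieAlgebra ℂ (KMGen I 𝔥) :=
  FreeLieAlgebra.of ℂ (KMGen.h a)

/-- The generators `e_i` (`ε = 1`) and `f_i` (`ε = -1`) of the free Lie algebra. -/
def freeE {I : Type u} (𝔥 : Type v) (ε : ℤˣ) (i : I) : FreeLieAlgebra ℂ (KMGen I 𝔥) :=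
  FreeLieAlgebra.of ℂ (KMGen.e ε i)

/-- The Chevalley-Serre relators. -/
inductive KMRelator (K : KacMoodyDatum I 𝔥) :
    FreeLieAlgebra ℂ (KMGen I 𝔥) → Prop
  | add (a b : 𝔥) : KMRelator K (freeH I (a + b) -
      (freeH I a + freeH I b))
  | smul (z : ℂ) (a : 𝔥) : KMRelator K (freeH I (z • a) -
      z • freeH I a)
  | hh (a b : 𝔥) : KMRelator K ⁅freeH I a, freeH I b⁆
  | he (a : 𝔥) (ε : ℤˣ) (j : I) : KMRelator K
      (⁅freeH I a, freeE 𝔥 ε j⁆ -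
        (((ε : ℤ) : ℂ) * K.root j a) • freeE 𝔥 ε j)
  | ef (i j : I) : KMRelator K
      (⁅freeE 𝔥 1 i, freeE 𝔥 (-1) j⁆ -
        if i = j then freeH I (K.coroot i) else 0)
  | serre (ε : ℤˣ) (i j : I) (hij : i ≠ j) : KMRelator K
      ((LieAlgebra.ad ℂ (FreeLieAlgebra ℂ (KMGen I 𝔥)) (freeE 𝔥 ε i) ^
        K.serreExp i j) (freeE 𝔥 ε j))

/-- The Kac-Moody algebra `𝔤`, by its Chevalley-Serre presentation. -/
def KacMoodyAlgebra (K : KacMoodyDatum I 𝔥) : Type (max u v) :=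
  FreeLieAlgebra ℂ (KMGen I 𝔥) ⧸
    LieSubmodule.lieSpan ℂ (FreeLieAlgebra ℂ (KMGen I 𝔥)) {r | KMRelator K r}

instance (K : KacMoodyDatum I 𝔥) : LieRing (KacMoodyAlgebra K) :=
  inferInstanceAs (LieRing (FreeLieAlgebra ℂ (KMGen I 𝔥) ⧸
    LieSubmodule.lieSpan ℂ (FreeLieAlgebra ℂ (KMGen I 𝔥)) {r | KMRelator K r}))

instance (K : KacMoodyDatum I 𝔥) : LieAlgebra ℂ (KacMoodyAlgebra K) :=
  inferInstanceAs (LieAlgebra ℂ (FreeLieAlgebra ℂ (KMGen I 𝔥) ⧸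
    LieSubmodule.lieSpan ℂ (FreeLieAlgebra ℂ (KMGen I 𝔥)) {r | KMRelator K r}))

/-- The quotient map from the free Lie algebra onto `𝔤`. -/
def KacMoodyAlgebra.mk (K : KacMoodyDatum I 𝔥) :
    FreeLieAlgebra ℂ (KMGen I 𝔥) →ₗ⁅ℂ⁆ KacMoodyAlgebra K :=
  { (LieSubmodule.Quotient.mk' (LieSubmodule.lieSpan ℂ (FreeLieAlgebra ℂ (KMGen I 𝔥))
      {r | KMRelator K r})).toLinearMap with
    map_lie' := fun {_ _} => rfl }

theorem KacMoodyAlgebra.mk_relator (K : KacMoodyDatum I 𝔥) {r : FreeLieAlgebra ℂ (KMGen I 𝔥)}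
    (hr : KMRelator K r) : KacMoodyAlgebra.mk K r = 0 :=
  LieSubmodule.Quotient.mk_eq_zero'.mpr (LieSubmodule.subset_lieSpan hr)

/-- The element of `𝔤` attached to `h ∈ 𝔥`. -/
def KacMoodyAlgebra.h (K : KacMoodyDatum I 𝔥) (a : 𝔥) : KacMoodyAlgebra K :=
  KacMoodyAlgebra.mk K (freeH I a)

/-- The normalized generators `x_i^+ = √d_i e_i` and `x_i^- = √d_i f_i` of `𝔤`. -/
def KacMoodyAlgebra.x (K : KacMoodyDatum I 𝔥) (ε : ℤˣ) (i : I) : KacMoodyAlgebra K :=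
  ((Real.sqrt (K.d i) : ℝ) : ℂ) • KacMoodyAlgebra.mk K (freeE 𝔥 ε i)

/-! ### The relations of the Yangian and of the Yangian double -/

/-- Generators with modes in `M` (`M = ℕ` for the Yangian, `M = ℤ` for its double):
`h ∈ 𝔥`, `x ε i r = x_{ir}^±` with `ε = ±1`, and `H i r = h_{ir}`. -/
inductive Gen (I : Type u) (𝔥 : Type v) (M : Type w)
  | h : 𝔥 → Gen I 𝔥 M
  | x : ℤˣ → I → M → Gen I 𝔥 M
  | H : I → M → Gen I 𝔥 M

/-- The commutator `b ↦ [a, b] = a b - b a` of an associative algebra. -/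
def adL (R : Type*) [Ring R] [Algebra ℂ R] : R →ₗ[ℂ] Module.End ℂ R :=
  LinearMap.mul ℂ R - (LinearMap.mul ℂ R).flip

theorem adL_apply {R : Type*} [Ring R] [Algebra ℂ R] (a b : R) : adL R a b = a * b - b * a := rfl

/-- The nested commutator sum
`∑_{π ∈ S_m} [y_{π(1)}, [y_{π(2)}, ⋯, [y_{π(m)}, z] ⋯ ]]`. -/
def serreSum {R : Type*} [Ring R] [Algebra ℂ R] {m : ℕ} (y : Fin m → R) (z : R) : R :=
  ∑ π : Equiv.Perm (Fin m), (List.ofFn fun k => adL R (y (π k))).prod z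

/-- The defining relators of the Yangian (`M = ℕ`) and of the Yangian double (`M = ℤ`), as elements
of a `ℂ`-algebra `R` with a chosen element `hb` (which stands for `ħ`) and a choice `g` of
elements of `R` for the generators. The condition that `𝔥 → R` is linear is included. -/
inductive Relator (K : KacMoodyDatum I 𝔥) {M : Type w} [AddMonoidWithOne M]
    {R : Type*} [Ring R] [Algebra ℂ R] (hb : R) (g : Gen I 𝔥 M → R) : R → Prop
  | add (a b : 𝔥) : Relator K hb g (g (.h (a + b)) - (g (.h a) + g (.h b)))
  | smul (z : ℂ) (a : 𝔥) : Relator K hb g (g (.h (z • a)) - z • g (.h a))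
  | H_zero (i : I) : Relator K hb g (g (.H i 0) - (K.d i : ℂ) • g (.h (K.coroot i)))
  | HH (i j : I) (r s : M) : Relator K hb g ⁅g (.H i r), g (.H j s)⁆
  | Hh (i : I) (r : M) (a : 𝔥) : Relator K hb g ⁅g (.H i r), g (.h a)⁆
  | hh (a b : 𝔥) : Relator K hb g ⁅g (.h a), g (.h b)⁆
  | hx (a : 𝔥) (ε : ℤˣ) (j : I) (s : M) : Relator K hb g
      (⁅g (.h a), g (.x ε j s)⁆ - (((ε : ℤ) : ℂ) * K.root j a) • g (.x ε j s))
  | xx_opp (i j : I) (r s : M) : Relator K hb g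
      (⁅g (.x 1 i r), g (.x (-1) j s)⁆ - if i = j then g (.H i (r + s)) else 0)
  | Hx (ε : ℤˣ) (i j : I) (r s : M) : Relator K hb g
      (⁅g (.H i (r + 1)), g (.x ε j s)⁆ - ⁅g (.H i r), g (.x ε j (s + 1))⁆ -
        (((ε : ℤ) : ℂ) * K.dd i j) •
          (hb * (g (.H i r) * g (.x ε j s) + g (.x ε j s) * g (.H i r))))
  | xx (ε : ℤˣ) (i j : I) (r s : M) : Relator K hb g
      (⁅g (.x ε i (r + 1)), g (.x ε j s)⁆ - ⁅g (.x ε i r), g (.x ε j (s + 1))⁆ -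
        (((ε : ℤ) : ℂ) * K.dd i j) •
          (hb * (g (.x ε i r) * g (.x ε j s) + g (.x ε j s) * g (.x ε i r))))
  | serre (ε : ℤˣ) (i j : I) (hij : i ≠ j) (r : Fin (K.serreExp i j) → M) (s : M) :
      Relator K hb g (serreSum (fun k => g (.x ε i (r k))) (g (.x ε j s)))

/-- The elements `g` of `R` satisfy the defining relations. -/
def Satisfies (K : KacMoodyDatum I 𝔥) {M : Type w} [AddMonoidWithOne M]
    {R : Type*} [Ring R] [Algebra ℂ R] (hb : R) (g : Gen I 𝔥 M → R) : Prop :=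
  ∀ r, Relator K hb g r → r = 0

theorem map_serreSum {R R' : Type*} [Ring R] [Algebra ℂ R] [Ring R'] [Algebra ℂ R']
    (φ : R →ₐ[ℂ] R') {m : ℕ} (y : Fin m → R) (z : R) :
    φ (serreSum y z) = serreSum (fun k => φ (y k)) (φ z) := by
  have key : ∀ l : List R, φ ((l.map fun a => adL R a).prod z) =
      (l.map fun a => adL R' (φ a)).prod (φ z) := by
    intro l
    induction l with
    | nil => simp
    | cons a l ih =>
      simp only [List.map_cons, List.prod_cons, Module.End.mul_apply, adL_apply, map_sub, map_mul, ih]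
  simp only [serreSum, map_sum]
  refine Finset.sum_congr rfl fun π _ => ?_
  have h1 := key (List.ofFn fun k => y (π k))
  simpa only [List.map_ofFn, Function.comp_def] using h1

theorem Relator.map (K : KacMoodyDatum I 𝔥) {M : Type w} [AddMonoidWithOne M]
    {R R' : Type*} [Ring R] [Algebra ℂ R] [Ring R'] [Algebra ℂ R'] (φ : R →ₐ[ℂ] R')
    {hb : R} {g : Gen I 𝔥 M → R} {r : R} (hr : Relator K hb g r) :
    Relator K (φ hb) (fun a => φ (g a)) (φ r) := by
  have lie : ∀ a b : R, φ ⁅a, b⁆ = ⁅φ a, φ b⁆ := by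
    intro a b
    simp [Ring.lie_def]
  have ite' : ∀ (p : Prop) [Decidable p] (a : R),
      φ (if p then a else 0) = if p then φ a else 0 := by
    intro p _ a
    split_ifs <;> simp
  cases hr with
  | add a b => simpa using Relator.add (K := K) (hb := φ hb) (g := fun a => φ (g a)) a b
  | smul z a => simpa using Relator.smul (K := K) (hb := φ hb) (g := fun a => φ (g a)) z a
  | H_zero i => simpa using Relator.H_zero (K := K) (hb := φ hb) (g := fun a => φ (g a)) i
  | HH i j r s => rw [lie]; exact .HH i j r s
  | Hh i r a => rw [lie]; exact .Hh i r a
  | hh a b => rw [lie]; exact .hh a b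
  | hx a ε j s => rw [map_sub, lie, map_smul]; exact .hx a ε j s
  | xx_opp i j r s => rw [map_sub, lie, ite']; exact .xx_opp i j r s
  | Hx ε i j r s =>
    simp only [map_sub, lie, map_smul, map_mul, map_add]
    exact .Hx ε i j r s
  | xx ε i j r s =>
    simp only [map_sub, lie, map_smul, map_mul, map_add]
    exact .xx ε i j r s
  | serre ε i j hij r s => rw [map_serreSum]; exact .serre ε i j hij r s

theorem Relator.exists_of_map (K : KacMoodyDatum I 𝔥) {M : Type w} [AddMonoidWithOne M]
    {R R' : Type*} [Ring R] [Algebra ℂ R] [Ring R'] [Algebra ℂ R'] (φ : R →ₐ[ℂ] R')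
    {hb : R} {g : Gen I 𝔥 M → R} {r' : R'} (hr : Relator K (φ hb) (fun a => φ (g a)) r') :
    ∃ r, Relator K hb g r ∧ φ r = r' := by
  have lie : ∀ a b : R, φ ⁅a, b⁆ = ⁅φ a, φ b⁆ := by
    intro a b
    simp [Ring.lie_def]
  have ite' : ∀ (p : Prop) [Decidable p] (a : R),
      φ (if p then a else 0) = if p then φ a else 0 := by
    intro p _ a
    split_ifs <;> simp
  cases hr with
  | add a b => exact ⟨_, .add a b, by rw [map_sub, map_add]⟩
  | smul z a => exact ⟨_, .smul z a, by rw [map_sub, map_smul]⟩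
  | H_zero i => exact ⟨_, .H_zero i, by rw [map_sub, map_smul]⟩
  | HH i j r s => exact ⟨_, .HH i j r s, lie _ _⟩
  | Hh i r a => exact ⟨_, .Hh i r a, lie _ _⟩
  | hh a b => exact ⟨_, .hh a b, lie _ _⟩
  | hx a ε j s => exact ⟨_, .hx a ε j s, by rw [map_sub, lie, map_smul]⟩
  | xx_opp i j r s => exact ⟨_, .xx_opp i j r s, by rw [map_sub, lie, ite']⟩
  | Hx ε i j r s =>
    exact ⟨_, .Hx ε i j r s, by simp only [map_sub, lie, map_smul, map_mul, map_add]⟩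
  | xx ε i j r s =>
    exact ⟨_, .xx ε i j r s, by simp only [map_sub, lie, map_smul, map_mul, map_add]⟩
  | serre ε i j hij r s => exact ⟨_, .serre ε i j hij r s, map_serreSum φ _ _⟩

theorem Satisfies.map {K : KacMoodyDatum I 𝔥} {M : Type w} [AddMonoidWithOne M]
    {R R' : Type*} [Ring R] [Algebra ℂ R] [Ring R'] [Algebra ℂ R'] (φ : R →ₐ[ℂ] R')
    {hb : R} {g : Gen I 𝔥 M → R} (H : Satisfies K hb g) :
    Satisfies K (φ hb) (fun a => φ (g a)) := by
  intro r' hr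
  obtain ⟨r, h1, rfl⟩ := Relator.exists_of_map K φ hr
  rw [H r h1, map_zero]

/-! ### Currents

An auxiliary device: from a family satisfying the relations, linear maps on a commutative algebra
`P` with a distinguished element `t` are obtained, and substituting `t ↦ c + t` is then easy. -/

/-- The relations, for currents `x ε i, y i : P → R` in place of modes. -/
structure CurrentRel (K : KacMoodyDatum I 𝔥) {P : Type*} [CommRing P] [Algebra ℂ P] (t : P)
    {R : Type*} [Ring R] [Algebra ℂ R] (hb : R) (h : 𝔥 → R)
    (x : ℤˣ → I → P →ₗ[ℂ] R) (y : I → P →ₗ[ℂ] R) : Prop where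
  add : ∀ a b, h (a + b) = h a + h b
  smul : ∀ (z : ℂ) a, h (z • a) = z • h a
  y_one : ∀ i, y i 1 = (K.d i : ℂ) • h (K.coroot i)
  yy : ∀ i j p q, ⁅y i p, y j q⁆ = 0
  yh : ∀ i p a, ⁅y i p, h a⁆ = 0
  hh : ∀ a b, ⁅h a, h b⁆ = 0
  hx : ∀ a ε j q, ⁅h a, x ε j q⁆ = (((ε : ℤ) : ℂ) * K.root j a) • x ε j q
  xx_opp : ∀ i j p q, ⁅x 1 i p, x (-1) j q⁆ = if i = j then y i (p * q) else 0
  yx : ∀ ε i j p q, ⁅y i (t * p), x ε j q⁆ - ⁅y i p, x ε j (t * q)⁆ =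
    (((ε : ℤ) : ℂ) * K.dd i j) • (hb * (y i p * x ε j q + x ε j q * y i p))
  xx : ∀ ε i j p q, ⁅x ε i (t * p), x ε j q⁆ - ⁅x ε i p, x ε j (t * q)⁆ =
    (((ε : ℤ) : ℂ) * K.dd i j) • (hb * (x ε i p * x ε j q + x ε j q * x ε i p))
  serre : ∀ ε i j, i ≠ j → ∀ (p : Fin (K.serreExp i j) → P) q,
    serreSum (fun k => x ε i (p k)) (x ε j q) = 0

theorem lie_shift {R : Type*} [Ring R] [Algebra ℂ R] (c : ℂ) (a a' b b' : R) :
    ⁅c • a + a', b⁆ - ⁅a, c • b + b'⁆ = ⁅a', b⁆ - ⁅a, b'⁆ := by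
  simp only [Ring.lie_def, add_mul, mul_add, smul_mul_assoc, mul_smul_comm]
  abel

theorem CurrentRel.satisfies {K : KacMoodyDatum I 𝔥} {P : Type*} [CommRing P] [Algebra ℂ P]
    {t : P} {R : Type*} [Ring R] [Algebra ℂ R] {hb : R} {h : 𝔥 → R}
    {x : ℤˣ → I → P →ₗ[ℂ] R} {y : I → P →ₗ[ℂ] R} (C : CurrentRel K t hb h x y)
    {M : Type w} [AddMonoidWithOne M] (c : ℂ) (e : M → P) (e_zero : e 0 = 1)
    (e_succ : ∀ r, e (r + 1) = c • e r + t * e r) (e_add : ∀ r s, e (r + s) = e r * e s)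
    (g : Gen I 𝔥 M → R) (gh : ∀ a, g (.h a) = h a) (gx : ∀ ε i r, g (.x ε i r) = x ε i (e r))
    (gy : ∀ i r, g (.H i r) = y i (e r)) : Satisfies K hb g := by
  intro r hr
  cases hr with
  | add a b => rw [gh, gh, gh, C.add, sub_self]
  | smul z a => rw [gh, gh, C.smul, sub_self]
  | H_zero i => rw [gy, gh, e_zero, C.y_one, sub_self]
  | HH i j r s => rw [gy, gy, C.yy]
  | Hh i r a => rw [gy, gh, C.yh]
  | hh a b => rw [gh, gh, C.hh]
  | hx a ε j s => rw [gh, gx, C.hx, sub_self]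
  | xx_opp i j r s => rw [gx, gx, gy, C.xx_opp, e_add, sub_self]
  | Hx ε i j r s =>
    rw [gy, gy, gx, gx, e_succ, e_succ, map_add, map_add, map_smul, map_smul, lie_shift, C.yx,
      sub_self]
  | xx ε i j r s =>
    rw [gx, gx, gx, gx, e_succ, e_succ, map_add, map_add, map_smul, map_smul, lie_shift, C.xx,
      sub_self]
  | serre ε i j hij r s => simp only [gx, C.serre ε i j hij]

/-- The linear map `ℂ[T] → R` with `T^n ↦ f n`. -/
def modeMap {R : Type*} [Ring R] [Algebra ℂ R] (f : ℕ → R) : ℂ[X] →ₗ[ℂ] R :=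
  (Polynomial.basisMonomials ℂ).constr ℂ f

theorem modeMap_monomial {R : Type*} [Ring R] [Algebra ℂ R] (f : ℕ → R) (n : ℕ) (a : ℂ) :
    modeMap f (Polynomial.monomial n a) = a • f n := by
  have h1 : modeMap f (Polynomial.monomial n 1) = f n := by
    have := (Polynomial.basisMonomials ℂ).constr_basis ℂ f n
    rwa [Polynomial.coe_basisMonomials] at this
  have h2 : Polynomial.monomial n a = a • Polynomial.monomial n (1 : ℂ) := by
    rw [Polynomial.smul_monomial, smul_eq_mul, mul_one]
  rw [h2, map_smul, h1]

/-- The nested commutator sum as a multilinear map in its first arguments. -/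
def serreMul (R : Type*) [Ring R] [Algebra ℂ R] (m : ℕ) (z : R) :
    MultilinearMap ℂ (fun _ : Fin m => R) R :=
  ∑ π : Equiv.Perm (Fin m),
    (LinearMap.applyₗ (R := ℂ) z).compMultilinearMap
      (((MultilinearMap.mkPiAlgebraFin ℂ m (Module.End ℂ R)).compLinearMap
        (fun _ => adL R)).domDomCongr π)

theorem serreMul_apply {R : Type*} [Ring R] [Algebra ℂ R] {m : ℕ} (y : Fin m → R) (z : R) :
    serreMul R m z y = serreSum y z := by
  simp only [serreMul, serreSum, sum_apply]
  refine Finset.sum_congr rfl fun π _ => ?_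
  simp [MultilinearMap.mkPiAlgebraFin_apply]

theorem serreSum_add {R : Type*} [Ring R] [Algebra ℂ R] {m : ℕ} (y : Fin m → R) (z z' : R) :
    serreSum y (z + z') = serreSum y z + serreSum y z' := by
  simp [serreSum, Finset.sum_add_distrib]

theorem serreSum_smul {R : Type*} [Ring R] [Algebra ℂ R] {m : ℕ} (y : Fin m → R) (a : ℂ) (z : R) :
    serreSum y (a • z) = a • serreSum y z := by
  simp [serreSum, Finset.smul_sum]

theorem serre_modeMap {R : Type*} [Ring R] [Algebra ℂ R] {m : ℕ} (f f' : ℕ → R)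
    (H : ∀ (r : Fin m → ℕ) s, serreSum (fun k => f (r k)) (f' s) = 0) (p : Fin m → ℂ[X])
    (q : ℂ[X]) : serreSum (fun k => modeMap f (p k)) (modeMap f' q) = 0 := by
  induction q using Polynomial.induction_on' with
  | add q q' h1 h2 => rw [map_add, serreSum_add, h1, h2, add_zero]
  | monomial s a =>
    rw [modeMap_monomial, serreSum_smul, ← serreMul_apply]
    have : (serreMul R m (f' s)).compLinearMap (fun _ => modeMap f) = 0 := by
      refine Module.Basis.ext_multilinear (fun _ => Polynomial.basisMonomials ℂ) fun v => ?_
      simp only [MultilinearMap.compLinearMap_apply, Polynomial.coe_basisMonomials,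
        modeMap_monomial, one_smul, serreMul_apply, H, zero_apply]
    have h2 := congrArg (fun F => F p) this
    simp only [MultilinearMap.compLinearMap_apply, zero_apply] at h2
    rw [h2, smul_zero]

theorem bilin_ext {R : Type*} [Ring R] [Algebra ℂ R] (B : ℂ[X] →ₗ[ℂ] ℂ[X] →ₗ[ℂ] R)
    (H : ∀ r s, B (Polynomial.monomial r 1) (Polynomial.monomial s 1) = 0) (p q : ℂ[X]) :
    B p q = 0 := by
  have : B = 0 := by
    refine (Polynomial.basisMonomials ℂ).ext fun r => (Polynomial.basisMonomials ℂ).ext fun s => ?_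
    simpa [Polynomial.coe_basisMonomials] using H r s
  rw [this]
  rfl

/-- The commutator as a bilinear map of two currents. -/
def lieBil {P R : Type*} [AddCommGroup P] [Module ℂ P] [Ring R] [Algebra ℂ R]
    (x y : P →ₗ[ℂ] R) : P →ₗ[ℂ] P →ₗ[ℂ] R :=
  ((adL R).compl₁₂ x y)

theorem lieBil_apply {P R : Type*} [AddCommGroup P] [Module ℂ P] [Ring R] [Algebra ℂ R]
    (x y : P →ₗ[ℂ] R) (p q : P) : lieBil x y p q = ⁅x p, y q⁆ := rfl

/-- The bilinear map `(p, q) ↦ [x(Tp), y(q)] - [x(p), y(Tq)] - z ħ (x(p) y(q) + y(q) x(p))`. -/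
def quadBil {R : Type*} [Ring R] [Algebra ℂ R] (hb : R) (z : ℂ) (x y : ℂ[X] →ₗ[ℂ] R) :
    ℂ[X] →ₗ[ℂ] ℂ[X] →ₗ[ℂ] R :=
  lieBil (x ∘ₗ LinearMap.mulLeft ℂ Polynomial.X) y -
    lieBil x (y ∘ₗ LinearMap.mulLeft ℂ Polynomial.X) -
    z • (((LinearMap.mul ℂ R).compl₁₂ x y + ((LinearMap.mul ℂ R).compl₁₂ y x).flip).compr₂
      (LinearMap.mulLeft ℂ hb))

theorem quadBil_apply {R : Type*} [Ring R] [Algebra ℂ R] (hb : R) (z : ℂ) (x y : ℂ[X] →ₗ[ℂ] R)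
    (p q : ℂ[X]) : quadBil hb z x y p q = ⁅x (Polynomial.X * p), y q⁆ -
      ⁅x p, y (Polynomial.X * q)⁆ - z • (hb * (x p * y q + y q * x p)) := rfl

theorem quad_modeMap {R : Type*} [Ring R] [Algebra ℂ R] (hb : R) (z : ℂ) (f f' : ℕ → R)
    (H : ∀ r s, ⁅f (r + 1), f' s⁆ - ⁅f r, f' (s + 1)⁆ - z • (hb * (f r * f' s + f' s * f r)) = 0)
    (p q : ℂ[X]) : ⁅modeMap f (Polynomial.X * p), modeMap f' q⁆ -
      ⁅modeMap f p, modeMap f' (Polynomial.X * q)⁆ =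
      z • (hb * (modeMap f p * modeMap f' q + modeMap f' q * modeMap f p)) := by
  rw [← sub_eq_zero, ← quadBil_apply]
  refine bilin_ext _ (fun r s => ?_) p q
  rw [quadBil_apply]
  simp only [Polynomial.X_mul_monomial, modeMap_monomial, one_smul]
  exact H r s

theorem lie_modeMap {R : Type*} [Ring R] [Algebra ℂ R] (f f' : ℕ → R)
    (H : ∀ r s, ⁅f r, f' s⁆ = 0) (p q : ℂ[X]) : ⁅modeMap f p, modeMap f' q⁆ = 0 := by
  rw [← lieBil_apply]
  refine bilin_ext _ (fun r s => ?_) p q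
  rw [lieBil_apply]
  simp only [modeMap_monomial, one_smul, H]

theorem lie_modeMap_mul {R : Type*} [Ring R] [Algebra ℂ R] (f f' k : ℕ → R)
    (H : ∀ r s, ⁅f r, f' s⁆ = k (r + s)) (p q : ℂ[X]) :
    ⁅modeMap f p, modeMap f' q⁆ = modeMap k (p * q) := by
  have := bilin_ext (lieBil (modeMap f) (modeMap f') -
    (LinearMap.mul ℂ ℂ[X]).compr₂ (modeMap k)) (fun r s => ?_) p q
  · rw [LinearMap.sub_apply, LinearMap.sub_apply, lieBil_apply, sub_eq_zero] at this
    exact this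
  · rw [LinearMap.sub_apply, LinearMap.sub_apply, lieBil_apply, sub_eq_zero]
    simp [modeMap_monomial, H, Polynomial.monomial_mul_monomial]

theorem lie_modeMap_left {R : Type*} [Ring R] [Algebra ℂ R] (a : R) (z : ℂ) (f : ℕ → R)
    (H : ∀ r, ⁅a, f r⁆ = z • f r) (p : ℂ[X]) : ⁅a, modeMap f p⁆ = z • modeMap f p := by
  induction p using Polynomial.induction_on' with
  | add p q h1 h2 =>
    rw [map_add, smul_add, ← h1, ← h2]
    simp only [Ring.lie_def, mul_add, add_mul]
    abel
  | monomial n b =>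
    rw [modeMap_monomial, smul_comm, ← H]
    simp only [Ring.lie_def, mul_smul_comm, smul_mul_assoc, smul_sub]

/-- Families satisfying the relations in modes `r ∈ ℕ` give currents on `ℂ[T]`. -/
theorem Satisfies.currentRel {K : KacMoodyDatum I 𝔥} {R : Type*} [Ring R] [Algebra ℂ R] {hb : R}
    {g : Gen I 𝔥 ℕ → R} (S : Satisfies K hb g) :
    CurrentRel K (Polynomial.X : ℂ[X]) hb (fun a => g (.h a))
      (fun ε i => modeMap fun r => g (.x ε i r)) (fun i => modeMap fun r => g (.H i r)) where
  add a b := by exact sub_eq_zero.mp (S _ (.add a b))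
  smul z a := by exact sub_eq_zero.mp (S _ (.smul z a))
  y_one i := by
    rw [← Polynomial.monomial_zero_one, modeMap_monomial, one_smul]
    exact sub_eq_zero.mp (S _ (.H_zero i))
  yy i j p q := by exact lie_modeMap _ _ (fun r s => S _ (.HH i j r s)) p q
  yh i p a := by
    have h1 := lie_modeMap_left (g (.h a)) 0 (fun r => g (.H i r)) (fun r => by
      have h2 := S _ (.Hh i r a)
      rw [zero_smul]
      rw [Ring.lie_def] at h2 ⊢
      rw [← neg_sub, h2, neg_zero]) p
    rw [zero_smul] at h1
    rw [Ring.lie_def] at h1 ⊢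
    rw [← neg_sub, h1, neg_zero]
  hh a b := by exact S _ (.hh a b)
  hx a ε j q := by exact lie_modeMap_left _ _ _ (fun s => sub_eq_zero.mp (S _ (.hx a ε j s))) q
  xx_opp i j p q := by
    split_ifs with hij
    · refine lie_modeMap_mul _ _ (fun r => g (.H i r)) (fun r s => ?_) p q
      have h1 := sub_eq_zero.mp (S _ (.xx_opp i j r s))
      rwa [if_pos hij] at h1
    · refine lie_modeMap _ _ (fun r s => ?_) p q
      have h1 := sub_eq_zero.mp (S _ (.xx_opp i j r s))
      rwa [if_neg hij] at h1
  yx ε i j p q := by exact quad_modeMap hb _ _ _ (fun r s => S _ (.Hx ε i j r s)) p q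
  xx ε i j p q := by exact quad_modeMap hb _ _ _ (fun r s => S _ (.xx ε i j r s)) p q
  serre ε i j hij p q := by
    have h1 := fun (r : Fin (K.serreExp i j) → ℕ) (s : ℕ) => S _ (Relator.serre ε i j hij r s)
    exact serre_modeMap (fun r => g (.x ε i r)) (fun r => g (.x ε j r)) h1 p q

/-! ### The Yangian -/

/-- The degree of a generator: `deg 𝔥 = 0` and `deg x_{ir}^± = deg h_{ir} = r`. -/
def Gen.deg {M : Type w} [AddMonoidWithOne M] : Gen I 𝔥 M → M
  | .h _ => 0
  | .x _ _ r => r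
  | .H _ r => r

/-- The two-sided ideal of the free `ℂ[ħ]`-algebra generated by the relators of the Yangian. -/
def yangianIdeal (K : KacMoodyDatum I 𝔥) : TwoSidedIdeal (FreeAlgebra ℂ[X] (Gen I 𝔥 ℕ)) :=
  TwoSidedIdeal.span {r | Relator K (algebraMap ℂ[X] (FreeAlgebra ℂ[X] (Gen I 𝔥 ℕ)) Polynomial.X)
    (FreeAlgebra.ι ℂ[X]) r}

/-- The Yangian `Y_ħ 𝔤`, an algebra over `ℂ[ħ]`. -/
def Yangian (K : KacMoodyDatum I 𝔥) : Type (max u v) :=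
  FreeAlgebra ℂ[X] (Gen I 𝔥 ℕ) ⧸ (yangianIdeal K).asIdeal

namespace Yangian

variable (K : KacMoodyDatum I 𝔥)

instance : Ring (Yangian K) :=
  inferInstanceAs (Ring (FreeAlgebra ℂ[X] (Gen I 𝔥 ℕ) ⧸ (yangianIdeal K).asIdeal))

instance : Algebra ℂ[X] (Yangian K) :=
  inferInstanceAs (Algebra ℂ[X] (FreeAlgebra ℂ[X] (Gen I 𝔥 ℕ) ⧸ (yangianIdeal K).asIdeal))

instance : Algebra ℂ (Yangian K) :=
  inferInstanceAs (Algebra ℂ (FreeAlgebra ℂ[X] (Gen I 𝔥 ℕ) ⧸ (yangianIdeal K).asIdeal))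

instance : IsScalarTower ℂ ℂ[X] (Yangian K) :=
  inferInstanceAs (IsScalarTower ℂ ℂ[X]
    (FreeAlgebra ℂ[X] (Gen I 𝔥 ℕ) ⧸ (yangianIdeal K).asIdeal))

/-- The quotient map from the free algebra. -/
def mk : FreeAlgebra ℂ[X] (Gen I 𝔥 ℕ) →ₐ[ℂ[X]] Yangian K :=
  Ideal.Quotient.mkₐ ℂ[X] (yangianIdeal K).asIdeal

/-- The element `ħ`. -/
def hbar : Yangian K := algebraMap ℂ[X] (Yangian K) Polynomial.X

/-- The generators of the Yangian. -/
def gen (a : Gen I 𝔥 ℕ) : Yangian K := mk K (FreeAlgebra.ι ℂ[X] a)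

theorem hbar_comm (y : Yangian K) : hbar K * y = y * hbar K := Algebra.commutes _ _

theorem satisfies : Satisfies K (hbar K) (gen K) := by
  intro r' hr
  have h0 : hbar K = (mk K).restrictScalars ℂ
      (algebraMap ℂ[X] (FreeAlgebra ℂ[X] (Gen I 𝔥 ℕ)) Polynomial.X) := ((mk K).commutes _).symm
  rw [h0] at hr
  obtain ⟨r, h1, rfl⟩ := Relator.exists_of_map K ((mk K).restrictScalars ℂ)
    (g := FreeAlgebra.ι ℂ[X]) hr
  exact Ideal.Quotient.eq_zero_iff_mem.mpr (TwoSidedIdeal.subset_span h1)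

variable {K}

/-- The universal property of the Yangian. -/
def lift {S : Type*} [Ring S] [Algebra ℂ[X] S] [Algebra ℂ S] [IsScalarTower ℂ ℂ[X] S]
    (g : Gen I 𝔥 ℕ → S) (H : Satisfies K (algebraMap ℂ[X] S Polynomial.X) g) :
    Yangian K →ₐ[ℂ[X]] S :=
  Ideal.Quotient.liftₐ (yangianIdeal K).asIdeal (FreeAlgebra.lift ℂ[X] g) (by
    intro a ha
    have h1 : yangianIdeal K ≤ TwoSidedIdeal.ker (FreeAlgebra.lift ℂ[X] g) := by
      refine TwoSidedIdeal.span_le.mpr fun r hr => ?_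
      have h2 := Relator.map K ((FreeAlgebra.lift ℂ[X] g).restrictScalars ℂ) hr
      simp only [AlgHom.coe_restrictScalars', AlgHom.commutes, FreeAlgebra.lift_ι_apply] at h2
      exact (TwoSidedIdeal.mem_ker _).mpr (H _ h2)
    exact (TwoSidedIdeal.mem_ker _).mp (h1 ha))

theorem lift_gen {S : Type*} [Ring S] [Algebra ℂ[X] S] [Algebra ℂ S] [IsScalarTower ℂ ℂ[X] S]
    (g : Gen I 𝔥 ℕ → S) (H : Satisfies K (algebraMap ℂ[X] S Polynomial.X) g) (a : Gen I 𝔥 ℕ) :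
    lift g H (gen K a) = g a :=
  FreeAlgebra.lift_ι_apply g a

variable (K)

/-- The values of the shift homomorphism `τ_c` on the generators. -/
def shiftGen (c : ℂ) : Gen I 𝔥 ℕ → Yangian K
  | .h a => gen K (.h a)
  | .x ε i r => ∑ k ∈ Finset.range (r + 1), ((r.choose k : ℂ) * c ^ (r - k)) • gen K (.x ε i k)
  | .H i r => ∑ k ∈ Finset.range (r + 1), ((r.choose k : ℂ) * c ^ (r - k)) • gen K (.H i k)

theorem modeMap_pow {R : Type*} [Ring R] [Algebra ℂ R] (f : ℕ → R) (c : ℂ) (r : ℕ) :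
    modeMap f ((Polynomial.X + Polynomial.C c) ^ r) =
      ∑ k ∈ Finset.range (r + 1), ((r.choose k : ℂ) * c ^ (r - k)) • f k := by
  rw [add_pow, map_sum]
  refine Finset.sum_congr rfl fun k _ => ?_
  have : (Polynomial.X : ℂ[X]) ^ k * Polynomial.C c ^ (r - k) * (r.choose k : ℂ[X]) =
      Polynomial.monomial k ((r.choose k : ℂ) * c ^ (r - k)) := by
    rw [← Polynomial.C_pow, ← Polynomial.C_eq_natCast, mul_assoc, ← Polynomial.C_mul, mul_comm,
      Polynomial.C_mul_X_pow_eq_monomial, mul_comm (c ^ (r - k))]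
  rw [this, modeMap_monomial]

theorem satisfies_shiftGen (c : ℂ) : Satisfies K (hbar K) (shiftGen K c) := by
  refine (satisfies K).currentRel.satisfies c
    (fun r : ℕ => ((Polynomial.X + Polynomial.C c) ^ r : ℂ[X])) (pow_zero _) ?_
    (fun r s => pow_add _ r s) _ (fun a => rfl) ?_ ?_
  · intro r
    rw [pow_succ, mul_comm, add_mul, add_comm, Polynomial.smul_eq_C_mul]
  · intro ε i r
    exact (modeMap_pow _ c r).symm
  · intro i r
    exact (modeMap_pow _ c r).symm

/-- The shift automorphism `τ_c` of the Yangian. -/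
def shift (c : ℂ) : Yangian K →ₐ[ℂ[X]] Yangian K :=
  lift (shiftGen K c) (satisfies_shiftGen K c)

/-- The graded component of degree `k`: the span of the elements `ħ^a w`, for monomials `w` in
the generators with `a + deg w = k`. -/
def grade (k : ℕ) : Submodule ℂ (Yangian K) :=
  Submodule.span ℂ {y | ∃ (a : ℕ) (l : List (Gen I 𝔥 ℕ)), a + (l.map Gen.deg).sum = k ∧
    y = hbar K ^ a * (l.map (gen K)).prod}

theorem one_mem_grade : (1 : Yangian K) ∈ grade K 0 :=
  Submodule.subset_span ⟨0, [], rfl, by simp⟩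

theorem hbar_pow_mem_grade (a : ℕ) : hbar K ^ a ∈ grade K a :=
  Submodule.subset_span ⟨a, [], rfl, by simp⟩

theorem gen_mem_grade (a : Gen I 𝔥 ℕ) : gen K a ∈ grade K a.deg :=
  Submodule.subset_span ⟨0, [a], by simp, by simp⟩

theorem mul_mem_grade {k l : ℕ} {y z : Yangian K} (hy : y ∈ grade K k) (hz : z ∈ grade K l) :
    y * z ∈ grade K (k + l) := by
  have h1 := Submodule.mul_mem_mul hy hz
  rw [grade, grade, Submodule.span_mul_span] at h1
  refine Submodule.span_mono ?_ h1
  rintro _ ⟨_, ⟨a, v, h2, rfl⟩, _, ⟨b, w, h3, rfl⟩, rfl⟩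
  refine ⟨a + b, v ++ w, ?_, ?_⟩
  · rw [List.map_append, List.sum_append]
    omega
  · have hc : Commute (v.map (gen K)).prod (hbar K ^ b) :=
      (Commute.pow_left (hbar_comm K _) b).symm
    simp only [List.map_append, List.prod_append, pow_add]
    rw [mul_assoc, ← mul_assoc _ (hbar K ^ b), hc.eq]
    simp only [mul_assoc]

end Yangian

/-! ### Power series over non-commutative algebras -/

/-- For an algebra homomorphism `φ : A → R⟦T⟧` and a central element `z` of `R`, the homomorphism
`A⟦ħ⟧ → R⟦T⟧`, `∑ a_k ħ^k ↦ ∑ φ(a_k) (zT)^k`. -/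
def hEval {A R : Type*} [Ring A] [Algebra ℂ A] [Ring R] [Algebra ℂ R] (φ : A →ₐ[ℂ] R⟦X⟧) (z : R)
    (hz : ∀ r, z * r = r * z) : A⟦X⟧ →ₐ[ℂ] R⟦X⟧ where
  toFun f := PowerSeries.mk fun n => ∑ p ∈ Finset.HasAntidiagonal.antidiagonal n,
    z ^ p.1 * PowerSeries.coeff p.2 (φ (PowerSeries.coeff p.1 f))
  map_one' := by
    ext n
    rw [PowerSeries.coeff_mk, Finset.sum_eq_single (0, n)]
    · simp
    · rintro ⟨k, l⟩ _ hb
      have hk : k ≠ 0 ∨ k = 0 := (em _).symm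
      rcases hk with hk | rfl
      · simp [PowerSeries.coeff_one, hk]
      · have h1 := Finset.HasAntidiagonal.mem_antidiagonal.mp ‹(0, l) ∈ _›
        simp only [zero_add] at h1
        exact absurd (by rw [h1]) hb
    · intro h
      exact absurd (Finset.HasAntidiagonal.mem_antidiagonal.mpr (zero_add n)) h
  map_mul' f g := by
    ext n
    have hp : ∀ k r, z ^ k * r = r * z ^ k := fun k r => (Commute.pow_left (hz r) k).eq
    simp only [PowerSeries.coeff_mk, PowerSeries.coeff_mul, map_sum, map_mul, Finset.mul_sum,
      Finset.sum_mul]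
    simp only [Finset.sum_sigma']
    refine Finset.sum_nbij'
      (fun x => ⟨(x.2.1.1 + x.2.2.1, x.2.1.2 + x.2.2.2), ⟨(x.2.1.2, x.2.2.2), (x.2.1.1, x.2.2.1)⟩⟩)
      (fun x => ⟨(x.2.2.1 + x.2.1.1, x.2.2.2 + x.2.1.2), ⟨(x.2.2.1, x.2.1.1), (x.2.2.2, x.2.1.2)⟩⟩)
      ?_ ?_ ?_ ?_ ?_
    · rintro ⟨⟨k, l⟩, ⟨k1, k2⟩, ⟨l1, l2⟩⟩ h
      simp only [Finset.mem_sigma, Finset.HasAntidiagonal.mem_antidiagonal] at h ⊢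
      obtain ⟨h1, h2, h3⟩ := h
      refine ⟨?_, ?_, ?_⟩ <;> first | omega | trivial
    · rintro ⟨⟨k, l⟩, ⟨k1, k2⟩, ⟨l1, l2⟩⟩ h
      simp only [Finset.mem_sigma, Finset.HasAntidiagonal.mem_antidiagonal] at h ⊢
      obtain ⟨h1, h2, h3⟩ := h
      refine ⟨?_, ?_, ?_⟩ <;> first | omega | trivial
    · rintro ⟨⟨k, l⟩, ⟨k1, k2⟩, ⟨l1, l2⟩⟩ h
      simp only [Finset.mem_sigma, Finset.HasAntidiagonal.mem_antidiagonal] at h ⊢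
      obtain ⟨-, rfl, rfl⟩ := h
      rfl
    · rintro ⟨⟨k, l⟩, ⟨k1, k2⟩, ⟨l1, l2⟩⟩ h
      simp only [Finset.mem_sigma, Finset.HasAntidiagonal.mem_antidiagonal] at h ⊢
      obtain ⟨-, rfl, rfl⟩ := h
      rfl
    · rintro ⟨⟨k, l⟩, ⟨k1, k2⟩, ⟨l1, l2⟩⟩ h
      simp only [Finset.mem_sigma, Finset.HasAntidiagonal.mem_antidiagonal] at h ⊢
      obtain ⟨-, rfl, rfl⟩ := h
      rw [pow_add, mul_assoc (z ^ k1) (z ^ k2), ← mul_assoc (z ^ k2), hp k2]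
      simp only [mul_assoc]
  map_zero' := by
    ext n
    simp
  map_add' f g := by
    ext n
    simp [mul_add, Finset.sum_add_distrib]
  commutes' a := by
    ext n
    rw [PowerSeries.coeff_mk, Finset.sum_eq_single (0, n)]
    · simp [PowerSeries.algebraMap_apply]
    · rintro ⟨k, l⟩ _ hb
      have hk : k ≠ 0 ∨ k = 0 := (em _).symm
      rcases hk with hk | rfl
      · simp [PowerSeries.algebraMap_apply, PowerSeries.coeff_C, hk]
      · have h1 := Finset.HasAntidiagonal.mem_antidiagonal.mp ‹(0, l) ∈ _›
        simp only [zero_add] at h1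
        exact absurd (by rw [h1]) hb
    · intro h
      exact absurd (Finset.HasAntidiagonal.mem_antidiagonal.mpr (zero_add n)) h

/-- The homomorphism `A⟦ħ⟧ → A'⟦ħ⟧`, `∑ a_k ħ^k ↦ ∑ c^k ψ(a_k) ħ^k`. -/
def twist {A A' : Type*} [Ring A] [Algebra ℂ A] [Ring A'] [Algebra ℂ A'] (c : ℂ)
    (ψ : A →ₐ[ℂ] A') : A⟦X⟧ →ₐ[ℂ] A'⟦X⟧ where
  toFun f := PowerSeries.mk fun n => c ^ n • ψ (PowerSeries.coeff n f)
  map_one' := by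
    ext n
    rw [PowerSeries.coeff_mk, PowerSeries.coeff_one, PowerSeries.coeff_one]
    split_ifs with h <;> simp [h]
  map_mul' f g := by
    ext n
    simp only [PowerSeries.coeff_mk, PowerSeries.coeff_mul, Finset.smul_sum, map_sum, map_mul]
    refine Finset.sum_congr rfl fun p hp => ?_
    rw [← Finset.HasAntidiagonal.mem_antidiagonal.mp hp, pow_add, smul_mul_smul_comm]
  map_zero' := by
    ext n
    simp
  map_add' f g := by
    ext n
    simp
  commutes' a := by
    ext n
    rw [PowerSeries.coeff_mk, PowerSeries.algebraMap_apply, PowerSeries.coeff_C,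
      PowerSeries.algebraMap_apply, PowerSeries.coeff_C]
    split_ifs with h <;> simp [h]

theorem map_algebraMap_comm {A : Type*} [Ring A] [Algebra ℂ A] (f : ℂ⟦X⟧) (x : A⟦X⟧) :
    PowerSeries.map (algebraMap ℂ A) f * x = x * PowerSeries.map (algebraMap ℂ A) f := by
  ext n
  rw [PowerSeries.coeff_mul, PowerSeries.coeff_mul, ← Finset.Nat.sum_antidiagonal_swap]
  refine Finset.sum_congr rfl fun p _ => ?_
  simp only [Prod.fst_swap, Prod.snd_swap, PowerSeries.coeff_map]
  exact Algebra.commutes _ _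

/-! ### The Yangian double -/

/-- The completed free algebra `ℂ⟨X⟩⟦ħ⟧` on the generators of the Yangian double. -/
abbrev DFree (I : Type u) (𝔥 : Type v) : Type (max u v) := (FreeAlgebra ℂ (Gen I 𝔥 ℤ))⟦X⟧

/-- The generators of `ℂ⟨X⟩⟦ħ⟧`. -/
def dfreeGen (I : Type u) (𝔥 : Type v) (a : Gen I 𝔥 ℤ) : DFree I 𝔥 :=
  PowerSeries.C (FreeAlgebra.ι ℂ a)

/-- The two-sided ideal generated by the relators of the Yangian double and by `ħ^n`. -/
def doubleIdealMod (K : KacMoodyDatum I 𝔥) (n : ℕ) : TwoSidedIdeal (DFree I 𝔥) :=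
  TwoSidedIdeal.span ({r | Relator K (PowerSeries.X : DFree I 𝔥) (dfreeGen I 𝔥) r} ∪
    {PowerSeries.X ^ n})

/-- The closure, in the `ħ`-adic topology, of the two-sided ideal `N` of `ℂ⟨X⟩⟦ħ⟧` generated by
the relators of the Yangian double: the intersection of all `N + ħ^n ℂ⟨X⟩⟦ħ⟧`. -/
def doubleIdeal (K : KacMoodyDatum I 𝔥) : TwoSidedIdeal (DFree I 𝔥) :=
  ⨅ n, doubleIdealMod K n

/-- The Yangian double `DY_ħ 𝔤`: the algebra topologically generated by `𝔥` and the elements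
`X_{ir}^±, H_{ir}` (`r ∈ ℤ`) subject to the defining relations. -/
def YangianDouble (K : KacMoodyDatum I 𝔥) : Type (max u v) := DFree I 𝔥 ⧸ (doubleIdeal K).asIdeal

namespace YangianDouble

variable (K : KacMoodyDatum I 𝔥)

instance : Ring (YangianDouble K) :=
  inferInstanceAs (Ring (DFree I 𝔥 ⧸ (doubleIdeal K).asIdeal))

instance : Algebra ℂ (YangianDouble K) :=
  inferInstanceAs (Algebra ℂ (DFree I 𝔥 ⧸ (doubleIdeal K).asIdeal))

/-- The quotient map from the completed free algebra. -/
def mk : DFree I 𝔥 →ₐ[ℂ] YangianDouble K := Ideal.Quotient.mkₐ ℂ (doubleIdeal K).asIdeal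

theorem mk_surjective : Function.Surjective (mk K) := Ideal.Quotient.mk_surjective

/-- `ℂ⟦ħ⟧ → ℂ⟨X⟩⟦ħ⟧`. -/
def scalarHom (I : Type u) (𝔥 : Type v) : ℂ⟦X⟧ →+* DFree I 𝔥 :=
  PowerSeries.map (algebraMap ℂ (FreeAlgebra ℂ (Gen I 𝔥 ℤ)))

instance : Algebra ℂ⟦X⟧ (YangianDouble K) :=
  RingHom.toAlgebra' ((mk K : DFree I 𝔥 →+* YangianDouble K).comp (scalarHom I 𝔥)) (by
    intro f x
    obtain ⟨x, rfl⟩ := mk_surjective K x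
    change mk K (scalarHom I 𝔥 f) * mk K x = mk K x * mk K (scalarHom I 𝔥 f)
    rw [← map_mul, ← map_mul, scalarHom, map_algebraMap_comm])

theorem algebraMap_eq (f : ℂ⟦X⟧) :
    algebraMap ℂ⟦X⟧ (YangianDouble K) f = mk K (scalarHom I 𝔥 f) := rfl

instance : Algebra ℂ[X] (YangianDouble K) :=
  Algebra.compHom (YangianDouble K) (Polynomial.coeToPowerSeries.ringHom : ℂ[X] →+* ℂ⟦X⟧)

theorem algebraMap_polynomial (f : ℂ[X]) :
    algebraMap ℂ[X] (YangianDouble K) f = mk K (scalarHom I 𝔥 (f : ℂ⟦X⟧)) := rfl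

instance : IsScalarTower ℂ ℂ[X] (YangianDouble K) :=
  IsScalarTower.of_algebraMap_eq (fun a => by
    rw [algebraMap_polynomial, ← AlgHom.commutes (mk K) a]
    congr 1
    rw [scalarHom, Polynomial.algebraMap_apply, Algebra.algebraMap_self_apply,
      Polynomial.coe_C, PowerSeries.map_C, PowerSeries.algebraMap_apply])

/-- The element `ħ`. -/
def hbar : YangianDouble K := mk K PowerSeries.X

/-- The generators of the Yangian double. -/
def gen (a : Gen I 𝔥 ℤ) : YangianDouble K := mk K (dfreeGen I 𝔥 a)

theorem algebraMap_X : algebraMap ℂ[X] (YangianDouble K) Polynomial.X = hbar K := by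
  rw [algebraMap_polynomial, Polynomial.coe_X, scalarHom, PowerSeries.map_X]
  rfl

theorem satisfies : Satisfies K (hbar K) (gen K) := by
  intro r' hr
  obtain ⟨r, h1, rfl⟩ := Relator.exists_of_map K (mk K) (g := dfreeGen I 𝔥) hr
  refine Ideal.Quotient.eq_zero_iff_mem.mpr ?_
  rw [TwoSidedIdeal.mem_asIdeal, doubleIdeal, TwoSidedIdeal.mem_iInf]
  exact fun n => TwoSidedIdeal.subset_span (Or.inl h1)

variable {K}

/-- The universal property of the Yangian double, for a homomorphism `φ` from the completed free
algebra that respects the relations modulo ideals `J n ∋ φ(ħ)^n` with zero intersection. -/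
def lift {S : Type*} [Ring S] [Algebra ℂ S] (φ : DFree I 𝔥 →ₐ[ℂ] S) (J : ℕ → TwoSidedIdeal S)
    (hJ : ∀ x, (∀ n, x ∈ J n) → x = 0)
    (h1 : ∀ r, Relator K (φ PowerSeries.X) (fun a => φ (dfreeGen I 𝔥 a)) r → ∀ n, r ∈ J n)
    (h2 : ∀ n, φ PowerSeries.X ^ n ∈ J n) : YangianDouble K →ₐ[ℂ] S :=
  Ideal.Quotient.liftₐ (doubleIdeal K).asIdeal φ (by
    intro a ha
    rw [TwoSidedIdeal.mem_asIdeal, doubleIdeal, TwoSidedIdeal.mem_iInf] at ha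
    refine hJ _ fun n => ?_
    have h3 : doubleIdealMod K n ≤ TwoSidedIdeal.comap φ (J n) := by
      refine TwoSidedIdeal.span_le.mpr ?_
      rintro r (hr | hr)
      · exact (TwoSidedIdeal.mem_comap _).mpr (h1 _ (Relator.map K φ hr) n)
      · rw [Set.mem_singleton_iff] at hr
        subst hr
        refine (TwoSidedIdeal.mem_comap _).mpr ?_
        rw [map_pow]
        exact h2 n
    exact (TwoSidedIdeal.mem_comap _).mp (h3 (ha n)))

end YangianDouble

/-! ### Homomorphisms from the Yangian double -/

/-- `ℕ`-modes as `ℤ`-modes. -/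
def Gen.toInt : Gen I 𝔥 ℕ → Gen I 𝔥 ℤ
  | .h a => .h a
  | .x ε i r => .x ε i r
  | .H i r => .H i r

theorem Satisfies.toInt {K : KacMoodyDatum I 𝔥} {R : Type*} [Ring R] [Algebra ℂ R] {hb : R}
    {g : Gen I 𝔥 ℤ → R} (S : Satisfies K hb g) : Satisfies K hb (fun a => g (Gen.toInt a)) := by
  intro r hr
  cases hr with
  | add a b => exact S _ (Relator.add (g := g) a b)
  | smul z a => exact S _ (Relator.smul (g := g) z a)
  | H_zero i =>
    simp only [Gen.toInt, Nat.cast_zero]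
    exact S _ (Relator.H_zero (g := g) i)
  | HH i j r s => exact S _ (Relator.HH (g := g) i j (r : ℤ) (s : ℤ))
  | Hh i r a => exact S _ (Relator.Hh (g := g) i (r : ℤ) a)
  | hh a b => exact S _ (Relator.hh (g := g) a b)
  | hx a ε j s => exact S _ (Relator.hx (g := g) a ε j (s : ℤ))
  | xx_opp i j r s =>
    simp only [Gen.toInt, Nat.cast_add]
    exact S _ (Relator.xx_opp (g := g) i j (r : ℤ) (s : ℤ))
  | Hx ε i j r s =>
    simp only [Gen.toInt, Nat.cast_add, Nat.cast_one]
    exact S _ (Relator.Hx (g := g) ε i j (r : ℤ) (s : ℤ))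
  | xx ε i j r s =>
    simp only [Gen.toInt, Nat.cast_add, Nat.cast_one]
    exact S _ (Relator.xx (g := g) ε i j (r : ℤ) (s : ℤ))
  | serre ε i j hij r s => exact S _ (Relator.serre (g := g) ε i j hij (fun k => (r k : ℤ)) (s : ℤ))

/-- The natural homomorphism `ι : Y_ħ 𝔤 → DY_ħ 𝔤`. -/
def inclusion (K : KacMoodyDatum I 𝔥) : Yangian K →ₐ[ℂ[X]] YangianDouble K :=
  Yangian.lift (fun a => YangianDouble.gen K a.toInt) (by
    rw [YangianDouble.algebraMap_X]
    exact (YangianDouble.satisfies K).toInt)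

theorem serreSum_smul_smul {R : Type*} [Ring R] [Algebra ℂ R] {m : ℕ} (b : Fin m → ℂ)
    (y : Fin m → R) (a : ℂ) (z : R) :
    serreSum (fun k => b k • y k) (a • z) = (a * ∏ k, b k) • serreSum y z := by
  rw [serreSum_smul, ← serreMul_apply, ← serreMul_apply, MultilinearMap.map_smul_univ, smul_smul]

theorem Satisfies.scale {K : KacMoodyDatum I 𝔥} {R : Type*} [Ring R] [Algebra ℂ R] {hb : R}
    {g : Gen I 𝔥 ℤ → R} (S : Satisfies K hb g) (c : ℂˣ) :
    Satisfies K ((c : ℂ) • hb) (fun a => ((c : ℂ) ^ a.deg) • g a) := by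
  have lie : ∀ (z w : ℂ) (a b : R), ⁅z • a, w • b⁆ = (z * w) • ⁅a, b⁆ := by
    intro z w a b
    rw [Ring.lie_def, Ring.lie_def, smul_mul_smul_comm, smul_mul_smul_comm, smul_sub,
      mul_comm w z]
  have hc := c.ne_zero
  have quad : ∀ (r s : ℤ) (z : ℂ) (a a' b b' : R),
      ⁅a', b⁆ - ⁅a, b'⁆ - z • (hb * (a * b + b * a)) = 0 →
      ⁅(c : ℂ) ^ (r + 1) • a', (c : ℂ) ^ s • b⁆ - ⁅(c : ℂ) ^ r • a, (c : ℂ) ^ (s + 1) • b'⁆ -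
        z • (((c : ℂ) • hb) * (((c : ℂ) ^ r • a) * ((c : ℂ) ^ s • b) +
          ((c : ℂ) ^ s • b) * ((c : ℂ) ^ r • a))) = 0 := by
    intro r s z a a' b b' h
    have h1 : (c : ℂ) ^ (r + 1) * (c : ℂ) ^ s = (c : ℂ) ^ (r + s + 1) := by
      rw [← zpow_add₀ hc]
      ring_nf
    have h2 : (c : ℂ) ^ r * (c : ℂ) ^ (s + 1) = (c : ℂ) ^ (r + s + 1) := by
      rw [← zpow_add₀ hc]
      ring_nf
    have h3 : (c : ℂ) * ((c : ℂ) ^ r * (c : ℂ) ^ s) = (c : ℂ) ^ (r + s + 1) := by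
      rw [← zpow_add₀ hc, ← zpow_one_add₀ hc]
      ring_nf
    rw [lie, lie, h1, h2, smul_mul_smul_comm, smul_mul_smul_comm, mul_comm ((c : ℂ) ^ s),
      ← smul_add, smul_mul_smul_comm, h3, smul_comm z, ← smul_sub, ← smul_sub, h, smul_zero]
  intro r hr
  cases hr with
  | add a b =>
    simp only [Gen.deg, zpow_zero, one_smul]
    exact S _ (.add a b)
  | smul z a =>
    simp only [Gen.deg, zpow_zero, one_smul]
    exact S _ (.smul z a)
  | H_zero i =>
    simp only [Gen.deg, zpow_zero, one_smul]
    exact S _ (.H_zero i)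
  | HH i j r s => rw [lie, S _ (.HH i j r s), smul_zero]
  | Hh i r a => rw [lie, S _ (.Hh i r a), smul_zero]
  | hh a b => rw [lie, S _ (.hh a b), smul_zero]
  | hx a ε j s =>
    rw [lie, smul_comm, sub_eq_zero.mp (S _ (.hx a ε j s))]
    simp only [Gen.deg, zpow_zero, one_mul, smul_smul, sub_self]
  | xx_opp i j r s =>
    rw [lie, sub_eq_zero.mp (S _ (.xx_opp i j r s))]
    simp only [Gen.deg, zpow_add₀ hc, smul_ite, smul_zero, sub_self]
  | Hx ε i j r s => exact quad r s _ _ _ _ _ (S _ (.Hx ε i j r s))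
  | xx ε i j r s => exact quad r s _ _ _ _ _ (S _ (.xx ε i j r s))
  | serre ε i j hij r s => rw [serreSum_smul_smul, S _ (.serre ε i j hij r s), smul_zero]

/-- The quotient of the Yangian double by `ħ^n`. -/
def YangianDouble.modHbar (K : KacMoodyDatum I 𝔥) (n : ℕ) :
    YangianDouble K →+* DFree I 𝔥 ⧸ (doubleIdealMod K n).asIdeal :=
  Ideal.Quotient.factor (S := (doubleIdeal K).asIdeal) (T := (doubleIdealMod K n).asIdeal)
    (fun _ hx => (iInf_le (doubleIdealMod K) n : doubleIdeal K ≤ _) hx)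

theorem YangianDouble.modHbar_mk (K : KacMoodyDatum I 𝔥) (n : ℕ) (x : DFree I 𝔥) :
    YangianDouble.modHbar K n (YangianDouble.mk K x) = Ideal.Quotient.mk _ x := rfl

/-- The homomorphism `ℂ⟨X⟩⟦ħ⟧ → DY_ħ 𝔤` that induces `χ_c`. -/
def chiFree (K : KacMoodyDatum I 𝔥) (c : ℂˣ) : DFree I 𝔥 →ₐ[ℂ] YangianDouble K :=
  (YangianDouble.mk K).comp (twist (c : ℂ)
    (FreeAlgebra.lift ℂ fun a : Gen I 𝔥 ℤ => ((c : ℂ) ^ a.deg) • FreeAlgebra.ι ℂ a))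

theorem chiFree_X (K : KacMoodyDatum I 𝔥) (c : ℂˣ) :
    chiFree K c PowerSeries.X = (c : ℂ) • YangianDouble.hbar K := by
  rw [chiFree, AlgHom.comp_apply, YangianDouble.hbar, ← map_smul]
  congr 1
  ext n
  simp only [twist, AlgHom.coe_mk, RingHom.coe_mk, MonoidHom.coe_mk, OneHom.coe_mk,
    PowerSeries.coeff_mk, PowerSeries.coeff_X, PowerSeries.coeff_smul]
  split_ifs with h <;> simp [h]

theorem chiFree_gen (K : KacMoodyDatum I 𝔥) (c : ℂˣ) (a : Gen I 𝔥 ℤ) :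
    chiFree K c (dfreeGen I 𝔥 a) = ((c : ℂ) ^ a.deg) • YangianDouble.gen K a := by
  rw [chiFree, AlgHom.comp_apply, YangianDouble.gen, ← map_smul]
  congr 1
  ext n
  simp only [twist, dfreeGen, AlgHom.coe_mk, RingHom.coe_mk, MonoidHom.coe_mk, OneHom.coe_mk,
    PowerSeries.coeff_mk, PowerSeries.coeff_C, PowerSeries.coeff_smul]
  split_ifs with h <;> simp [h]

/-- The gradation automorphism `χ_c` of the Yangian double: it multiplies a homogeneous element of
degree `k` by `c^k`; thus `ħ ↦ cħ`, `h ↦ h`, `X_{ir}^± ↦ c^r X_{ir}^±` and `H_{ir} ↦ c^r H_{ir}`. -/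
def chi (K : KacMoodyDatum I 𝔥) (c : ℂˣ) : YangianDouble K →ₐ[ℂ] YangianDouble K :=
  YangianDouble.lift (chiFree K c) (fun n => TwoSidedIdeal.ker (YangianDouble.modHbar K n)) (by
      intro y hx
      obtain ⟨x, rfl⟩ := YangianDouble.mk_surjective K y
      refine Ideal.Quotient.eq_zero_iff_mem.mpr ?_
      rw [TwoSidedIdeal.mem_asIdeal, doubleIdeal, TwoSidedIdeal.mem_iInf]
      intro n
      have h1 := (TwoSidedIdeal.mem_ker _).mp (hx n)
      rw [YangianDouble.modHbar_mk] at h1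
      exact Ideal.Quotient.eq_zero_iff_mem.mp h1) (by
      intro r hr n
      simp only [chiFree_X, chiFree_gen] at hr
      rw [(YangianDouble.satisfies K).scale c r hr]
      exact TwoSidedIdeal.zero_mem _) (by
      intro n
      rw [chiFree_X, YangianDouble.hbar, ← map_smul, ← map_pow, TwoSidedIdeal.mem_ker,
        YangianDouble.modHbar_mk, smul_pow]
      refine Ideal.Quotient.eq_zero_iff_mem.mpr ?_
      rw [TwoSidedIdeal.mem_asIdeal, Algebra.smul_def]
      exact TwoSidedIdeal.mul_mem_left _ _ _ (TwoSidedIdeal.subset_span (Or.inr rfl)))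

/-! ### Evaluation of the Yangian double, and the evaluation ideal -/

/-- The values of the evaluation map `DY_ħ 𝔤 → U(𝔤)` on the generators. -/
def evGen (K : KacMoodyDatum I 𝔥) (c : ℂˣ) :
    Gen I 𝔥 ℤ → UniversalEnvelopingAlgebra ℂ (KacMoodyAlgebra K)
  | .h a => UniversalEnvelopingAlgebra.ι ℂ (KacMoodyAlgebra.h K a)
  | .x ε i r => ((c : ℂ) ^ r) • UniversalEnvelopingAlgebra.ι ℂ (KacMoodyAlgebra.x K ε i)
  | .H i r => ((c : ℂ) ^ r) • (K.d i : ℂ) •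
      UniversalEnvelopingAlgebra.ι ℂ (KacMoodyAlgebra.h K (K.coroot i))

namespace KacMoodyAlgebra

variable (K : KacMoodyDatum I 𝔥)

theorem h_add (a b : 𝔥) : h K (a + b) = h K a + h K b := by
  have h1 := mk_relator K (KMRelator.add a b)
  rw [map_sub, map_add] at h1
  exact sub_eq_zero.mp h1

theorem h_smul (z : ℂ) (a : 𝔥) : h K (z • a) = z • h K a := by
  have h1 := mk_relator K (KMRelator.smul z a)
  rw [map_sub, map_smul] at h1
  exact sub_eq_zero.mp h1

theorem lie_h_h (a b : 𝔥) : ⁅h K a, h K b⁆ = 0 := by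
  have h1 := mk_relator K (KMRelator.hh a b)
  rwa [LieHom.map_lie] at h1

theorem lie_h_x (a : 𝔥) (ε : ℤˣ) (j : I) :
    ⁅h K a, x K ε j⁆ = (((ε : ℤ) : ℂ) * K.root j a) • x K ε j := by
  have h1 := mk_relator K (KMRelator.he a ε j)
  rw [map_sub, LieHom.map_lie, map_smul, sub_eq_zero] at h1
  rw [x, lie_smul, h, h1, smul_comm]

theorem sqrt_mul_sqrt (i : I) : ((Real.sqrt (K.d i) : ℝ) : ℂ) * ((Real.sqrt (K.d i) : ℝ) : ℂ) =
    (K.d i : ℂ) := by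
  rw [← Complex.ofReal_mul, Real.mul_self_sqrt (Nat.cast_nonneg _), Complex.ofReal_natCast]

theorem lie_x_x (i j : I) :
    ⁅x K 1 i, x K (-1) j⁆ = if i = j then (K.d i : ℂ) • h K (K.coroot i) else 0 := by
  have h1 := mk_relator K (KMRelator.ef i j)
  rw [map_sub, LieHom.map_lie, sub_eq_zero] at h1
  rw [x, x, lie_smul, smul_lie, h1]
  split_ifs with hij
  · subst hij
    rw [smul_smul, sqrt_mul_sqrt]
    rfl
  · simp

theorem serre_e (ε : ℤˣ) (i j : I) (hij : i ≠ j) :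
    (LieAlgebra.ad ℂ (KacMoodyAlgebra K) (mk K (freeE 𝔥 ε i)) ^ K.serreExp i j)
      (mk K (freeE 𝔥 ε j)) = 0 := by
  have h1 := mk_relator K (KMRelator.serre ε i j hij)
  have key : ∀ (n : ℕ) (y : FreeLieAlgebra ℂ (KMGen I 𝔥)),
      mk K ((LieAlgebra.ad ℂ (FreeLieAlgebra ℂ (KMGen I 𝔥)) (freeE 𝔥 ε i) ^ n) y) =
      (LieAlgebra.ad ℂ (KacMoodyAlgebra K) (mk K (freeE 𝔥 ε i)) ^ n) (mk K y) := by
    intro n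
    induction n with
    | zero => intro y; rfl
    | succ n ih =>
      intro y
      rw [pow_succ, pow_succ, Module.End.mul_apply, Module.End.mul_apply, ih, LieAlgebra.ad_apply,
        LieAlgebra.ad_apply, LieHom.map_lie]
  rwa [key] at h1

theorem serre_x (ε : ℤˣ) (i j : I) (hij : i ≠ j) :
    (LieAlgebra.ad ℂ (KacMoodyAlgebra K) (x K ε i) ^ K.serreExp i j) (x K ε j) = 0 := by
  rw [x, x, map_smul, map_smul, smul_pow, LinearMap.smul_apply, serre_e K ε i j hij, smul_zero,
    smul_zero]

end KacMoodyAlgebra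

theorem ι_lie {L : Type*} [LieRing L] [LieAlgebra ℂ L] (a b : L) :
    UniversalEnvelopingAlgebra.ι ℂ ⁅a, b⁆ =
      UniversalEnvelopingAlgebra.ι ℂ a * UniversalEnvelopingAlgebra.ι ℂ b -
        UniversalEnvelopingAlgebra.ι ℂ b * UniversalEnvelopingAlgebra.ι ℂ a := by
  let _ : LieRing (UniversalEnvelopingAlgebra ℂ L) := LieRing.ofAssociativeRing
  exact LieHom.map_lie (UniversalEnvelopingAlgebra.ι ℂ) a b

theorem serreSum_const {R : Type*} [Ring R] [Algebra ℂ R] (m : ℕ) (y z : R) :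
    serreSum (fun _ : Fin m => y) z = (m.factorial : ℂ) • (adL R y ^ m) z := by
  simp only [serreSum, List.ofFn_const, List.prod_replicate, Finset.sum_const, Finset.card_univ,
    Fintype.card_perm, Fintype.card_fin]
  rw [Nat.cast_smul_eq_nsmul]

theorem evGen_currentRel (K : KacMoodyDatum I 𝔥) :
    CurrentRel K (0 : ℂ) (0 : UniversalEnvelopingAlgebra ℂ (KacMoodyAlgebra K))
      (fun a => UniversalEnvelopingAlgebra.ι ℂ (KacMoodyAlgebra.h K a))
      (fun ε i => LinearMap.toSpanSingleton ℂ _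
        (UniversalEnvelopingAlgebra.ι ℂ (KacMoodyAlgebra.x K ε i)))
      (fun i => LinearMap.toSpanSingleton ℂ _
        ((K.d i : ℂ) • UniversalEnvelopingAlgebra.ι ℂ (KacMoodyAlgebra.h K (K.coroot i)))) where
  add a b := by rw [KacMoodyAlgebra.h_add, map_add]
  smul z a := by rw [KacMoodyAlgebra.h_smul, map_smul]
  y_one i := by simp
  yy i j p q := by
    have h1 := ι_lie (KacMoodyAlgebra.h K (K.coroot i)) (KacMoodyAlgebra.h K (K.coroot j))
    rw [KacMoodyAlgebra.lie_h_h, map_zero] at h1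
    simp only [LinearMap.toSpanSingleton_apply, smul_smul]
    rw [Ring.lie_def, smul_mul_smul_comm, smul_mul_smul_comm, mul_comm (q * _), ← smul_sub, ← h1,
      smul_zero]
  yh i p a := by
    have h1 := ι_lie (KacMoodyAlgebra.h K (K.coroot i)) (KacMoodyAlgebra.h K a)
    rw [KacMoodyAlgebra.lie_h_h, map_zero] at h1
    simp only [LinearMap.toSpanSingleton_apply, smul_smul]
    rw [Ring.lie_def, smul_mul_assoc, mul_smul_comm, ← smul_sub, ← h1, smul_zero]
  hh a b := by
    have h1 := ι_lie (KacMoodyAlgebra.h K a) (KacMoodyAlgebra.h K b)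
    rw [KacMoodyAlgebra.lie_h_h, map_zero] at h1
    rw [Ring.lie_def, ← h1]
  hx a ε j q := by
    have h1 := ι_lie (KacMoodyAlgebra.h K a) (KacMoodyAlgebra.x K ε j)
    rw [KacMoodyAlgebra.lie_h_x, map_smul] at h1
    simp only [LinearMap.toSpanSingleton_apply]
    rw [Ring.lie_def, smul_mul_assoc, mul_smul_comm, ← smul_sub, ← h1, smul_comm]
  xx_opp i j p q := by
    have h1 := ι_lie (KacMoodyAlgebra.x K 1 i) (KacMoodyAlgebra.x K (-1) j)
    simp only [LinearMap.toSpanSingleton_apply]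
    rw [Ring.lie_def, smul_mul_smul_comm, smul_mul_smul_comm, mul_comm q, ← smul_sub, ← h1,
      KacMoodyAlgebra.lie_x_x]
    split_ifs with hij
    · rw [map_smul]
    · simp
  yx ε i j p q := by simp [Ring.lie_def]
  xx ε i j p q := by simp [Ring.lie_def]
  serre ε i j hij p q := by
    simp only [LinearMap.toSpanSingleton_apply]
    rw [serreSum_smul_smul, serreSum_const]
    have key : ∀ (n : ℕ) (a : KacMoodyAlgebra K),
        UniversalEnvelopingAlgebra.ι ℂ
          ((LieAlgebra.ad ℂ (KacMoodyAlgebra K) (KacMoodyAlgebra.x K ε i) ^ n) a) =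
        (adL (UniversalEnvelopingAlgebra ℂ (KacMoodyAlgebra K))
          (UniversalEnvelopingAlgebra.ι ℂ (KacMoodyAlgebra.x K ε i)) ^ n)
            (UniversalEnvelopingAlgebra.ι ℂ a) := by
      intro n
      induction n with
      | zero => intro a; rfl
      | succ n ih =>
        intro a
        rw [pow_succ, pow_succ, Module.End.mul_apply, Module.End.mul_apply, ih, adL_apply,
          LieAlgebra.ad_apply, ι_lie]
    rw [← key, KacMoodyAlgebra.serre_x K ε i j hij, map_zero, smul_zero, smul_zero]

theorem satisfies_evGen (K : KacMoodyDatum I 𝔥) (c : ℂˣ) : Satisfies K 0 (evGen K c) := by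
  refine (evGen_currentRel K).satisfies (c : ℂ) (fun r : ℤ => (c : ℂ) ^ r) (zpow_zero _) ?_ ?_ _
    (fun a => rfl) (fun ε i r => rfl) (fun i r => rfl)
  · intro r
    rw [zero_mul, add_zero, zpow_add₀ c.ne_zero, zpow_one, smul_eq_mul, mul_comm]
  · intro r s
    exact zpow_add₀ c.ne_zero r s

/-- The homomorphism `ℂ⟨X⟩⟦ħ⟧ → U(𝔤)`, with `ħ ↦ 0`, that induces the evaluation map. -/
def evFree (K : KacMoodyDatum I 𝔥) (c : ℂˣ) :
    DFree I 𝔥 →ₐ[ℂ] UniversalEnvelopingAlgebra ℂ (KacMoodyAlgebra K) :=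
  (FreeAlgebra.lift ℂ (evGen K c)).comp
    { (PowerSeries.constantCoeff : DFree I 𝔥 →+* FreeAlgebra ℂ (Gen I 𝔥 ℤ)) with
      commutes' := fun a => by
        change PowerSeries.constantCoeff (algebraMap ℂ (DFree I 𝔥) a) = _
        rw [PowerSeries.algebraMap_apply, PowerSeries.constantCoeff_C] }

theorem evFree_apply (K : KacMoodyDatum I 𝔥) (c : ℂˣ) (x : DFree I 𝔥) :
    evFree K c x = FreeAlgebra.lift ℂ (evGen K c) (PowerSeries.constantCoeff x) := rfl

/-- The evaluation homomorphism at `t = c`, which is the composite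
`DY_ħ 𝔤 → DY_ħ 𝔤 / ħ = U(𝔱 ⋊ 𝔥') → U(𝔤'[t^{±1}] ⋊ 𝔥') → U(𝔤)` of the specialization `ħ ↦ 0`, of
`X_{ir}^± ↦ x_i^± t^r`, `H_{ir} ↦ d_i α_i^∨ t^r`, and of the specialization `t ↦ c`. -/
def ev (K : KacMoodyDatum I 𝔥) (c : ℂˣ) :
    YangianDouble K →ₐ[ℂ] UniversalEnvelopingAlgebra ℂ (KacMoodyAlgebra K) :=
  YangianDouble.lift (evFree K c) (fun n => if n = 0 then ⊤ else ⊥) (by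
      intro x hx
      simpa using hx 1) (by
      intro r hr n
      simp only [evFree_apply, dfreeGen, PowerSeries.constantCoeff_X, PowerSeries.constantCoeff_C,
        map_zero, FreeAlgebra.lift_ι_apply] at hr
      rw [satisfies_evGen K c r hr]
      exact TwoSidedIdeal.zero_mem _) (by
      intro n
      rcases Nat.eq_zero_or_pos n with rfl | hn
      · simp
      · rw [evFree_apply, PowerSeries.constantCoeff_X, map_zero, zero_pow hn.ne']
        exact TwoSidedIdeal.zero_mem _)

/-- The evaluation ideal `𝒥_c` of the Yangian double. -/
def evalIdeal (K : KacMoodyDatum I 𝔥) (c : ℂˣ) : Ideal (YangianDouble K) := RingHom.ker (ev K c)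

instance (K : KacMoodyDatum I 𝔥) (c : ℂˣ) : (evalIdeal K c).IsTwoSided :=
  inferInstanceAs (RingHom.ker (ev K c)).IsTwoSided

/-! ### The homomorphism `Φ_c` -/

/-- The two-sided ideal `T^n R⟦T⟧`. -/
def tIdeal (R : Type*) [Ring R] (n : ℕ) : TwoSidedIdeal R⟦X⟧ :=
  TwoSidedIdeal.mk' {f | ∀ k < n, PowerSeries.coeff k f = 0}
    (fun k _ => map_zero _)
    (fun {f g} hf hg k hk => by rw [map_add, hf k hk, hg k hk, add_zero])
    (fun {f} hf k hk => by rw [map_neg, hf k hk, neg_zero])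
    (fun {f g} hg k hk => by
      rw [PowerSeries.coeff_mul]
      refine Finset.sum_eq_zero fun p hp => ?_
      have h1 := Finset.HasAntidiagonal.mem_antidiagonal.mp hp
      rw [hg p.2 (by omega), mul_zero])
    (fun {f g} hf k hk => by
      rw [PowerSeries.coeff_mul]
      refine Finset.sum_eq_zero fun p hp => ?_
      have h1 := Finset.HasAntidiagonal.mem_antidiagonal.mp hp
      rw [hf p.1 (by omega), zero_mul])

theorem mem_tIdeal {R : Type*} [Ring R] {n : ℕ} {f : R⟦X⟧} :
    f ∈ tIdeal R n ↔ ∀ k < n, PowerSeries.coeff k f = 0 := by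
  rw [tIdeal, TwoSidedIdeal.mem_mk']
  rfl

theorem list_adL_central {R : Type*} [Ring R] [Algebra ℂ R] (T : R) (hT : ∀ r, T * r = r * T)
    (l : List (ℕ × R)) (s : ℕ) (z : R) :
    (l.map fun a => adL R (T ^ a.1 * a.2)).prod (T ^ s * z) =
      T ^ ((l.map Prod.fst).sum + s) * (l.map fun a => adL R a.2).prod z := by
  have hp : ∀ k r, r * T ^ k = T ^ k * r := fun k r => ((Commute.pow_left (hT r) k).eq).symm
  induction l with
  | nil => simp
  | cons a l ih =>
    simp only [List.map_cons, List.prod_cons, List.sum_cons, Module.End.mul_apply, ih, adL_apply]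
    generalize (l.map fun a => adL R a.2).prod z = w
    rw [mul_sub, add_assoc, pow_add T a.1]
    congr 1
    · rw [mul_assoc, ← mul_assoc a.2, hp _ a.2]
      simp only [mul_assoc]
    · rw [mul_assoc, ← mul_assoc w, hp _ w, ← mul_assoc, ← mul_assoc, ← pow_add, ← pow_add,
        add_comm a.1]
      simp only [mul_assoc]

theorem serreSum_central {R : Type*} [Ring R] [Algebra ℂ R] (T : R) (hT : ∀ r, T * r = r * T)
    {m : ℕ} (n : Fin m → ℕ) (y : Fin m → R) (s : ℕ) (z : R) :
    serreSum (fun k => T ^ n k * y k) (T ^ s * z) = T ^ (∑ k, n k + s) * serreSum y z := by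
  rw [serreSum, serreSum, Finset.mul_sum]
  refine Finset.sum_congr rfl fun π _ => ?_
  have h1 := list_adL_central T hT (List.ofFn fun k => (n (π k), y (π k))) s z
  simp only [List.map_ofFn, Function.comp_def, List.sum_ofFn] at h1
  rw [h1, Equiv.sum_comp π n]

/-- Rescaling a solution of the relations by powers of a central element. -/
theorem Satisfies.central {K : KacMoodyDatum I 𝔥} {R : Type*} [Ring R] [Algebra ℂ R] {hb : R}
    {g : Gen I 𝔥 ℕ → R} (S : Satisfies K hb g) (T : R) (hT : ∀ r, T * r = r * T) :
    Satisfies K (T * hb) (fun a => T ^ a.deg * g a) := by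
  have hp : ∀ k r, r * T ^ k = T ^ k * r := fun k r => ((Commute.pow_left (hT r) k).eq).symm
  have mm : ∀ (r s : ℕ) (a b : R), (T ^ r * a) * (T ^ s * b) = T ^ (r + s) * (a * b) := by
    intro r s a b
    rw [mul_assoc, ← mul_assoc a, hp, pow_add]
    simp only [mul_assoc]
  have lie : ∀ (r s : ℕ) (a b : R), ⁅T ^ r * a, T ^ s * b⁆ = T ^ (r + s) * ⁅a, b⁆ := by
    intro r s a b
    rw [Ring.lie_def, Ring.lie_def, mm, mm, mul_sub, add_comm s r]
  have quad : ∀ (r s : ℕ) (z : ℂ) (a a' b b' : R),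
      ⁅a', b⁆ - ⁅a, b'⁆ - z • (hb * (a * b + b * a)) = 0 →
      ⁅T ^ (r + 1) * a', T ^ s * b⁆ - ⁅T ^ r * a, T ^ (s + 1) * b'⁆ -
        z • ((T * hb) * ((T ^ r * a) * (T ^ s * b) + (T ^ s * b) * (T ^ r * a))) = 0 := by
    intro r s z a a' b b' h
    have h3 : (T * hb) * ((T ^ r * a) * (T ^ s * b) + (T ^ s * b) * (T ^ r * a)) =
        T ^ (r + s + 1) * (hb * (a * b + b * a)) := by
      rw [mm, mm, add_comm s r, ← mul_add]
      have := mm 1 (r + s) hb (a * b + b * a)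
      rw [pow_one, add_comm 1] at this
      exact this
    rw [lie, lie, h3, show r + 1 + s = r + s + 1 by omega, show r + (s + 1) = r + s + 1 by omega,
      ← mul_sub, ← mul_smul_comm, ← mul_sub, h, mul_zero]
  intro r hr
  cases hr with
  | add a b =>
    simp only [Gen.deg, pow_zero, one_mul]
    exact S _ (.add a b)
  | smul z a =>
    simp only [Gen.deg, pow_zero, one_mul]
    exact S _ (.smul z a)
  | H_zero i =>
    simp only [Gen.deg, pow_zero, one_mul]
    exact S _ (.H_zero i)
  | HH i j r s => rw [lie, S _ (.HH i j r s), mul_zero]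
  | Hh i r a => rw [lie, S _ (.Hh i r a), mul_zero]
  | hh a b => rw [lie, S _ (.hh a b), mul_zero]
  | hx a ε j s =>
    rw [lie, sub_eq_zero.mp (S _ (.hx a ε j s))]
    simp only [Gen.deg, zero_add, mul_smul_comm, sub_self]
  | xx_opp i j r s =>
    rw [lie, sub_eq_zero.mp (S _ (.xx_opp i j r s))]
    simp only [Gen.deg, mul_ite, mul_zero, sub_self]
  | Hx ε i j r s => exact quad r s _ _ _ _ _ (S _ (.Hx ε i j r s))
  | xx ε i j r s => exact quad r s _ _ _ _ _ (S _ (.xx ε i j r s))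
  | serre ε i j hij r s =>
    simp only [Gen.deg]
    rw [serreSum_central T hT, S _ (.serre ε i j hij r s), mul_zero]

/-- The `ℂ`-algebra homomorphism `R → R⟦T⟧`. -/
def constHom (R : Type*) [Ring R] [Algebra ℂ R] : R →ₐ[ℂ] R⟦X⟧ :=
  { (PowerSeries.C : R →+* R⟦X⟧) with
    commutes' := fun a => by
      rw [PowerSeries.algebraMap_apply]
      rfl }

/-- The linear map `ℂ⟦T⟧ → R⟦T⟧`, `∑ a_n T^n ↦ ∑ a_n f(n) T^n`. -/
def current {R : Type*} [Ring R] [Algebra ℂ R] (f : ℕ → R) : ℂ⟦X⟧ →ₗ[ℂ] R⟦X⟧ where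
  toFun p := PowerSeries.mk fun n => PowerSeries.coeff n p • f n
  map_add' p q := by
    ext n
    simp [add_smul]
  map_smul' z p := by
    ext n
    simp [mul_smul]

theorem coeff_current {R : Type*} [Ring R] [Algebra ℂ R] (f : ℕ → R) (p : ℂ⟦X⟧) (n : ℕ) :
    PowerSeries.coeff n (current f p) = PowerSeries.coeff n p • f n := by
  simp [current]

theorem coeff_modeMap {R : Type*} [Ring R] [Algebra ℂ R] (f : ℕ → R) (p : ℂ[X]) (n : ℕ) :
    PowerSeries.coeff n (modeMap (fun k => (PowerSeries.X : R⟦X⟧) ^ k * constHom R (f k)) p) =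
      p.coeff n • f n := by
  induction p using Polynomial.induction_on' with
  | add p q h1 h2 => rw [map_add, map_add, h1, h2, Polynomial.coeff_add, add_smul]
  | monomial k a =>
    rw [modeMap_monomial, PowerSeries.coeff_smul, Polynomial.coeff_monomial]
    change a • PowerSeries.coeff n (PowerSeries.X ^ k * PowerSeries.C (f k)) = _
    rw [PowerSeries.coeff_mul_C, PowerSeries.coeff_X_pow]
    by_cases h : k = n
    · subst h
      simp
    · rw [if_neg (Ne.symm h), if_neg h]
      simp

namespace Yangian

variable (K : KacMoodyDatum I 𝔥)

/-- The quotient map `Y⟦T⟧ → Y⟦T⟧ / T^N`. -/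
def modT (N : ℕ) : (Yangian K)⟦X⟧ →ₐ[ℂ] (Yangian K)⟦X⟧ ⧸ (tIdeal (Yangian K) N).asIdeal :=
  Ideal.Quotient.mkₐ ℂ (tIdeal (Yangian K) N).asIdeal

theorem modT_current (N : ℕ) (f : ℕ → Yangian K) (p : ℂ⟦X⟧) (p' : ℂ[X])
    (h : ∀ k < N, PowerSeries.coeff k p = p'.coeff k) : modT K N (current f p) =
      modeMap (fun k => modT K N (PowerSeries.X ^ k * constHom _ (f k))) p' := by
  have h1 : modeMap (fun k => modT K N (PowerSeries.X ^ k * constHom _ (f k))) p' =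
      modT K N (modeMap (fun k => PowerSeries.X ^ k * constHom _ (f k)) p') := by
    clear h
    induction p' using Polynomial.induction_on' with
    | add p q h1 h2 => rw [map_add, map_add, map_add, h1, h2]
    | monomial k a => rw [modeMap_monomial, modeMap_monomial, map_smul]
  rw [h1]
  refine Ideal.Quotient.eq.mpr ?_
  rw [TwoSidedIdeal.mem_asIdeal, mem_tIdeal]
  intro k hk
  rw [map_sub, coeff_current, coeff_modeMap, h k hk, sub_self]

/-- Currents on `ℂ⟦T⟧` with values in `Y⟦T⟧ / T^N`. -/
theorem currentRel_modT (N : ℕ) :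
    CurrentRel K (PowerSeries.X : ℂ⟦X⟧) (modT K N (PowerSeries.X * constHom _ (hbar K)))
      (fun a => modT K N (constHom _ (gen K (.h a))))
      (fun ε i => (modT K N).toLinearMap ∘ₗ current fun n => gen K (.x ε i n))
      (fun i => (modT K N).toLinearMap ∘ₗ current fun n => gen K (.H i n)) := by
  have hX : ∀ r : (Yangian K)⟦X⟧, PowerSeries.X * r = r * PowerSeries.X := fun r =>
    (PowerSeries.commute_X r).eq.symm
  have C := ((((satisfies K).map (constHom (Yangian K))).central PowerSeries.X hX).map
    (modT K N)).currentRel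
  have hh : ∀ a, modT K N (constHom _ (gen K (.h a))) =
      modT K N (PowerSeries.X ^ (Gen.h a : Gen I 𝔥 ℕ).deg * constHom _ (gen K (.h a))) := by
    intro a
    rw [Gen.deg, pow_zero, one_mul]
  have key : ∀ (f : ℕ → Yangian K) (p : ℂ⟦X⟧),
      modT K N (current f p) =
        modeMap (fun k => modT K N (PowerSeries.X ^ k * constHom _ (f k)))
          (PowerSeries.trunc N p) := by
    intro f p
    refine modT_current K N f p _ fun k hk => ?_
    rw [PowerSeries.coeff_trunc, if_pos hk]
  have keyX : ∀ (f : ℕ → Yangian K) (p : ℂ⟦X⟧),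
      modT K N (current f (PowerSeries.X * p)) =
        modeMap (fun k => modT K N (PowerSeries.X ^ k * constHom _ (f k)))
          (Polynomial.X * PowerSeries.trunc N p) := by
    intro f p
    refine modT_current K N f _ _ fun k hk => ?_
    rcases k with _ | k
    · simp
    · rw [PowerSeries.coeff_succ_X_mul, Polynomial.coeff_X_mul, PowerSeries.coeff_trunc,
        if_pos (by omega)]
  have keymul : ∀ (f : ℕ → Yangian K) (p q : ℂ⟦X⟧),
      modT K N (current f (p * q)) =
        modeMap (fun k => modT K N (PowerSeries.X ^ k * constHom _ (f k)))
          (PowerSeries.trunc N p * PowerSeries.trunc N q) := by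
    intro f p q
    refine modT_current K N f _ _ fun k hk => ?_
    rw [PowerSeries.coeff_mul, Polynomial.coeff_mul]
    refine Finset.sum_congr rfl fun x hx => ?_
    have h1 := Finset.HasAntidiagonal.mem_antidiagonal.mp hx
    rw [PowerSeries.coeff_trunc, PowerSeries.coeff_trunc, if_pos (by omega), if_pos (by omega)]
  exact
  { add := fun a b => by simp only [hh]; exact C.add a b
    smul := fun z a => by simp only [hh]; exact C.smul z a
    y_one := fun i => by
      have h1 := modT_current K N (fun n => gen K (.H i n)) 1 1 (fun k _ => by
        rw [PowerSeries.coeff_one, Polynomial.coeff_one])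
      simp only [hh, LinearMap.comp_apply, AlgHom.toLinearMap_apply, h1]
      exact C.y_one i
    yy := fun i j p q => by
      simp only [LinearMap.comp_apply, AlgHom.toLinearMap_apply, key]
      exact C.yy i j _ _
    yh := fun i p a => by
      simp only [hh, LinearMap.comp_apply, AlgHom.toLinearMap_apply, key]
      exact C.yh i _ a
    hh := fun a b => by simp only [hh]; exact C.hh a b
    hx := fun a ε j q => by
      simp only [hh, LinearMap.comp_apply, AlgHom.toLinearMap_apply, key]
      exact C.hx a ε j _
    xx_opp := fun i j p q => by
      simp only [LinearMap.comp_apply, AlgHom.toLinearMap_apply, keymul, key]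
      exact C.xx_opp i j _ _
    yx := fun ε i j p q => by
      simp only [LinearMap.comp_apply, AlgHom.toLinearMap_apply, keyX, key]
      exact C.yx ε i j _ _
    xx := fun ε i j p q => by
      simp only [LinearMap.comp_apply, AlgHom.toLinearMap_apply, keyX, key]
      exact C.xx ε i j _ _
    serre := fun ε i j hij p q => by
      simp only [LinearMap.comp_apply, AlgHom.toLinearMap_apply, key]
      exact C.serre ε i j hij _ _ }

end Yangian

/-- The binomial series `(c + T)^r = ∑_n binom(r, n) c^{r-n} T^n`, for `r ∈ ℤ`. -/
def binomSeries (c : ℂˣ) (r : ℤ) : ℂ⟦X⟧ :=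
  PowerSeries.mk fun n => ((Ring.choose r n : ℤ) : ℂ) * (c : ℂ) ^ (r - n)

theorem binomSeries_zero (c : ℂˣ) : binomSeries c 0 = 1 := by
  ext n
  rw [binomSeries, PowerSeries.coeff_mk, PowerSeries.coeff_one]
  rcases n with _ | n
  · simp
  · rw [Ring.choose_zero_succ]
    simp

theorem binomSeries_succ (c : ℂˣ) (r : ℤ) : binomSeries c (r + 1) =
    (c : ℂ) • binomSeries c r + PowerSeries.X * binomSeries c r := by
  ext n
  rw [map_add, PowerSeries.coeff_smul]
  have hc := c.ne_zero
  rcases n with _ | n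
  · simp only [binomSeries, PowerSeries.coeff_mk, PowerSeries.coeff_zero_X_mul,
      Ring.choose_zero_right, smul_eq_mul]
    simp only [Nat.cast_zero, sub_zero, add_zero, Int.cast_one, one_mul, zpow_add_one₀ hc]
    ring
  · rw [PowerSeries.coeff_succ_X_mul]
    simp only [binomSeries, PowerSeries.coeff_mk, Ring.choose_succ_succ, smul_eq_mul]
    have h1 : r + 1 - ((n + 1 : ℕ) : ℤ) = r - n := by
      push_cast
      ring
    have h2 : (c : ℂ) ^ (r - (n : ℤ)) = c * (c : ℂ) ^ (r - ((n + 1 : ℕ) : ℤ)) := by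
      rw [← zpow_one_add₀ hc]
      congr 1
      push_cast
      ring
    rw [h1, h2, Int.cast_add]
    ring

theorem binomSeries_add (c : ℂˣ) (r s : ℤ) :
    binomSeries c (r + s) = binomSeries c r * binomSeries c s := by
  have hs : ∀ r : ℤ, binomSeries c (r + 1) =
      (PowerSeries.C (c : ℂ) + PowerSeries.X) * binomSeries c r := by
    intro r
    rw [binomSeries_succ, add_mul, PowerSeries.smul_eq_C_mul]
  have h0 : (PowerSeries.C (c : ℂ) + PowerSeries.X : ℂ⟦X⟧) ≠ 0 := by
    intro h
    have := congrArg PowerSeries.constantCoeff h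
    simp at this
  induction r using Int.induction_on with
  | zero => rw [zero_add, binomSeries_zero, one_mul]
  | succ k ih => rw [add_right_comm, hs, hs, ih, mul_assoc]
  | pred k ih =>
    have h1 := hs (-(k : ℤ) - 1 + s)
    have h2 := hs (-(k : ℤ) - 1)
    rw [show -(k : ℤ) - 1 + s + 1 = -(k : ℤ) + s by ring, ih] at h1
    rw [show -(k : ℤ) - 1 + 1 = -(k : ℤ) by ring] at h2
    rw [h2, mul_assoc] at h1
    exact (mul_left_cancel₀ h0 h1).symm

/-- The values of `Φ_c` on the generators: `Φ_c(h) = h`,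
`Φ_c(X_{ir}^±) = ∑_n binom(r, n) c^{r-n} x_{in}^±`, `Φ_c(H_{ir}) = ∑_n binom(r, n) c^{r-n} h_{in}`;
the variable `T` keeps track of the degree. -/
def phiGen (K : KacMoodyDatum I 𝔥) (c : ℂˣ) : Gen I 𝔥 ℤ → (Yangian K)⟦X⟧
  | .h a => PowerSeries.C (Yangian.gen K (.h a))
  | .x ε i r => PowerSeries.mk fun n =>
      (((Ring.choose r n : ℤ) : ℂ) * (c : ℂ) ^ (r - n)) • Yangian.gen K (.x ε i n)
  | .H i r => PowerSeries.mk fun n =>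
      (((Ring.choose r n : ℤ) : ℂ) * (c : ℂ) ^ (r - n)) • Yangian.gen K (.H i n)

theorem satisfies_phiGen (K : KacMoodyDatum I 𝔥) (c : ℂˣ) (N : ℕ) :
    Satisfies K (Yangian.modT K N (PowerSeries.X * constHom _ (Yangian.hbar K)))
      (fun a => Yangian.modT K N (phiGen K c a)) := by
  have key : ∀ (f : ℕ → Yangian K) (r : ℤ), (PowerSeries.mk fun n =>
      (((Ring.choose r n : ℤ) : ℂ) * (c : ℂ) ^ (r - n)) • f n) = current f (binomSeries c r) := by
    intro f r
    ext n
    rw [PowerSeries.coeff_mk, coeff_current, binomSeries, PowerSeries.coeff_mk]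
  refine (Yangian.currentRel_modT K N).satisfies (c : ℂ) (binomSeries c) (binomSeries_zero c)
    (binomSeries_succ c) (binomSeries_add c) _ (fun a => rfl) (fun ε i r => ?_) (fun i r => ?_)
  · simp only [phiGen, key]
    rfl
  · simp only [phiGen, key]
    rfl

/-- The homomorphism `ℂ⟨X⟩⟦ħ⟧ → Y⟦T⟧`, with `ħ ↦ ħT`, that induces `Φ_c`. -/
def phiFree (K : KacMoodyDatum I 𝔥) (c : ℂˣ) : DFree I 𝔥 →ₐ[ℂ] (Yangian K)⟦X⟧ :=
  hEval (FreeAlgebra.lift ℂ (phiGen K c)) (Yangian.hbar K) (Yangian.hbar_comm K)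

theorem coeff_hEval {A R : Type*} [Ring A] [Algebra ℂ A] [Ring R] [Algebra ℂ R] (φ : A →ₐ[ℂ] R⟦X⟧)
    (z : R) (hz : ∀ r, z * r = r * z) (f : A⟦X⟧) (n : ℕ) : PowerSeries.coeff n (hEval φ z hz f) =
      ∑ p ∈ Finset.HasAntidiagonal.antidiagonal n,
        z ^ p.1 * PowerSeries.coeff p.2 (φ (PowerSeries.coeff p.1 f)) := by
  simp [hEval]

theorem hEval_C {A R : Type*} [Ring A] [Algebra ℂ A] [Ring R] [Algebra ℂ R] (φ : A →ₐ[ℂ] R⟦X⟧)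
    (z : R) (hz : ∀ r, z * r = r * z) (a : A) : hEval φ z hz (PowerSeries.C a) = φ a := by
  ext n
  rw [coeff_hEval, Finset.Nat.sum_antidiagonal_eq_sum_range_succ_mk, Finset.sum_range_succ',
    Finset.sum_eq_zero]
  · simp
  · intro k _
    simp

theorem hEval_X {A R : Type*} [Ring A] [Algebra ℂ A] [Ring R] [Algebra ℂ R] (φ : A →ₐ[ℂ] R⟦X⟧)
    (z : R) (hz : ∀ r, z * r = r * z) :
    hEval φ z hz PowerSeries.X = PowerSeries.X * constHom R z := by
  ext n
  change _ = PowerSeries.coeff n (PowerSeries.X * PowerSeries.C z)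
  rw [coeff_hEval, Finset.Nat.sum_antidiagonal_eq_sum_range_succ_mk,
    PowerSeries.coeff_mul_C, PowerSeries.coeff_X]
  rcases n with _ | n
  · simp
  · rw [Finset.sum_eq_single 1]
    · rcases n with _ | n
      · simp
      · simp [PowerSeries.coeff_one]
    · intro k _ hk
      rw [PowerSeries.coeff_X, if_neg hk]
      simp
    · intro h
      exact absurd (Finset.mem_range.mpr (by omega)) h

theorem phiFree_gen (K : KacMoodyDatum I 𝔥) (c : ℂˣ) (a : Gen I 𝔥 ℤ) :
    phiFree K c (dfreeGen I 𝔥 a) = phiGen K c a := by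
  rw [phiFree, dfreeGen, hEval_C, FreeAlgebra.lift_ι_apply]

/-- The homomorphism `Φ_c`, with values in `Y⟦T⟧`. -/
def phiSeries (K : KacMoodyDatum I 𝔥) (c : ℂˣ) : YangianDouble K →ₐ[ℂ] (Yangian K)⟦X⟧ :=
  YangianDouble.lift (phiFree K c) (tIdeal (Yangian K))
    (fun x hx => by
      ext n
      exact mem_tIdeal.mp (hx (n + 1)) n (Nat.lt_succ_self n))
    (fun r hr n => by
      have h1 := Relator.map K (Yangian.modT K n) hr
      simp only [phiFree_gen] at h1
      rw [phiFree, hEval_X] at h1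
      have h2 := satisfies_phiGen K c n _ h1
      exact Ideal.Quotient.eq_zero_iff_mem.mp h2)
    (fun n => by
      rw [phiFree, hEval_X, mem_tIdeal]
      intro k hk
      rw [(PowerSeries.commute_X (constHom _ (Yangian.hbar K))).symm.mul_pow,
        PowerSeries.coeff_X_pow_mul', if_neg (by omega)])

theorem phiSeries_mk (K : KacMoodyDatum I 𝔥) (c : ℂˣ) (x : DFree I 𝔥) :
    phiSeries K c (YangianDouble.mk K x) = phiFree K c x := rfl

/-! ### The completed Yangian -/

/-- The completed Yangian `∏_k Y_k`, as the subalgebra of `Y⟦T⟧` of all `∑_k y_k T^k` with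
`y_k ∈ Y_k` (the family `(y_k)` stands for the infinite sum `∑_k y_k`). -/
def YhatSub (K : KacMoodyDatum I 𝔥) : Subalgebra ℂ (Yangian K)⟦X⟧ where
  carrier := {f | ∀ k, PowerSeries.coeff k f ∈ Yangian.grade K k}
  mul_mem' := by
    intro f g hf hg k
    rw [PowerSeries.coeff_mul]
    refine Submodule.sum_mem _ fun p hp => ?_
    rw [← Finset.HasAntidiagonal.mem_antidiagonal.mp hp]
    exact Yangian.mul_mem_grade K (hf _) (hg _)
  add_mem' := by
    intro f g hf hg k
    rw [map_add]
    exact Submodule.add_mem _ (hf k) (hg k)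
  algebraMap_mem' := by
    intro z k
    rw [PowerSeries.algebraMap_apply, PowerSeries.coeff_C]
    split_ifs with h
    · rw [h, Algebra.algebraMap_eq_smul_one]
      exact Submodule.smul_mem _ _ (Yangian.one_mem_grade K)
    · exact Submodule.zero_mem _

theorem mem_YhatSub {K : KacMoodyDatum I 𝔥} {f : (Yangian K)⟦X⟧} :
    f ∈ YhatSub K ↔ ∀ k, PowerSeries.coeff k f ∈ Yangian.grade K k := Iff.rfl

/-- The completed Yangian `∏_k Y_k`. -/
def Yhat (K : KacMoodyDatum I 𝔥) : Type (max u v) := YhatSub K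

namespace Yhat

variable (K : KacMoodyDatum I 𝔥)

instance : Ring (Yhat K) := inferInstanceAs (Ring (YhatSub K))

instance : Algebra ℂ (Yhat K) := inferInstanceAs (Algebra ℂ (YhatSub K))

/-- The embedding into `Y⟦T⟧`. -/
def val : Yhat K →ₐ[ℂ] (Yangian K)⟦X⟧ := (YhatSub K).val

theorem val_injective : Function.Injective (val K) := Subtype.val_injective

theorem val_mem (f : Yhat K) : val K f ∈ YhatSub K := Subtype.property (p := (· ∈ YhatSub K)) f

/-- The component of degree `k`. -/
def comp (k : ℕ) (f : Yhat K) : Yangian K := PowerSeries.coeff k (val K f)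

theorem comp_mem (k : ℕ) (f : Yhat K) : comp K k f ∈ Yangian.grade K k := val_mem K f k

variable {K}

/-- The element `∑_k y_k` of the completed Yangian. -/
def ofComp (y : ℕ → Yangian K) (hy : ∀ k, y k ∈ Yangian.grade K k) : Yhat K :=
  (⟨PowerSeries.mk y, fun k => by rw [PowerSeries.coeff_mk]; exact hy k⟩ : YhatSub K)

theorem comp_ofComp (y : ℕ → Yangian K) (hy : ∀ k, y k ∈ Yangian.grade K k) (k : ℕ) :
    comp K k (ofComp y hy) = y k :=
  PowerSeries.coeff_mk k y

/-- Restriction of the codomain of a homomorphism. -/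
def codRestrict {R : Type*} [Ring R] [Algebra ℂ R] (φ : R →ₐ[ℂ] (Yangian K)⟦X⟧)
    (h : ∀ r, φ r ∈ YhatSub K) : R →ₐ[ℂ] Yhat K :=
  (AlgHom.codRestrict φ (YhatSub K) h : R →ₐ[ℂ] YhatSub K)

theorem val_codRestrict {R : Type*} [Ring R] [Algebra ℂ R] (φ : R →ₐ[ℂ] (Yangian K)⟦X⟧)
    (h : ∀ r, φ r ∈ YhatSub K) (r : R) : val K (codRestrict φ h r) = φ r := rfl

theorem ext_comp {f g : Yhat K} (h : ∀ k, comp K k f = comp K k g) : f = g :=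
  val_injective K (PowerSeries.ext h)

theorem comp_add (k : ℕ) (f g : Yhat K) : comp K k (f + g) = comp K k f + comp K k g := by
  rw [comp, map_add, map_add]
  rfl

theorem comp_sub (k : ℕ) (f g : Yhat K) : comp K k (f - g) = comp K k f - comp K k g := by
  rw [comp, map_sub, map_sub]
  rfl

theorem comp_mul (k : ℕ) (f g : Yhat K) : comp K k (f * g) =
    ∑ p ∈ Finset.HasAntidiagonal.antidiagonal k, comp K p.1 f * comp K p.2 g := by
  rw [comp, map_mul, PowerSeries.coeff_mul]
  rfl

variable (K)

/-- `∑_k a_k ħ^k`, as an element of `Y⟦T⟧`: its component of degree `k` is `a_k ħ^k`. -/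
def scalarSeries : ℂ⟦X⟧ →ₐ[ℂ] (Yangian K)⟦X⟧ :=
  hEval (Algebra.ofId ℂ (Yangian K)⟦X⟧) (Yangian.hbar K) (Yangian.hbar_comm K)

theorem coeff_scalarSeries (a : ℂ⟦X⟧) (n : ℕ) :
    PowerSeries.coeff n (scalarSeries K a) = PowerSeries.coeff n a • Yangian.hbar K ^ n := by
  rw [scalarSeries, coeff_hEval, Finset.Nat.sum_antidiagonal_eq_sum_range_succ_mk,
    Finset.sum_range_succ, Finset.sum_eq_zero]
  · simp only [Algebra.ofId_apply, PowerSeries.algebraMap_apply, Nat.sub_self,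
      PowerSeries.coeff_zero_C, zero_add]
    rw [← Algebra.commutes, ← Algebra.smul_def]
  · intro k hk
    rw [Algebra.ofId_apply, PowerSeries.algebraMap_apply, PowerSeries.coeff_C, if_neg, mul_zero]
    have := Finset.mem_range.mp hk
    omega

theorem scalarSeries_mem (a : ℂ⟦X⟧) : scalarSeries K a ∈ YhatSub K := by
  intro k
  rw [coeff_scalarSeries]
  exact Submodule.smul_mem _ _ (Yangian.hbar_pow_mem_grade K k)

/-- The structure of a `ℂ⟦ħ⟧`-algebra. -/
instance : Algebra ℂ⟦X⟧ (Yhat K) :=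
  RingHom.toAlgebra' (codRestrict (scalarSeries K) (scalarSeries_mem K) : ℂ⟦X⟧ →+* Yhat K) (by
    intro a f
    refine val_injective K ?_
    rw [map_mul, map_mul]
    change scalarSeries K a * val K f = val K f * scalarSeries K a
    ext n
    rw [PowerSeries.coeff_mul, PowerSeries.coeff_mul, ← Finset.Nat.sum_antidiagonal_swap]
    refine Finset.sum_congr rfl fun p _ => ?_
    simp only [Prod.fst_swap, Prod.snd_swap, coeff_scalarSeries]
    rw [smul_mul_assoc, mul_smul_comm, (Commute.pow_left (Yangian.hbar_comm K _) p.2).eq])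

theorem val_algebraMap (a : ℂ⟦X⟧) : val K (algebraMap ℂ⟦X⟧ (Yhat K) a) = scalarSeries K a := rfl

/-- The ideal `∏_{k ≥ n} Y_k`. For `n = 1` this is the ideal of all elements without component
of degree `0`. -/
def ge (n : ℕ) : Ideal (Yhat K) where
  carrier := {f | ∀ k < n, comp K k f = 0}
  add_mem' := by
    intro f g hf hg k hk
    rw [comp_add, hf k hk, hg k hk, add_zero]
  zero_mem' := by
    intro k _
    rw [comp, map_zero, map_zero]
  smul_mem' := by
    intro f g hg k hk
    rw [smul_eq_mul, comp_mul]
    refine Finset.sum_eq_zero fun p hp => ?_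
    have h1 := Finset.HasAntidiagonal.mem_antidiagonal.mp hp
    rw [hg p.2 (by omega), mul_zero]

variable {K}

theorem mem_ge {n : ℕ} {f : Yhat K} : f ∈ ge K n ↔ ∀ k < n, comp K k f = 0 := Iff.rfl

theorem ge_mul {m n : ℕ} {f g : Yhat K} (hf : f ∈ ge K m) (hg : g ∈ ge K n) :
    f * g ∈ ge K (m + n) := by
  intro k hk
  rw [comp_mul]
  refine Finset.sum_eq_zero fun p hp => ?_
  have h1 := Finset.HasAntidiagonal.mem_antidiagonal.mp hp
  by_cases h2 : p.1 < m
  · rw [hf _ h2, zero_mul]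
  · rw [hg p.2 (by omega), mul_zero]

theorem pow_le_ge {R : Type*} [Ring R] (φ : R →+* Yhat K) {J : Ideal R}
    (h : J ≤ Ideal.comap φ (ge K 1)) (n : ℕ) : J ^ n ≤ Ideal.comap φ (ge K n) := by
  induction n with
  | zero =>
    intro x _
    exact fun k hk => absurd hk (Nat.not_lt_zero k)
  | succ n ih =>
    rw [Submodule.pow_succ]
    refine Ideal.mul_le.mpr fun r hr s hs => ?_
    rw [Ideal.mem_comap, map_mul]
    exact ge_mul (ih hr) (h hs)

end Yhat

/-- The gradation automorphism of the completed Yangian, `∑_k y_k ↦ ∑_k a^k y_k`. -/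
def chiY (K : KacMoodyDatum I 𝔥) (a : ℂˣ) : Yhat K →ₐ[ℂ] Yhat K :=
  Yhat.codRestrict ((twist (a : ℂ) (AlgHom.id ℂ (Yangian K))).comp (Yhat.val K)) (by
    intro f k
    have h1 := Submodule.smul_mem _ ((a : ℂ) ^ k) (Yhat.comp_mem K k f)
    have h2 : PowerSeries.coeff k ((twist (a : ℂ) (AlgHom.id ℂ (Yangian K))).comp (Yhat.val K) f) =
        ((a : ℂ) ^ k) • Yhat.comp K k f := by
      simp [twist, Yhat.comp]
    rw [h2]
    exact h1)

theorem phiSeries_mem (K : KacMoodyDatum I 𝔥) (c : ℂˣ) (y : YangianDouble K) :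
    phiSeries K c y ∈ YhatSub K := by
  obtain ⟨x, rfl⟩ := YangianDouble.mk_surjective K y
  have h1 : ∀ a : FreeAlgebra ℂ (Gen I 𝔥 ℤ), FreeAlgebra.lift ℂ (phiGen K c) a ∈ YhatSub K := by
    intro a
    induction a using FreeAlgebra.induction with
    | grade0 z => rw [AlgHom.commutes]; exact Subalgebra.algebraMap_mem _ _
    | grade1 a =>
      rw [FreeAlgebra.lift_ι_apply, mem_YhatSub]
      intro k
      cases a with
      | h a =>
        rw [phiGen, PowerSeries.coeff_C]
        split_ifs with hk
        · subst hk
          exact Yangian.gen_mem_grade K (.h a)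
        · exact Submodule.zero_mem _
      | x ε i r =>
        rw [phiGen, PowerSeries.coeff_mk]
        exact Submodule.smul_mem _ _ (Yangian.gen_mem_grade K (.x ε i k))
      | H i r =>
        rw [phiGen, PowerSeries.coeff_mk]
        exact Submodule.smul_mem _ _ (Yangian.gen_mem_grade K (.H i k))
    | mul a b ha hb => rw [map_mul]; exact Subalgebra.mul_mem _ ha hb
    | add a b ha hb => rw [map_add]; exact Subalgebra.add_mem _ ha hb
  rw [phiSeries_mk, phiFree, mem_YhatSub]
  intro k
  rw [coeff_hEval]
  refine Submodule.sum_mem _ fun p hp => ?_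
  rw [← Finset.HasAntidiagonal.mem_antidiagonal.mp hp]
  exact Yangian.mul_mem_grade K (Yangian.hbar_pow_mem_grade K _) (h1 _ _)

/-- The homomorphism `Φ_c : DY_ħ 𝔤 → ∏_k Y_k` of `ℂ⟦ħ⟧`-algebras. -/
def Phi (K : KacMoodyDatum I 𝔥) (c : ℂˣ) : YangianDouble K →ₐ[ℂ⟦X⟧] Yhat K :=
  { (Yhat.codRestrict (phiSeries K c) (phiSeries_mem K c) : YangianDouble K →+* Yhat K) with
    commutes' := fun a => by
      refine Yhat.val_injective K ?_
      change phiFree K c (YangianDouble.scalarHom I 𝔥 a) = Yhat.scalarSeries K a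
      ext n
      rw [phiFree, Yhat.scalarSeries, coeff_hEval, coeff_hEval]
      refine Finset.sum_congr rfl fun p _ => ?_
      rw [YangianDouble.scalarHom, PowerSeries.coeff_map, AlgHom.commutes, Algebra.ofId_apply] }

/-! ### Completions with respect to powers of an ideal -/

/-- The completion `lim_n R / J^n`, as a subalgebra of `∏_n R / J^n`. -/
def IdealCompletion (S : Type*) [CommRing S] {R : Type*} [Ring R] [Algebra S R] (J : Ideal R)
    [J.IsTwoSided] : Subalgebra S (∀ n : ℕ, R ⧸ J ^ n) where
  carrier := {f | ∀ (m n : ℕ) (h : m ≤ n),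
    Ideal.Quotient.factor (Ideal.pow_le_pow_right h) (f n) = f m}
  mul_mem' := by
    intro f g hf hg m n h
    rw [Pi.mul_apply, Pi.mul_apply, map_mul, hf m n h, hg m n h]
  add_mem' := by
    intro f g hf hg m n h
    rw [Pi.add_apply, Pi.add_apply, map_add, hf m n h, hg m n h]
  algebraMap_mem' := by
    intro s m n h
    rfl

/-- The homomorphism of completions induced by a ring homomorphism `φ` with `φ(J) ⊆ J'`. -/
def IdealCompletion.map (S : Type*) [CommRing S] {R R' : Type*} [Ring R] [Algebra S R] [Ring R']
    [Algebra S R'] {J : Ideal R} [J.IsTwoSided] {J' : Ideal R'} [J'.IsTwoSided] (φ : R →+* R')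
    (h : ∀ n, J ^ n ≤ Ideal.comap φ (J' ^ n)) :
    IdealCompletion S J →+* IdealCompletion S J' where
  toFun f := ⟨fun n => Ideal.quotientMap (J' ^ n) φ (h n) (f.1 n), by
    intro m n hmn
    have h1 := f.2 m n hmn
    obtain ⟨x, hx⟩ := Ideal.Quotient.mk_surjective (f.1 n)
    change Ideal.Quotient.factor _ (Ideal.quotientMap (J' ^ n) φ (h n) (f.1 n)) =
      Ideal.quotientMap (J' ^ m) φ (h m) (f.1 m)
    rw [← h1, ← hx]
    rfl⟩
  map_one' := Subtype.ext (funext fun n => map_one (Ideal.quotientMap (J' ^ n) φ (h n)))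
  map_mul' f g := Subtype.ext (funext fun n =>
    map_mul (Ideal.quotientMap (J' ^ n) φ (h n)) (f.1 n) (g.1 n))
  map_zero' := Subtype.ext (funext fun n => map_zero (Ideal.quotientMap (J' ^ n) φ (h n)))
  map_add' f g := Subtype.ext (funext fun n =>
    map_add (Ideal.quotientMap (J' ^ n) φ (h n)) (f.1 n) (g.1 n))

/-- The completion of the Yangian double with respect to the powers of `𝒥_c`. -/
abbrev DYhat (K : KacMoodyDatum I 𝔥) (c : ℂˣ) :
    Subalgebra ℂ⟦X⟧ (∀ n : ℕ, YangianDouble K ⧸ evalIdeal K c ^ n) :=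
  IdealCompletion ℂ⟦X⟧ (evalIdeal K c)

theorem ev_chi (K : KacMoodyDatum I 𝔥) (a b : ℂˣ) (y : YangianDouble K) :
    ev K b (chi K a y) = ev K (a * b) y := by
  obtain ⟨x, rfl⟩ := YangianDouble.mk_surjective K y
  have h1 : ev K b (chi K a (YangianDouble.mk K x)) =
      FreeAlgebra.lift ℂ (evGen K b) (FreeAlgebra.lift ℂ
        (fun g : Gen I 𝔥 ℤ => ((a : ℂ) ^ g.deg) • FreeAlgebra.ι ℂ g)
          (PowerSeries.constantCoeff x)) := by
    change FreeAlgebra.lift ℂ (evGen K b) (PowerSeries.constantCoeff (twist (a : ℂ) _ x)) = _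
    rw [← PowerSeries.coeff_zero_eq_constantCoeff_apply]
    simp [twist]
  rw [h1]
  change _ = FreeAlgebra.lift ℂ (evGen K (a * b)) (PowerSeries.constantCoeff x)
  rw [← AlgHom.comp_apply]
  congr 1
  ext g
  cases g with
  | h g => simp [evGen, Gen.deg]
  | x ε i r => simp [evGen, Gen.deg, smul_smul, mul_zpow]
  | H i r => simp [evGen, Gen.deg, smul_smul, mul_zpow, mul_assoc]

theorem evalIdeal_le_comap_chi (K : KacMoodyDatum I 𝔥) {a b b' : ℂˣ} (h : a * b' = b) :
    evalIdeal K b ≤ Ideal.comap (chi K a : YangianDouble K →+* YangianDouble K)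
      (evalIdeal K b') := by
  intro y hy
  rw [Ideal.mem_comap, evalIdeal, RingHom.mem_ker]
  change ev K b' (chi K a y) = 0
  rw [ev_chi, h]
  exact hy

theorem pow_le_comap {R R' : Type*} [Ring R] [Ring R'] (φ : R →+* R') {J : Ideal R} {J' : Ideal R'}
    (h : J ≤ Ideal.comap φ J') (n : ℕ) : J ^ n ≤ Ideal.comap φ (J' ^ n) := by
  induction n with
  | zero =>
    rw [Submodule.pow_zero, Submodule.pow_zero, Ideal.one_eq_top, Ideal.one_eq_top]
    exact fun _ _ => Submodule.mem_top
  | succ n ih =>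
    rw [Submodule.pow_succ, Submodule.pow_succ]
    refine Ideal.mul_le.mpr fun r hr s hs => ?_
    rw [Ideal.mem_comap, map_mul]
    exact Ideal.mul_mem_mul (ih hr) (h hs)

/-- The homomorphism `χ̂_a`, from the completion at `𝒥_b` to the completion at `𝒥_{b'}` where
`b = a b'`, that is induced by `χ_a`. -/
def chiHat (K : KacMoodyDatum I 𝔥) (a b b' : ℂˣ) (h : a * b' = b) : DYhat K b →+* DYhat K b' :=
  IdealCompletion.map ℂ⟦X⟧ (chi K a : YangianDouble K →+* YangianDouble K)
    (pow_le_comap _ (evalIdeal_le_comap_chi K h))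

/-! ### The homomorphisms `Φ̂_c` and `Γ̂` -/

section PhiHat

variable (K : KacMoodyDatum I 𝔥) (c : ℂˣ)

/-- The component of degree `k` of the image of a compatible family `f`: that of `Φ_c(x)`, for any
representative `x` of `f (k + 1)`. -/
def phiComp (k : ℕ) (f : DYhat K c) : Yangian K :=
  Yhat.comp K k (Phi K c (Function.surjInv Ideal.Quotient.mk_surjective (f.1 (k + 1))))

theorem phiComp_mem (k : ℕ) (f : DYhat K c) : phiComp K c k f ∈ Yangian.grade K k :=
  Yhat.comp_mem K k _

variable {K c}

theorem phiComp_eq (hΦ : evalIdeal K c ≤ Ideal.comap (Phi K c) (Yhat.ge K 1)) {k n : ℕ}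
    (hkn : k < n) (f : DYhat K c) (x : YangianDouble K)
    (hx : Ideal.Quotient.mk (evalIdeal K c ^ n) x = f.1 n) :
    phiComp K c k f = Yhat.comp K k (Phi K c x) := by
  have h1 := Function.surjInv_eq
    (Ideal.Quotient.mk_surjective (I := evalIdeal K c ^ (k + 1))) (f.1 (k + 1))
  have h2 := f.2 (k + 1) n hkn
  rw [← hx, Ideal.Quotient.factor_mk, ← h1, eq_comm, Ideal.Quotient.eq] at h2
  have h3 := Yhat.pow_le_ge (Phi K c : YangianDouble K →+* Yhat K) hΦ (k + 1) h2
  have h4 := h3 k (Nat.lt_succ_self k)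
  rw [map_sub, Yhat.comp_sub, sub_eq_zero] at h4
  exact h4

/-- The homomorphism `Φ̂_c` induced by `Φ_c`: the inverse limit of the homomorphisms
`DY / 𝒥_c^n → ∏_k Y_k / ∏_{k ≥ n} Y_k`. It is defined when `Φ_c(𝒥_c) ⊆ ∏_{k ≥ 1} Y_k`. -/
def PhiHat (hΦ : evalIdeal K c ≤ Ideal.comap (Phi K c) (Yhat.ge K 1)) :
    DYhat K c →ₐ[ℂ⟦X⟧] Yhat K where
  toFun f := Yhat.ofComp (fun k => phiComp K c k f) (fun k => phiComp_mem K c k f)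
  map_one' := by
    refine Yhat.ext_comp fun k => ?_
    rw [Yhat.comp_ofComp, phiComp_eq hΦ (Nat.lt_succ_self k) 1 1 rfl, map_one]
  map_zero' := by
    refine Yhat.ext_comp fun k => ?_
    rw [Yhat.comp_ofComp, phiComp_eq hΦ (Nat.lt_succ_self k) 0 0 rfl, map_zero]
  map_add' f g := by
    refine Yhat.ext_comp fun k => ?_
    obtain ⟨x, hx⟩ := Ideal.Quotient.mk_surjective (f.1 (k + 1))
    obtain ⟨y, hy⟩ := Ideal.Quotient.mk_surjective (g.1 (k + 1))
    rw [Yhat.comp_add]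
    simp only [Yhat.comp_ofComp]
    rw [phiComp_eq hΦ (Nat.lt_succ_self k) f x hx, phiComp_eq hΦ (Nat.lt_succ_self k) g y hy,
      phiComp_eq hΦ (Nat.lt_succ_self k) (f + g) (x + y)
        (by rw [map_add, hx, hy]; rfl), map_add, Yhat.comp_add]
  map_mul' f g := by
    refine Yhat.ext_comp fun k => ?_
    obtain ⟨x, hx⟩ := Ideal.Quotient.mk_surjective (f.1 (k + 1))
    obtain ⟨y, hy⟩ := Ideal.Quotient.mk_surjective (g.1 (k + 1))
    rw [Yhat.comp_mul]
    simp only [Yhat.comp_ofComp]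
    rw [phiComp_eq hΦ (Nat.lt_succ_self k) (f * g) (x * y)
        (by rw [map_mul, hx, hy]; rfl), map_mul, Yhat.comp_mul]
    refine Finset.sum_congr rfl fun p hp => ?_
    have h1 := Finset.HasAntidiagonal.mem_antidiagonal.mp hp
    rw [phiComp_eq hΦ (show p.1 < k + 1 by omega) f x hx,
      phiComp_eq hΦ (show p.2 < k + 1 by omega) g y hy]
  commutes' a := by
    refine Yhat.ext_comp fun k => ?_
    rw [Yhat.comp_ofComp, phiComp_eq hΦ (Nat.lt_succ_self k) _ (algebraMap ℂ⟦X⟧ (YangianDouble K) a) rfl,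
      AlgHom.commutes]

end PhiHat

/-- The homomorphism `Γ = ι ∘ τ_{-1} : Y_ħ 𝔤 → DY_ħ 𝔤`. -/
def Gamma (K : KacMoodyDatum I 𝔥) : Yangian K →ₐ[ℂ[X]] YangianDouble K :=
  (inclusion K).comp (Yangian.shift K (-1))

/-- The map `Γ̂` from the completed Yangian to the completion of the Yangian double at `𝒥_1`,
`∑_k y_k ↦ ∑_k Γ(y_k)`. It is defined when `Γ(Y_n) ⊆ 𝒥_1^n` for all `n`. -/
def GammaHat (K : KacMoodyDatum I 𝔥)
    (hΓ : ∀ n, ∀ y ∈ Yangian.grade K n, Gamma K y ∈ evalIdeal K 1 ^ n) (f : Yhat K) : DYhat K 1 :=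
  ⟨fun n => Ideal.Quotient.mk (evalIdeal K 1 ^ n)
    (∑ k ∈ Finset.range n, Gamma K (Yhat.comp K k f)), by
    intro m n h
    rw [Ideal.Quotient.factor_mk]
    refine Ideal.Quotient.eq.mpr ?_
    rw [← Finset.sum_sdiff (Finset.range_mono h), add_sub_cancel_right]
    refine Ideal.sum_mem _ fun k hk => ?_
    have h1 := Finset.mem_sdiff.mp hk
    have h2 : m ≤ k := not_lt.mp fun h3 => h1.2 (Finset.mem_range.mpr h3)
    exact Ideal.pow_le_pow_right h2 (hΓ k _ (Yhat.comp_mem K k f))⟩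

end YD

end

/-!
# The completion of the Yangian double at an evaluation ideal

The relations of the Yangian double can be written in terms of currents `x_i^±(p)`, `h_i(p)`, linear
in `p ∈ ℂ[t, t⁻¹]`, where `X_{ir}^± = x_i^±(t^r)`, and they are invariant under `t ↦ t + c`. In these
terms `Γ` sends `x_{ir}^±` to `x_i^±((t - 1)^r)`, and `Φ_c` expands `p` at `t = c`. So `Γ` and `Φ_1`
are inverse to each other after completion, once the two filtrations are compared.

* `Φ_c(𝒥_c)` has no component of degree `0` (`evalIdeal_le_comap_Phi`): the modes `0` of the
  Yangian satisfy the Chevalley-Serre relations, so there is a homomorphism `θ : U(𝔤) → Y`, and the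
  component of degree `0` of `Φ_c(y)` is `θ` of the value of `y` under the evaluation map.
* `Γ(Y_n) ⊆ 𝒥_1^n` (`Gamma_mem_pow`). The point is that `x_i^±((t - 1)^n p) ∈ 𝒥_1^n` for all `p`
  (`Satisfies.fwdDiff_x_mem`), by induction on `n` from
  `[h_i(t - 1), x_i^±(q)] = ± 2 d_i x_i^±((t - 1) q) ± ħ d_i (h_{i0} x_i^±(q) + x_i^±(q) h_{i0})`
  and from `ħ, h_i(t - 1) ∈ 𝒥_1`. The element `x_i^±((t - 1)^n t^r)` is the `n`-th finite difference
  of `s ↦ X_{is}^±` at `r`, so Mathlib's `fwdDiff` serves as the calculus of currents.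
* `Φ_1(Γ(y)) = y` for homogeneous `y` (`comp_Phi_Gamma`), by `((1 + T) - 1)^r = T^r`.
* `y ≡ ∑_{k < N} Γ(Φ_1(y)_k)` modulo `𝒥_1^N` (`sub_gammaTrunc_Phi_mem`). Both sides are
  multiplicative modulo `𝒥_1^N`; on the generators this is the Newton expansion of `t^r` at `t = 1`,
  whose remainder is a multiple of `(t - 1)^N`; the `ħ`-adic tail lies in `𝒥_1^N` since `ħ ∈ 𝒥_1`.

The last two facts say that `Φ̂_1` and `Γ̂` are mutually inverse. The general case is
transported from `c = 1` by `Φ_c = χ^ι_{a/c} ∘ Φ_a ∘ χ_{c/a}` (`Phi_eq_chiY_Phi_chi`). In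
particular no basis theorem for the Yangian is needed.
-/

noncomputable section

namespace YD

universe u v

variable {I : Type u} {𝔥 : Type v} [Fintype I] [DecidableEq I] [AddCommGroup 𝔥] [Module ℂ 𝔥]

/-! ### The evaluation map and the component of degree zero -/

theorem KacMoodyAlgebra.mk_surjective (K : KacMoodyDatum I 𝔥) :
    Function.Surjective (KacMoodyAlgebra.mk K) :=
  Submodule.Quotient.mk_surjective _

section Lie

attribute [local instance] LieRing.ofAssociativeRing

/-- The universal property of the Kac-Moody algebra `𝔤`, for Lie homomorphisms into an associative
algebra. -/
theorem KacMoodyAlgebra.exists_lift (K : KacMoodyDatum I 𝔥) {R : Type*} [Ring R] [Algebra ℂ R]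
    (f : KMGen I 𝔥 → R) (H : ∀ r, KMRelator K r → FreeLieAlgebra.lift ℂ f r = 0) :
    ∃ φ : KacMoodyAlgebra K →ₗ⁅ℂ⁆ R,
      ∀ a, φ (KacMoodyAlgebra.mk K (FreeLieAlgebra.of ℂ a)) = f a := by
  have h1 : LieSubmodule.lieSpan ℂ (FreeLieAlgebra ℂ (KMGen I 𝔥)) {r | KMRelator K r} ≤
      (FreeLieAlgebra.lift ℂ f).ker :=
    LieSubmodule.lieSpan_le.mpr fun r hr => LieHom.mem_ker.mpr (H r hr)
  have h2 : ∀ x y, KacMoodyAlgebra.mk K x = KacMoodyAlgebra.mk K y →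
      FreeLieAlgebra.lift ℂ f x = FreeLieAlgebra.lift ℂ f y := by
    intro x y hxy
    rw [← sub_eq_zero, ← map_sub] at hxy ⊢
    exact LieHom.mem_ker.mp (h1 (LieSubmodule.Quotient.mk_eq_zero'.mp hxy))
  have hs := KacMoodyAlgebra.mk_surjective K
  set ψ : KacMoodyAlgebra K → R := fun x => FreeLieAlgebra.lift ℂ f (Function.surjInv hs x) with hψ
  have h3 : ∀ x, ψ (KacMoodyAlgebra.mk K x) = FreeLieAlgebra.lift ℂ f x := fun x =>
    h2 _ _ (Function.surjInv_eq hs _)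
  refine ⟨{ toFun := ψ, map_add' := ?_, map_smul' := ?_, map_lie' := ?_ }, fun a => ?_⟩
  · intro x y
    obtain ⟨x, rfl⟩ := hs x
    obtain ⟨y, rfl⟩ := hs y
    rw [← map_add, h3, h3, h3, map_add]
  · intro z x
    obtain ⟨x, rfl⟩ := hs x
    rw [← map_smul, h3, h3, map_smul, RingHom.id_apply]
  · intro x y
    obtain ⟨x, rfl⟩ := hs x
    obtain ⟨y, rfl⟩ := hs y
    rw [← LieHom.map_lie, h3, h3, h3, LieHom.map_lie]
  · change ψ _ = _
    rw [h3, FreeLieAlgebra.lift_of_apply]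

/-- The modes `0` of a solution of the relations satisfy the relations of `𝔤`, and so determine a
homomorphism from `U(𝔤)`. -/
theorem Satisfies.exists_envelopingHom {K : KacMoodyDatum I 𝔥} {R : Type*} [Ring R] [Algebra ℂ R]
    {hb : R} {g : Gen I 𝔥 ℕ → R} (S : Satisfies K hb g) :
    ∃ θ : UniversalEnvelopingAlgebra ℂ (KacMoodyAlgebra K) →ₐ[ℂ] R,
      (∀ a, θ (UniversalEnvelopingAlgebra.ι ℂ (KacMoodyAlgebra.h K a)) = g (.h a)) ∧
      ∀ ε i, θ (UniversalEnvelopingAlgebra.ι ℂ (KacMoodyAlgebra.x K ε i)) = g (.x ε i 0) := by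
  set q : I → ℂ := fun i => ((Real.sqrt (K.d i) : ℝ) : ℂ) with hq
  have hqq : ∀ i, q i * q i = K.d i := KacMoodyAlgebra.sqrt_mul_sqrt K
  have hd : ∀ i, (K.d i : ℂ) ≠ 0 := fun i => Nat.cast_ne_zero.mpr (K.d_pos i).ne'
  have hq0 : ∀ i, q i ≠ 0 := fun i h => hd i (by rw [← hqq, h, zero_mul])
  -- `x_i^± = √d_i e_i` forces `e_i ↦ (√d_i)⁻¹ x_{i0}^±`, and similarly for `f_i`.
  set f : KMGen I 𝔥 → R := fun a => match a with
    | .h a => g (.h a)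
    | .e ε i => (q i)⁻¹ • g (.x ε i 0) with hf
  have fh : ∀ a, FreeLieAlgebra.lift ℂ f (freeH I a) = g (.h a) := fun a =>
    FreeLieAlgebra.lift_of_apply f _
  have fe : ∀ ε i, FreeLieAlgebra.lift ℂ f (freeE 𝔥 ε i) = (q i)⁻¹ • g (.x ε i 0) := fun ε i =>
    FreeLieAlgebra.lift_of_apply f _
  have lie : ∀ (z w : ℂ) (a b : R), ⁅z • a, w • b⁆ = (z * w) • ⁅a, b⁆ := by
    intro z w a b
    rw [Ring.lie_def, Ring.lie_def, smul_mul_smul_comm, smul_mul_smul_comm, smul_sub,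
      mul_comm w z]
  obtain ⟨φ, hφ⟩ := KacMoodyAlgebra.exists_lift K f (by
    intro r hr
    cases hr with
    | add a b => rw [map_sub, map_add, fh, fh, fh, S _ (.add a b)]
    | smul z a => rw [map_sub, map_smul, fh, fh, S _ (.smul z a)]
    | hh a b => rw [LieHom.map_lie, fh, fh, S _ (.hh a b)]
    | he a ε j =>
      have h1 := lie 1 (q j)⁻¹ (g (.h a)) (g (.x ε j 0))
      rw [one_smul, one_mul] at h1
      rw [map_sub, LieHom.map_lie, map_smul, fh, fe, h1, sub_eq_zero.mp (S _ (.hx a ε j 0)),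
        smul_comm, sub_self]
    | ef i j =>
      rw [map_sub, LieHom.map_lie, fe, fe, lie, sub_eq_zero.mp (S _ (.xx_opp i j 0 0)), sub_eq_zero]
      split_ifs with hij
      · subst hij
        rw [fh, add_zero, sub_eq_zero.mp (S _ (.H_zero i)), smul_smul, ← mul_inv, hqq,
          inv_mul_cancel₀ (hd i), one_smul]
      · rw [smul_zero, map_zero]
    | serre ε i j hij =>
      have key : ∀ (n : ℕ) (y : FreeLieAlgebra ℂ (KMGen I 𝔥)), FreeLieAlgebra.lift ℂ f
          ((LieAlgebra.ad ℂ (FreeLieAlgebra ℂ (KMGen I 𝔥)) (freeE 𝔥 ε i) ^ n) y) =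
          (adL R ((q i)⁻¹ • g (.x ε i 0)) ^ n) (FreeLieAlgebra.lift ℂ f y) := by
        intro n
        induction n with
        | zero => intro y; rfl
        | succ n ih =>
          intro y
          rw [pow_succ, pow_succ, Module.End.mul_apply, Module.End.mul_apply, ih,
            LieAlgebra.ad_apply, LieHom.map_lie, fe]
          rfl
      -- For equal modes the symmetrized Serre sum is `m!` times the nested commutator.
      have h1 := S _ (.serre ε i j hij (fun _ => 0) 0)
      rw [serreSum_const, smul_eq_zero] at h1
      have h2 := h1.resolve_left (Nat.cast_ne_zero.mpr (Nat.factorial_ne_zero _))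
      rw [key, fe, map_smul, map_smul, smul_pow, LinearMap.smul_apply, h2, smul_zero, smul_zero])
  refine ⟨UniversalEnvelopingAlgebra.lift ℂ φ, fun a => ?_, fun ε i => ?_⟩
  · rw [UniversalEnvelopingAlgebra.lift_ι_apply]
    exact hφ _
  · rw [UniversalEnvelopingAlgebra.lift_ι_apply, KacMoodyAlgebra.x, map_smul]
    refine (congrArg _ (hφ (.e ε i))).trans ?_
    exact smul_inv_smul₀ (hq0 i) _

end Lie

theorem Yhat.comp_Phi_mk (K : KacMoodyDatum I 𝔥) (c : ℂˣ) (k : ℕ) (x : DFree I 𝔥) :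
    Yhat.comp K k (Phi K c (YangianDouble.mk K x)) = PowerSeries.coeff k (phiFree K c x) := rfl

/-- The component of degree `0` of `Φ_c(y)` is a function of the value of `y` under the evaluation
map. -/
theorem exists_comp_zero_Phi (K : KacMoodyDatum I 𝔥) (c : ℂˣ) :
    ∃ θ : UniversalEnvelopingAlgebra ℂ (KacMoodyAlgebra K) →ₐ[ℂ] Yangian K,
      ∀ y, Yhat.comp K 0 (Phi K c y) = θ (ev K c y) := by
  obtain ⟨θ, hh, hx⟩ := (Yangian.satisfies K).exists_envelopingHom
  refine ⟨θ, fun y => ?_⟩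
  obtain ⟨x, rfl⟩ := YangianDouble.mk_surjective K y
  have h1 : Yhat.comp K 0 (Phi K c (YangianDouble.mk K x)) =
      PowerSeries.constantCoeff (FreeAlgebra.lift ℂ (phiGen K c) (PowerSeries.constantCoeff x)) := by
    rw [Yhat.comp_Phi_mk, phiFree, coeff_hEval]
    simp
  rw [h1]
  change _ = θ (FreeAlgebra.lift ℂ (evGen K c) (PowerSeries.constantCoeff x))
  generalize (PowerSeries.constantCoeff x : FreeAlgebra ℂ (Gen I 𝔥 ℤ)) = a
  induction a using FreeAlgebra.induction with
  | grade0 z =>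
    rw [AlgHom.commutes, AlgHom.commutes, AlgHom.commutes, PowerSeries.algebraMap_apply,
      PowerSeries.constantCoeff_C]
  | grade1 a =>
    rw [FreeAlgebra.lift_ι_apply, FreeAlgebra.lift_ι_apply]
    cases a with
    | h a => simp [-UniversalEnvelopingAlgebra.ι_apply, phiGen, evGen, hh]
    | x ε i r =>
      simp [-UniversalEnvelopingAlgebra.ι_apply, phiGen, evGen, hx,
        ← PowerSeries.coeff_zero_eq_constantCoeff_apply]
    | H i r =>
      simp [-UniversalEnvelopingAlgebra.ι_apply, phiGen, evGen, hh,
        ← PowerSeries.coeff_zero_eq_constantCoeff_apply,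
        sub_eq_zero.mp (Yangian.satisfies K _ (.H_zero i))]
  | mul a b ha hb => rw [map_mul, map_mul, map_mul, map_mul, ha, hb]
  | add a b ha hb => rw [map_add, map_add, map_add, map_add, ha, hb]

/-- `Φ_c(𝒥_c) ⊆ ∏_{k ≥ 1} Y_k`. -/
theorem evalIdeal_le_comap_Phi (K : KacMoodyDatum I 𝔥) (c : ℂˣ) :
    evalIdeal K c ≤ Ideal.comap (Phi K c) (Yhat.ge K 1) := by
  intro y hy
  obtain ⟨θ, hθ⟩ := exists_comp_zero_Phi K c
  rw [Ideal.mem_comap, Yhat.mem_ge]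
  intro k hk
  obtain rfl : k = 0 := by omega
  rw [hθ, show ev K c y = 0 from hy, map_zero]

/-! ### Finite differences of currents

For a family `X : ℤ → R` of modes, `(Δ_[1])^[n] X r` is the value of the current at
`(t - 1)^n t^r`. -/

section Differences

open scoped fwdDiff

theorem fwdDiff_iter_succ {G : Type*} [AddCommGroup G] (f : ℤ → G) (n : ℕ) (r : ℤ) :
    (Δ_[1])^[n + 1] f r = (Δ_[1])^[n] f (r + 1) - (Δ_[1])^[n] f r := by
  rw [Function.iterate_succ_apply', fwdDiff]

/-- Newton interpolation at `r ∈ ℤ`, up to a subgroup that contains the differences of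
order `N`. -/
theorem sub_sum_choose_smul_fwdDiff_mem {G : Type*} [AddCommGroup G] (M : AddSubgroup G) (N : ℕ)
    (f : ℤ → G) (h : ∀ r, (Δ_[1])^[N] f r ∈ M) (r : ℤ) :
    f r - ∑ n ∈ Finset.range N, (Ring.choose r n : ℤ) • (Δ_[1])^[n] f 0 ∈ M := by
  induction N generalizing f r with
  | zero => simpa using h r
  | succ N ih =>
    -- The difference of the error term is the error term of order `N` for `Δ f`.
    have step : ∀ r : ℤ,
        (f (r + 1) - ∑ n ∈ Finset.range (N + 1), (Ring.choose (r + 1) n : ℤ) • (Δ_[1])^[n] f 0) -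
        (f r - ∑ n ∈ Finset.range (N + 1), (Ring.choose r n : ℤ) • (Δ_[1])^[n] f 0) ∈ M := by
      intro r
      have h1 := ih (Δ_[1] f) (fun s => h s) r
      rw [Finset.sum_range_succ', Finset.sum_range_succ' _ N]
      simp only [Ring.choose_succ_succ, Ring.choose_zero_right, add_smul, Finset.sum_add_distrib]
      simp only [Function.iterate_succ_apply]
      rw [fwdDiff] at h1
      convert h1 using 1
      abel
    induction r using Int.induction_on with
    | zero =>
      rw [Finset.sum_range_succ', Finset.sum_eq_zero]
      · simp [M.zero_mem]
      · intro k _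
        rw [Ring.choose_zero_succ, zero_smul]
    | succ k ih1 => simpa using M.add_mem (step k) ih1
    | pred k ih1 =>
      have h1 := step (-(k : ℤ) - 1)
      rw [sub_add_cancel] at h1
      simpa using M.sub_mem ih1 h1

variable {K : KacMoodyDatum I 𝔥} {R : Type*} [Ring R] [Algebra ℂ R] {hb : R} {g : Gen I 𝔥 ℤ → R}

/-- `h_{i0} = d_i α_i^∨` acts on all modes of `x_i^±` by `± 2 d_i`, hence on their differences. -/
theorem Satisfies.lie_H_zero_fwdDiff (S : Satisfies K hb g) (ε : ℤˣ) (i : I) (n : ℕ) (r : ℤ) :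
    ⁅g (.H i 0), (Δ_[1])^[n] (fun s => g (.x ε i s)) r⁆ =
      ((K.d i : ℂ) * (((ε : ℤ) : ℂ) * 2)) • (Δ_[1])^[n] (fun s => g (.x ε i s)) r := by
  induction n generalizing r with
  | zero =>
    have h1 := sub_eq_zero.mp (S _ (.hx (K.coroot i) ε i r))
    rw [K.root_coroot, K.diag] at h1
    rw [Function.iterate_zero, id, sub_eq_zero.mp (S _ (.H_zero i)), Ring.lie_def, smul_mul_assoc,
      mul_smul_comm, ← smul_sub, ← Ring.lie_def, h1, smul_smul]
    norm_num
  | succ n ih =>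
    have h1 := ih r
    have h2 := ih (r + 1)
    rw [Ring.lie_def] at h1 h2 ⊢
    rw [fwdDiff_iter_succ, smul_sub, ← h1, ← h2]
    noncomm_ring

/-- The relation between `h_i` and `x_i^±` is invariant under translation of the modes of `x_i^±`,
and so holds for their differences. -/
theorem Satisfies.lie_H_one_fwdDiff (S : Satisfies K hb g) (ε : ℤˣ) (i : I) (n : ℕ) (r : ℤ) :
    ⁅g (.H i 1), (Δ_[1])^[n] (fun s => g (.x ε i s)) r⁆ -
      ⁅g (.H i 0), (Δ_[1])^[n] (fun s => g (.x ε i s)) (r + 1)⁆ =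
      (((ε : ℤ) : ℂ) * K.dd i i) • (hb * (g (.H i 0) * (Δ_[1])^[n] (fun s => g (.x ε i s)) r +
        (Δ_[1])^[n] (fun s => g (.x ε i s)) r * g (.H i 0))) := by
  induction n generalizing r with
  | zero =>
    have h1 := sub_eq_zero.mp (S _ (.Hx ε i i 0 r))
    rwa [zero_add] at h1
  | succ n ih =>
    have h1 := ih r
    have h2 := ih (r + 1)
    rw [fwdDiff_iter_succ, fwdDiff_iter_succ _ n (r + 1)]
    simp only [mul_sub, sub_mul]
    rw [show ∀ a b c d : R, a - b + (c - d) = (a + c) - (b + d) from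
      fun a b c d => by abel, mul_sub, smul_sub, ← h1, ← h2]
    simp only [Ring.lie_def]
    noncomm_ring

/-- The current `x_i^±` maps `(t - 1)^n t^r` into `J^n`: up to a multiple of `ħ`, the commutator
with `h_i(t - 1) ∈ J` multiplies the argument of the current by `± 2 d_i (t - 1)`. -/
theorem Satisfies.fwdDiff_x_mem (S : Satisfies K hb g) {J : Ideal R} [J.IsTwoSided] (hJ : hb ∈ J)
    (hH : ∀ i, g (.H i 1) - g (.H i 0) ∈ J) (ε : ℤˣ) (i : I) (n : ℕ) (r : ℤ) :
    (Δ_[1])^[n] (fun s => g (.x ε i s)) r ∈ J ^ n := by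
  induction n generalizing r with
  | zero =>
    rw [Submodule.pow_zero, Ideal.one_eq_top]
    exact Submodule.mem_top
  | succ n ih =>
    have h1 := S.lie_H_one_fwdDiff ε i n r
    have h2 := S.lie_H_zero_fwdDiff ε i n r
    have h3 := S.lie_H_zero_fwdDiff ε i n (r + 1)
    set w : ℂ := (K.d i : ℂ) * (((ε : ℤ) : ℂ) * 2) with hw
    have hw0 : w ≠ 0 := by
      have h4 : ((ε : ℤ) : ℂ) ≠ 0 := Int.cast_ne_zero.mpr ε.ne_zero
      have h5 : (K.d i : ℂ) ≠ 0 := Nat.cast_ne_zero.mpr (K.d_pos i).ne'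
      exact mul_ne_zero h5 (mul_ne_zero h4 two_ne_zero)
    have key : w • (Δ_[1])^[n + 1] (fun s => g (.x ε i s)) r =
        (g (.H i 1) - g (.H i 0)) * (Δ_[1])^[n] (fun s => g (.x ε i s)) r -
        (Δ_[1])^[n] (fun s => g (.x ε i s)) r * (g (.H i 1) - g (.H i 0)) -
        (((ε : ℤ) : ℂ) * K.dd i i) • (hb * (g (.H i 0) * (Δ_[1])^[n] (fun s => g (.x ε i s)) r +
        (Δ_[1])^[n] (fun s => g (.x ε i s)) r * g (.H i 0))) := by
      rw [fwdDiff_iter_succ, smul_sub, ← h1, ← h2, ← h3]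
      simp only [Ring.lie_def]
      noncomm_ring
    have h6 : w • (Δ_[1])^[n + 1] (fun s => g (.x ε i s)) r ∈ J ^ (n + 1) := by
      rw [key]
      refine sub_mem (sub_mem ?_ ?_) (Submodule.smul_of_tower_mem _ _ ?_)
      · rw [Ideal.IsTwoSided.pow_succ]
        exact Ideal.mul_mem_mul (hH i) (ih r)
      · rw [Submodule.pow_succ]
        exact Ideal.mul_mem_mul (ih r) (hH i)
      · rw [Ideal.IsTwoSided.pow_succ]
        exact Ideal.mul_mem_mul hJ (add_mem (Ideal.mul_mem_left _ _ (ih r))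
          (Ideal.mul_mem_right _ _ (ih r)))
    have h7 := Submodule.smul_of_tower_mem _ w⁻¹ h6
    rwa [inv_smul_smul₀ hw0] at h7

/-- The analogue of `Satisfies.fwdDiff_x_mem` for `h_i`, because `h_{ir} = [x_{ir}^+, x_{i0}^-]`. -/
theorem Satisfies.fwdDiff_H_mem (S : Satisfies K hb g) {J : Ideal R} [J.IsTwoSided] (hJ : hb ∈ J)
    (hH : ∀ i, g (.H i 1) - g (.H i 0) ∈ J) (i : I) (n : ℕ) (r : ℤ) :
    (Δ_[1])^[n] (fun s => g (.H i s)) r ∈ J ^ n := by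
  have key : ∀ (n : ℕ) (r : ℤ), (Δ_[1])^[n] (fun s => g (.H i s)) r =
      (Δ_[1])^[n] (fun s => g (.x 1 i s)) r * g (.x (-1) i 0) -
        g (.x (-1) i 0) * (Δ_[1])^[n] (fun s => g (.x 1 i s)) r := by
    intro n
    induction n with
    | zero =>
      intro r
      have h1 := sub_eq_zero.mp (S _ (.xx_opp i i r 0))
      rw [if_pos rfl, add_zero, Ring.lie_def] at h1
      exact h1.symm
    | succ n ih =>
      intro r
      rw [fwdDiff_iter_succ, ih, ih, fwdDiff_iter_succ]
      noncomm_ring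
  rw [key]
  exact sub_mem (Ideal.mul_mem_right _ _ (S.fwdDiff_x_mem hJ hH 1 i n r))
    (Ideal.mul_mem_left _ _ (S.fwdDiff_x_mem hJ hH 1 i n r))

end Differences

/-! ### The filtration by powers of the evaluation ideal at `1` -/

theorem ev_gen (K : KacMoodyDatum I 𝔥) (c : ℂˣ) (a : Gen I 𝔥 ℤ) :
    ev K c (YangianDouble.gen K a) = evGen K c a := by
  change evFree K c (dfreeGen I 𝔥 a) = _
  rw [evFree_apply, dfreeGen, PowerSeries.constantCoeff_C, FreeAlgebra.lift_ι_apply]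

theorem hbar_mem_evalIdeal (K : KacMoodyDatum I 𝔥) (c : ℂˣ) :
    YangianDouble.hbar K ∈ evalIdeal K c := by
  change evFree K c PowerSeries.X = 0
  rw [evFree_apply, PowerSeries.constantCoeff_X, map_zero]

theorem H_one_sub_H_zero_mem_evalIdeal (K : KacMoodyDatum I 𝔥) (i : I) :
    YangianDouble.gen K (.H i 1) - YangianDouble.gen K (.H i 0) ∈ evalIdeal K 1 := by
  change ev K 1 _ = 0
  rw [map_sub, ev_gen, ev_gen]
  simp [evGen]

open scoped fwdDiff in
theorem fwdDiff_gen_x_mem (K : KacMoodyDatum I 𝔥) (ε : ℤˣ) (i : I) (n : ℕ) (r : ℤ) :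
    (Δ_[1])^[n] (fun s => YangianDouble.gen K (.x ε i s)) r ∈ evalIdeal K 1 ^ n :=
  (YangianDouble.satisfies K).fwdDiff_x_mem (hbar_mem_evalIdeal K 1)
    (H_one_sub_H_zero_mem_evalIdeal K) ε i n r

open scoped fwdDiff in
theorem fwdDiff_gen_H_mem (K : KacMoodyDatum I 𝔥) (i : I) (n : ℕ) (r : ℤ) :
    (Δ_[1])^[n] (fun s => YangianDouble.gen K (.H i s)) r ∈ evalIdeal K 1 ^ n :=
  (YangianDouble.satisfies K).fwdDiff_H_mem (hbar_mem_evalIdeal K 1)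
    (H_one_sub_H_zero_mem_evalIdeal K) i n r

theorem Gamma_hbar (K : KacMoodyDatum I 𝔥) :
    Gamma K (Yangian.hbar K) = YangianDouble.hbar K := by
  rw [Yangian.hbar, AlgHom.commutes, YangianDouble.algebraMap_X]

theorem Gamma_gen (K : KacMoodyDatum I 𝔥) (a : Gen I 𝔥 ℕ) :
    Gamma K (Yangian.gen K a) = inclusion K (Yangian.shiftGen K (-1) a) := by
  exact congrArg (inclusion K) (Yangian.lift_gen _ (Yangian.satisfies_shiftGen K (-1)) a)

theorem inclusion_gen (K : KacMoodyDatum I 𝔥) (a : Gen I 𝔥 ℕ) :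
    inclusion K (Yangian.gen K a) = YangianDouble.gen K a.toInt :=
  Yangian.lift_gen _ _ a

theorem Gamma_gen_h (K : KacMoodyDatum I 𝔥) (a : 𝔥) :
    Gamma K (Yangian.gen K (.h a)) = YangianDouble.gen K (.h a) := by
  rw [Gamma_gen]
  exact inclusion_gen K (.h a)

theorem Gamma_gen_x (K : KacMoodyDatum I 𝔥) (ε : ℤˣ) (i : I) (r : ℕ) :
    Gamma K (Yangian.gen K (.x ε i r)) = ∑ k ∈ Finset.range (r + 1),
      ((r.choose k : ℂ) * (-1) ^ (r - k)) • YangianDouble.gen K (.x ε i k) := by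
  rw [Gamma_gen, Yangian.shiftGen, map_sum]
  refine Finset.sum_congr rfl fun k _ => ?_
  rw [AlgHom.map_smul_of_tower, inclusion_gen]
  rfl

theorem Gamma_gen_H (K : KacMoodyDatum I 𝔥) (i : I) (r : ℕ) :
    Gamma K (Yangian.gen K (.H i r)) = ∑ k ∈ Finset.range (r + 1),
      ((r.choose k : ℂ) * (-1) ^ (r - k)) • YangianDouble.gen K (.H i k) := by
  rw [Gamma_gen, Yangian.shiftGen, map_sum]
  refine Finset.sum_congr rfl fun k _ => ?_
  rw [AlgHom.map_smul_of_tower, inclusion_gen]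
  rfl

open scoped fwdDiff in
theorem sum_choose_smul_eq_fwdDiff {G : Type*} [AddCommGroup G] [Module ℂ G] (f : ℤ → G) (r : ℕ) :
    ∑ k ∈ Finset.range (r + 1), ((r.choose k : ℂ) * (-1) ^ (r - k)) • f k = (Δ_[1])^[r] f 0 := by
  rw [fwdDiff_iter_eq_sum_shift]
  refine Finset.sum_congr rfl fun k _ => ?_
  rw [← Int.cast_smul_eq_zsmul ℂ]
  simp [mul_comm]

/-- `Γ(x_{ir}^±)` and `Γ(h_{ir})` are differences of order `r` at `0`: the values of the currents at
`(t - 1)^r`. -/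
theorem Gamma_gen_mem (K : KacMoodyDatum I 𝔥) (a : Gen I 𝔥 ℕ) :
    Gamma K (Yangian.gen K a) ∈ evalIdeal K 1 ^ a.deg := by
  cases a with
  | h a =>
    rw [Gen.deg, Submodule.pow_zero, Ideal.one_eq_top]
    exact Submodule.mem_top
  | x ε i r =>
    rw [Gamma_gen_x, sum_choose_smul_eq_fwdDiff fun s : ℤ => YangianDouble.gen K (.x ε i s)]
    exact fwdDiff_gen_x_mem K ε i r 0
  | H i r =>
    rw [Gamma_gen_H, sum_choose_smul_eq_fwdDiff fun s : ℤ => YangianDouble.gen K (.H i s)]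
    exact fwdDiff_gen_H_mem K i r 0

theorem mul_mem_pow_add {R : Type*} [Ring R] {J : Ideal R} [J.IsTwoSided] {m n : ℕ} {x y : R}
    (hx : x ∈ J ^ m) (hy : y ∈ J ^ n) : x * y ∈ J ^ (m + n) := by
  rw [Ideal.IsTwoSided.pow_add]
  exact Ideal.mul_mem_mul hx hy

/-- `Γ(Y_n) ⊆ 𝒥_1^n`. -/
theorem Gamma_mem_pow (K : KacMoodyDatum I 𝔥) (n : ℕ) (y : Yangian K)
    (hy : y ∈ Yangian.grade K n) : Gamma K y ∈ evalIdeal K 1 ^ n := by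
  induction hy using Submodule.span_induction with
  | mem y hy =>
    obtain ⟨a, l, rfl, rfl⟩ := hy
    rw [map_mul, map_pow, Gamma_hbar]
    refine mul_mem_pow_add ?_ ?_
    · induction a with
      | zero => rw [Submodule.pow_zero, Ideal.one_eq_top]; exact Submodule.mem_top
      | succ a ih =>
        rw [pow_succ, Submodule.pow_succ]
        exact Ideal.mul_mem_mul ih (hbar_mem_evalIdeal K 1)
    · induction l with
      | nil => rw [List.map_nil, List.sum_nil, Submodule.pow_zero, Ideal.one_eq_top]
               exact Submodule.mem_top
      | cons b l ih =>
        rw [List.map_cons, List.map_cons, List.prod_cons, List.sum_cons, map_mul]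
        exact mul_mem_pow_add (Gamma_gen_mem K b) ih
  | zero => rw [map_zero]; exact zero_mem _
  | add y z _ _ h1 h2 => rw [map_add]; exact add_mem h1 h2
  | smul z y _ h => rw [AlgHom.map_smul_of_tower]; exact Submodule.smul_of_tower_mem _ z h

/-! ### `Φ_1 ∘ Γ` is the canonical embedding -/

theorem binomSeries_natCast (c : ℂˣ) (r : ℕ) :
    binomSeries c r = (PowerSeries.X + PowerSeries.C (c : ℂ)) ^ r := by
  induction r with
  | zero => rw [Nat.cast_zero, binomSeries_zero, pow_zero]
  | succ r ih =>
    rw [Nat.cast_succ, binomSeries_succ, ih, pow_succ', PowerSeries.smul_eq_C_mul, add_mul, add_comm]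

/-- The expansion of `((1 + T) - 1)^r`. -/
theorem sum_choose_smul_binomSeries (r : ℕ) : ∑ k ∈ Finset.range (r + 1),
    ((r.choose k : ℂ) * (-1) ^ (r - k)) • binomSeries 1 k = PowerSeries.X ^ r := by
  have h1 := add_pow ((PowerSeries.X : ℂ⟦X⟧) + PowerSeries.C ((1 : ℂˣ) : ℂ))
    (PowerSeries.C (-1 : ℂ)) r
  rw [add_assoc, ← map_add, Units.val_one, add_neg_cancel, map_zero, add_zero] at h1
  rw [h1]
  refine Finset.sum_congr rfl fun k _ => ?_
  rw [binomSeries_natCast, PowerSeries.smul_eq_C_mul, map_mul, map_pow, map_natCast, Units.val_one]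
  ring

theorem val_Phi_gen (K : KacMoodyDatum I 𝔥) (c : ℂˣ) (a : Gen I 𝔥 ℤ) :
    Yhat.val K (Phi K c (YangianDouble.gen K a)) = phiGen K c a :=
  phiFree_gen K c a

theorem val_Phi_hbar (K : KacMoodyDatum I 𝔥) (c : ℂˣ) :
    Yhat.val K (Phi K c (YangianDouble.hbar K)) =
      PowerSeries.X * PowerSeries.C (Yangian.hbar K) := by
  change phiFree K c PowerSeries.X = _
  rw [phiFree, hEval_X]
  rfl

theorem phiGen_x (K : KacMoodyDatum I 𝔥) (c : ℂˣ) (ε : ℤˣ) (i : I) (r : ℤ) :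
    phiGen K c (.x ε i r) = current (fun n => Yangian.gen K (.x ε i n)) (binomSeries c r) := by
  ext n
  rw [phiGen, PowerSeries.coeff_mk, coeff_current, binomSeries, PowerSeries.coeff_mk]

theorem phiGen_H (K : KacMoodyDatum I 𝔥) (c : ℂˣ) (i : I) (r : ℤ) :
    phiGen K c (.H i r) = current (fun n => Yangian.gen K (.H i n)) (binomSeries c r) := by
  ext n
  rw [phiGen, PowerSeries.coeff_mk, coeff_current, binomSeries, PowerSeries.coeff_mk]

theorem current_X_pow {R : Type*} [Ring R] [Algebra ℂ R] (f : ℕ → R) (r : ℕ) :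
    current f (PowerSeries.X ^ r) = PowerSeries.monomial r (f r) := by
  ext n
  rw [coeff_current, PowerSeries.coeff_X_pow, PowerSeries.coeff_monomial]
  split_ifs with h
  · rw [one_smul, h]
  · rw [zero_smul]

/-- The homomorphism `Φ_1 ∘ Γ`, with values in `Y⟦T⟧`. -/
def phiGamma (K : KacMoodyDatum I 𝔥) : Yangian K →ₐ[ℂ] (Yangian K)⟦X⟧ :=
  (phiSeries K 1).comp ((Gamma K).restrictScalars ℂ)

theorem phiGamma_hbar (K : KacMoodyDatum I 𝔥) :
    phiGamma K (Yangian.hbar K) = PowerSeries.monomial 1 (Yangian.hbar K) := by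
  change phiSeries K 1 (Gamma K (Yangian.hbar K)) = _
  rw [Gamma_hbar, PowerSeries.monomial_eq_C_mul_X_pow, pow_one, (PowerSeries.commute_X _).eq]
  exact val_Phi_hbar K 1

theorem phiSeries_gen (K : KacMoodyDatum I 𝔥) (c : ℂˣ) (a : Gen I 𝔥 ℤ) :
    phiSeries K c (YangianDouble.gen K a) = phiGen K c a :=
  phiFree_gen K c a

theorem phiGamma_gen (K : KacMoodyDatum I 𝔥) (a : Gen I 𝔥 ℕ) :
    phiGamma K (Yangian.gen K a) = PowerSeries.monomial a.deg (Yangian.gen K a) := by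
  change phiSeries K 1 (Gamma K (Yangian.gen K a)) = _
  cases a with
  | h a =>
    rw [Gamma_gen_h, phiSeries_gen, Gen.deg, PowerSeries.monomial_zero_eq_C_apply, phiGen]
  | x ε i r =>
    rw [Gamma_gen_x, map_sum]
    simp only [map_smul, phiSeries_gen, phiGen_x]
    simp only [← map_smul]
    rw [← map_sum, sum_choose_smul_binomSeries, current_X_pow]
    rfl
  | H i r =>
    rw [Gamma_gen_H, map_sum]
    simp only [map_smul, phiSeries_gen, phiGen_H]
    simp only [← map_smul]
    rw [← map_sum, sum_choose_smul_binomSeries, current_X_pow]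
    rfl

/-- `Φ_1(Γ(y))` is `y`, placed in degree `n`, for `y ∈ Y_n`. -/
theorem phiGamma_of_mem (K : KacMoodyDatum I 𝔥) (n : ℕ) (y : Yangian K)
    (hy : y ∈ Yangian.grade K n) : phiGamma K y = PowerSeries.monomial n y := by
  induction hy using Submodule.span_induction with
  | mem y hy =>
    obtain ⟨a, l, rfl, rfl⟩ := hy
    have h1 : phiGamma K (Yangian.hbar K ^ a) = PowerSeries.monomial a (Yangian.hbar K ^ a) := by
      induction a with
      | zero => rw [pow_zero, map_one, PowerSeries.monomial_zero_eq_C_apply, map_one]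
      | succ a ih =>
        rw [pow_succ, map_mul, ih, phiGamma_hbar, PowerSeries.monomial_mul_monomial]
    have h2 : phiGamma K (l.map (Yangian.gen K)).prod =
        PowerSeries.monomial (l.map Gen.deg).sum (l.map (Yangian.gen K)).prod := by
      induction l with
      | nil =>
        rw [List.map_nil, List.map_nil, List.prod_nil, List.sum_nil, map_one,
          PowerSeries.monomial_zero_eq_C_apply, map_one]
      | cons b l ih =>
        rw [List.map_cons, List.map_cons, List.prod_cons, List.sum_cons, map_mul, phiGamma_gen, ih,
          PowerSeries.monomial_mul_monomial]
    rw [map_mul, h1, h2, PowerSeries.monomial_mul_monomial]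
  | zero => rw [map_zero, map_zero]
  | add y z _ _ h1 h2 => rw [map_add, map_add, h1, h2]
  | smul z y _ h =>
    rw [map_smul, h]
    ext k
    rw [PowerSeries.coeff_smul, PowerSeries.coeff_monomial, PowerSeries.coeff_monomial]
    split_ifs <;> simp

theorem comp_Phi_Gamma (K : KacMoodyDatum I 𝔥) {n : ℕ} {y : Yangian K}
    (hy : y ∈ Yangian.grade K n) (k : ℕ) :
    Yhat.comp K k (Phi K 1 (Gamma K y)) = if k = n then y else 0 := by
  change PowerSeries.coeff k (phiGamma K y) = _
  rw [phiGamma_of_mem K n y hy, PowerSeries.coeff_monomial]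

/-! ### `Γ ∘ Φ_1` is the identity up to powers of the evaluation ideal -/

/-- The sum `∑_{k < N} Γ(y_k)`, for `f = ∑_k y_k` in the completed Yangian. -/
def gammaTrunc (K : KacMoodyDatum I 𝔥) (N : ℕ) (f : Yhat K) : YangianDouble K :=
  ∑ k ∈ Finset.range N, Gamma K (Yhat.comp K k f)

theorem gammaTrunc_add (K : KacMoodyDatum I 𝔥) (N : ℕ) (f g : Yhat K) :
    gammaTrunc K N (f + g) = gammaTrunc K N f + gammaTrunc K N g := by
  simp only [gammaTrunc, Yhat.comp_add, map_add, Finset.sum_add_distrib]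

/-- Modulo `𝒥_1^N`, the truncated sum `∑_{k < N} Γ(y_k)` is multiplicative. -/
theorem gammaTrunc_mul (K : KacMoodyDatum I 𝔥) (N : ℕ) (f g : Yhat K) :
    gammaTrunc K N f * gammaTrunc K N g - gammaTrunc K N (f * g) ∈ evalIdeal K 1 ^ N := by
  set s := Finset.range N ×ˢ Finset.range N with hs
  set F : ℕ × ℕ → YangianDouble K := fun p =>
    Gamma K (Yhat.comp K p.1 f) * Gamma K (Yhat.comp K p.2 g) with hF
  have h1 : gammaTrunc K N (f * g) = ∑ p ∈ s with p.1 + p.2 < N, F p := by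
    rw [← Finset.sum_fiberwise_of_maps_to (t := Finset.range N) (g := fun p : ℕ × ℕ => p.1 + p.2)
      (fun p hp => Finset.mem_range.mpr (Finset.mem_filter.mp hp).2), gammaTrunc]
    refine Finset.sum_congr rfl fun k hk => ?_
    have hk := Finset.mem_range.mp hk
    rw [Yhat.comp_mul, map_sum]
    refine Finset.sum_congr ?_ fun p _ => map_mul _ _ _
    ext p
    simp only [hs, Finset.mem_filter, Finset.mem_product, Finset.mem_range,
      Finset.HasAntidiagonal.mem_antidiagonal]
    omega
  have h2 : gammaTrunc K N f * gammaTrunc K N g = ∑ p ∈ s, F p := by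
    rw [gammaTrunc, gammaTrunc, Finset.sum_mul_sum, ← Finset.sum_product']
  rw [h1, h2, ← Finset.sum_filter_add_sum_filter_not s (fun p => p.1 + p.2 < N) F,
    add_sub_cancel_left]
  refine Ideal.sum_mem _ fun p hp => ?_
  have h3 := (Finset.mem_filter.mp hp).2
  exact Ideal.pow_le_pow_right (not_lt.mp h3) (mul_mem_pow_add
    (Gamma_mem_pow K _ _ (Yhat.comp_mem K _ f)) (Gamma_mem_pow K _ _ (Yhat.comp_mem K _ g)))

/-- On the generators, `Γ ∘ Φ_1` is Newton interpolation: `t^r` is congruent to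
`∑_{n < N} binom(r, n) (t - 1)^n` modulo `(t - 1)^N ℂ[t, t⁻¹]`. -/
theorem gammaTrunc_Phi_gen (K : KacMoodyDatum I 𝔥) (N : ℕ) (a : Gen I 𝔥 ℤ) :
    YangianDouble.gen K a - gammaTrunc K N (Phi K 1 (YangianDouble.gen K a)) ∈
      evalIdeal K 1 ^ N := by
  have hc : ∀ k, Yhat.comp K k (Phi K 1 (YangianDouble.gen K a)) =
      PowerSeries.coeff k (phiGen K 1 a) := fun k => by rw [Yhat.comp, val_Phi_gen]
  simp only [gammaTrunc, hc]
  cases a with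
  | h a =>
    rcases N with _ | N
    · rw [Submodule.pow_zero, Ideal.one_eq_top]
      exact Submodule.mem_top
    · rw [Finset.sum_eq_single 0]
      · rw [phiGen, PowerSeries.coeff_zero_C, Gamma_gen_h, sub_self]
        exact zero_mem _
      · intro k _ hk
        rw [phiGen, PowerSeries.coeff_C_of_ne_zero hk, map_zero]
      · intro h
        exact absurd (Finset.mem_range.mpr (Nat.succ_pos N)) h
  | x ε i r =>
    have h1 := sub_sum_choose_smul_fwdDiff_mem (evalIdeal K 1 ^ N).toAddSubgroup N
      (fun s => YangianDouble.gen K (.x ε i s)) (fwdDiff_gen_x_mem K ε i N) r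
    rw [Submodule.mem_toAddSubgroup] at h1
    convert h1 using 3 with k
    rw [phiGen, PowerSeries.coeff_mk, AlgHom.map_smul_of_tower, Gamma_gen_x,
      sum_choose_smul_eq_fwdDiff fun s : ℤ => YangianDouble.gen K (.x ε i s), Units.val_one,
      one_zpow, mul_one, Int.cast_smul_eq_zsmul]
  | H i r =>
    have h1 := sub_sum_choose_smul_fwdDiff_mem (evalIdeal K 1 ^ N).toAddSubgroup N
      (fun s => YangianDouble.gen K (.H i s)) (fwdDiff_gen_H_mem K i N) r
    rw [Submodule.mem_toAddSubgroup] at h1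
    convert h1 using 3 with k
    rw [phiGen, PowerSeries.coeff_mk, AlgHom.map_smul_of_tower, Gamma_gen_H,
      sum_choose_smul_eq_fwdDiff fun s : ℤ => YangianDouble.gen K (.H i s), Units.val_one,
      one_zpow, mul_one, Int.cast_smul_eq_zsmul]

theorem gammaTrunc_algebraMap (K : KacMoodyDatum I 𝔥) (N : ℕ) (z : ℂ) :
    algebraMap ℂ (YangianDouble K) z -
      gammaTrunc K N (Phi K 1 (algebraMap ℂ (YangianDouble K) z)) ∈ evalIdeal K 1 ^ N := by
  rcases N with _ | N
  · rw [Submodule.pow_zero, Ideal.one_eq_top]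
    exact Submodule.mem_top
  · have hc : ∀ k, Yhat.comp K k (Phi K 1 (algebraMap ℂ (YangianDouble K) z)) =
        if k = 0 then algebraMap ℂ (Yangian K) z else 0 := by
      intro k
      change PowerSeries.coeff k (phiSeries K 1 (algebraMap ℂ (YangianDouble K) z)) = _
      rw [AlgHom.commutes, PowerSeries.algebraMap_apply, PowerSeries.coeff_C]
    simp only [gammaTrunc, hc]
    rw [Finset.sum_eq_single 0 (fun k _ hk => by rw [if_neg hk, map_zero])
      (fun h => absurd (Finset.mem_range.mpr (Nat.succ_pos N)) h), if_pos rfl]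
    have h1 : Gamma K (algebraMap ℂ (Yangian K) z) = algebraMap ℂ (YangianDouble K) z :=
      ((Gamma K).restrictScalars ℂ).commutes z
    rw [h1, sub_self]
    exact zero_mem _

theorem gammaTrunc_Phi_C (K : KacMoodyDatum I 𝔥) (N : ℕ) (a : FreeAlgebra ℂ (Gen I 𝔥 ℤ)) :
    YangianDouble.mk K (PowerSeries.C a) -
      gammaTrunc K N (Phi K 1 (YangianDouble.mk K (PowerSeries.C a))) ∈ evalIdeal K 1 ^ N := by
  induction a using FreeAlgebra.induction with
  | grade0 z =>
    have h1 : YangianDouble.mk K (PowerSeries.C (algebraMap ℂ _ z)) =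
        algebraMap ℂ (YangianDouble K) z := by
      rw [← PowerSeries.algebraMap_apply, AlgHom.commutes]
    rw [h1]
    exact gammaTrunc_algebraMap K N z
  | grade1 a => exact gammaTrunc_Phi_gen K N a
  | mul a b ha hb =>
    rw [map_mul, map_mul, map_mul]
    generalize YangianDouble.mk K (PowerSeries.C a) = y at ha ⊢
    generalize YangianDouble.mk K (PowerSeries.C b) = z at hb ⊢
    have h1 := gammaTrunc_mul K N (Phi K 1 y) (Phi K 1 z)
    have h2 := Ideal.mul_mem_right z _ ha
    have h3 := Ideal.mul_mem_left _ (gammaTrunc K N (Phi K 1 y)) hb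
    convert add_mem (add_mem h1 h2) h3 using 1
    noncomm_ring
  | add a b ha hb =>
    rw [map_add, map_add, map_add, gammaTrunc_add, add_sub_add_comm]
    exact add_mem ha hb

theorem gammaTrunc_hbar_mul (K : KacMoodyDatum I 𝔥) (N : ℕ) (y : YangianDouble K) :
    gammaTrunc K (N + 1) (Phi K 1 (YangianDouble.hbar K * y)) =
      YangianDouble.hbar K * gammaTrunc K N (Phi K 1 y) := by
  have h1 : Yhat.val K (Phi K 1 (YangianDouble.hbar K * y)) =
      PowerSeries.X * (PowerSeries.C (Yangian.hbar K) * Yhat.val K (Phi K 1 y)) := by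
    rw [map_mul, map_mul, val_Phi_hbar, mul_assoc]
  rw [gammaTrunc, Finset.sum_range_succ', gammaTrunc, Finset.mul_sum]
  simp only [Yhat.comp, h1, PowerSeries.coeff_succ_X_mul, PowerSeries.coeff_zero_X_mul, map_zero,
    add_zero, PowerSeries.coeff_C_mul]
  simp only [map_mul, Gamma_hbar]

/-- `y ≡ ∑_{k < N} Γ(Φ_1(y)_k)` modulo `𝒥_1^N`. Both sides are homomorphisms modulo `𝒥_1^N`; on the
generators this is Newton interpolation, and the terms of order `≥ N` in `ħ` lie in `𝒥_1^N`. -/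
theorem sub_gammaTrunc_Phi_mem (K : KacMoodyDatum I 𝔥) (N : ℕ) (y : YangianDouble K) :
    y - gammaTrunc K N (Phi K 1 y) ∈ evalIdeal K 1 ^ N := by
  induction N generalizing y with
  | zero =>
    rw [Submodule.pow_zero, Ideal.one_eq_top]
    exact Submodule.mem_top
  | succ N ih =>
    obtain ⟨x, rfl⟩ := YangianDouble.mk_surjective K y
    rw [PowerSeries.eq_X_mul_shift_add_const x, map_add, map_mul, map_add, gammaTrunc_add,
      add_sub_add_comm]
    refine add_mem ?_ (gammaTrunc_Phi_C K (N + 1) _)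
    change YangianDouble.hbar K * _ - gammaTrunc K (N + 1) (Phi K 1 (YangianDouble.hbar K * _)) ∈ _
    rw [gammaTrunc_hbar_mul, ← mul_sub, Ideal.IsTwoSided.pow_succ]
    exact Ideal.mul_mem_mul (hbar_mem_evalIdeal K 1) (ih _)

/-! ### Gradation automorphisms -/

theorem chi_mk (K : KacMoodyDatum I 𝔥) (a : ℂˣ) (x : DFree I 𝔥) :
    chi K a (YangianDouble.mk K x) = YangianDouble.mk K (twist (a : ℂ)
      (FreeAlgebra.lift ℂ fun g : Gen I 𝔥 ℤ => ((a : ℂ) ^ g.deg) • FreeAlgebra.ι ℂ g) x) := rfl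

theorem coeff_twist {A A' : Type*} [Ring A] [Algebra ℂ A] [Ring A'] [Algebra ℂ A'] (c : ℂ)
    (ψ : A →ₐ[ℂ] A') (f : A⟦X⟧) (n : ℕ) :
    PowerSeries.coeff n (twist c ψ f) = c ^ n • ψ (PowerSeries.coeff n f) :=
  PowerSeries.coeff_mk n fun n => c ^ n • ψ (PowerSeries.coeff n f)

theorem chi_chi (K : KacMoodyDatum I 𝔥) {a b : ℂˣ} (hab : a * b = 1) (y : YangianDouble K) :
    chi K a (chi K b y) = y := by
  have h0 : (a : ℂ) * b = 1 := by rw [← Units.val_mul, hab, Units.val_one]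
  obtain ⟨x, rfl⟩ := YangianDouble.mk_surjective K y
  rw [chi_mk, chi_mk]
  congr 1
  have h1 : (FreeAlgebra.lift ℂ
      fun g : Gen I 𝔥 ℤ => ((a : ℂ) ^ g.deg) • FreeAlgebra.ι ℂ g).comp (FreeAlgebra.lift ℂ
      fun g : Gen I 𝔥 ℤ => ((b : ℂ) ^ g.deg) • FreeAlgebra.ι ℂ g) = AlgHom.id ℂ _ := by
    ext g
    simp [smul_smul, ← mul_zpow, mul_comm (b : ℂ), h0]
  ext n
  rw [coeff_twist, coeff_twist, map_smul, ← AlgHom.comp_apply, h1, smul_smul, ← mul_pow, h0,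
    one_pow, one_smul, AlgHom.id_apply]

theorem comp_chiY (K : KacMoodyDatum I 𝔥) (a : ℂˣ) (k : ℕ) (f : Yhat K) :
    Yhat.comp K k (chiY K a f) = (a : ℂ) ^ k • Yhat.comp K k f :=
  coeff_twist _ _ _ _

theorem chiY_chiY (K : KacMoodyDatum I 𝔥) {a b : ℂˣ} (hab : a * b = 1) (f : Yhat K) :
    chiY K a (chiY K b f) = f := by
  refine Yhat.ext_comp fun k => ?_
  rw [comp_chiY, comp_chiY, smul_smul, ← mul_pow, ← Units.val_mul, hab, Units.val_one, one_pow,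
    one_smul]

/-- `Φ_c = χ^ι_{a/c} ∘ Φ_a ∘ χ_{c/a}`. -/
theorem Phi_eq_chiY_Phi_chi (K : KacMoodyDatum I 𝔥) (a c : ℂˣ) (y : YangianDouble K) :
    Phi K c y = chiY K (a / c) (Phi K a (chi K (c / a) y)) := by
  have hs : ((a / c : ℂˣ) : ℂ) = a / c := Units.val_div_eq_div_val a c
  have hs' : ((c / a : ℂˣ) : ℂ) = c / a := Units.val_div_eq_div_val c a
  have ha := a.ne_zero
  have hc := c.ne_zero
  -- The coefficient `binom(r, n) a^{r-n}` of `Φ_a`, rescaled by the two gradation automorphisms.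
  have hz : ∀ (r : ℤ) (n : ℕ), ((a : ℂ) / c) ^ n * (((c : ℂ) / a) ^ r * (a : ℂ) ^ (r - n)) =
      (c : ℂ) ^ (r - n) := by
    intro r n
    rw [div_pow, div_zpow, zpow_sub₀ ha, zpow_sub₀ hc, zpow_natCast, zpow_natCast]
    field_simp
  have h1 : FreeAlgebra.lift ℂ (phiGen K c) = (twist ((a / c : ℂˣ) : ℂ)
      (AlgHom.id ℂ (Yangian K))).comp ((FreeAlgebra.lift ℂ (phiGen K a)).comp (FreeAlgebra.lift ℂ
      fun g : Gen I 𝔥 ℤ => (((c / a : ℂˣ) : ℂ) ^ g.deg) • FreeAlgebra.ι ℂ g)) := by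
    refine FreeAlgebra.hom_ext (funext fun g => PowerSeries.ext fun n => ?_)
    simp only [Function.comp_apply, AlgHom.comp_apply, FreeAlgebra.lift_ι_apply, map_smul]
    rw [PowerSeries.coeff_smul, coeff_twist, AlgHom.id_apply, hs, hs']
    cases g with
    | h g =>
      rw [Gen.deg, zpow_zero, one_smul, phiGen, phiGen, PowerSeries.coeff_C]
      split_ifs with h
      · rw [h, pow_zero, one_smul]
      · rw [smul_zero]
    | x ε i r =>
      simp only [Gen.deg, phiGen, PowerSeries.coeff_mk, smul_smul]
      rw [← hz r n]
      congr 1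
      ring
    | H i r =>
      simp only [Gen.deg, phiGen, PowerSeries.coeff_mk, smul_smul]
      rw [← hz r n]
      congr 1
      ring
  obtain ⟨x, rfl⟩ := YangianDouble.mk_surjective K y
  refine Yhat.ext_comp fun k => ?_
  rw [comp_chiY, chi_mk, Yhat.comp_Phi_mk, Yhat.comp_Phi_mk, phiFree, phiFree, coeff_hEval,
    coeff_hEval, Finset.smul_sum]
  refine Finset.sum_congr rfl fun p hp => ?_
  have hp' := Finset.HasAntidiagonal.mem_antidiagonal.mp hp
  rw [coeff_twist, map_smul, PowerSeries.coeff_smul, h1, AlgHom.comp_apply, AlgHom.comp_apply,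
    coeff_twist, AlgHom.id_apply, mul_smul_comm, mul_smul_comm, smul_smul, ← hp', pow_add,
    mul_right_comm, ← mul_pow, ← Units.val_mul, div_mul_div_cancel, div_self', Units.val_one,
    one_pow, one_mul]

/-! ### The homomorphisms between the completions -/

theorem IdealCompletion.map_apply_mk (S : Type*) [CommRing S] {R R' : Type*} [Ring R] [Algebra S R]
    [Ring R'] [Algebra S R'] {J : Ideal R} [J.IsTwoSided] {J' : Ideal R'} [J'.IsTwoSided]
    (φ : R →+* R') (h : ∀ n, J ^ n ≤ Ideal.comap φ (J' ^ n)) (f : IdealCompletion S J) (n : ℕ)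
    (x : R) (hx : Ideal.Quotient.mk (J ^ n) x = f.1 n) :
    Ideal.Quotient.mk (J' ^ n) (φ x) = (IdealCompletion.map S φ h f).1 n := by
  change _ = Ideal.quotientMap (J' ^ n) φ (h n) (f.1 n)
  rw [← hx]
  rfl

theorem chiHat_chiHat (K : KacMoodyDatum I 𝔥) {a a' b b' : ℂˣ} (h : a * b' = b) (h' : a' * b = b')
    (haa : a' * a = 1) (f : DYhat K b) : chiHat K a' b' b h' (chiHat K a b b' h f) = f := by
  refine Subtype.ext (funext fun n => ?_)
  obtain ⟨x, hx⟩ := Ideal.Quotient.mk_surjective (f.1 n)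
  have h1 := IdealCompletion.map_apply_mk ℂ⟦X⟧ _ (pow_le_comap _ (evalIdeal_le_comap_chi K h)) f n x
    hx
  have h2 := IdealCompletion.map_apply_mk ℂ⟦X⟧ _ (pow_le_comap _ (evalIdeal_le_comap_chi K h')) _ n
    _ h1
  refine h2.symm.trans ?_
  rw [← hx]
  exact congrArg _ (chi_chi K haa x)

/-- The component of degree `k` of `Φ̂_c(f)` can be read off from a representative of `f` modulo any
`𝒥_c^n` with `n > k`. -/
theorem comp_PhiHat (K : KacMoodyDatum I 𝔥) {c : ℂˣ}
    (hΦ : evalIdeal K c ≤ Ideal.comap (Phi K c) (Yhat.ge K 1)) {k n : ℕ} (hkn : k < n)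
    (f : DYhat K c) (x : YangianDouble K)
    (hx : Ideal.Quotient.mk (evalIdeal K c ^ n) x = f.1 n) :
    Yhat.comp K k (PhiHat hΦ f) = Yhat.comp K k (Phi K c x) :=
  (Yhat.comp_ofComp _ (fun k => phiComp_mem K c k f) k).trans (phiComp_eq hΦ hkn f x hx)

theorem PhiHat_eq_chiY_PhiHat_chiHat (K : KacMoodyDatum I 𝔥) {c : ℂˣ}
    (hΦ : ∀ a : ℂˣ, evalIdeal K a ≤ Ideal.comap (Phi K a) (Yhat.ge K 1)) (f : DYhat K c) :
    PhiHat (hΦ c) f = chiY K (1 / c) (PhiHat (hΦ 1) (chiHat K c c 1 (mul_one c) f)) := by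
  refine Yhat.ext_comp fun k => ?_
  obtain ⟨x, hx⟩ := Ideal.Quotient.mk_surjective (f.1 (k + 1))
  rw [comp_chiY, comp_PhiHat K (hΦ c) (Nat.lt_succ_self k) f x hx,
    comp_PhiHat K (hΦ 1) (Nat.lt_succ_self k) (chiHat K c c 1 (mul_one c) f) (chi K c x)
      (IdealCompletion.map_apply_mk ℂ⟦X⟧ _
        (pow_le_comap _ (evalIdeal_le_comap_chi K (mul_one c))) f _ x hx),
    Phi_eq_chiY_Phi_chi K 1 c x, comp_chiY, div_one]

theorem GammaHat_PhiHat (K : KacMoodyDatum I 𝔥)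
    (hΦ : evalIdeal K 1 ≤ Ideal.comap (Phi K 1) (Yhat.ge K 1))
    (hΓ : ∀ n, ∀ y ∈ Yangian.grade K n, Gamma K y ∈ evalIdeal K 1 ^ n) (f : DYhat K 1) :
    GammaHat K hΓ (PhiHat hΦ f) = f := by
  refine Subtype.ext (funext fun n => ?_)
  obtain ⟨x, hx⟩ := Ideal.Quotient.mk_surjective (f.1 n)
  change Ideal.Quotient.mk (evalIdeal K 1 ^ n) (gammaTrunc K n (PhiHat hΦ f)) = f.1 n
  have h1 : gammaTrunc K n (PhiHat hΦ f) = gammaTrunc K n (Phi K 1 x) :=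
    Finset.sum_congr rfl fun k hk => by
      rw [comp_PhiHat K hΦ (Finset.mem_range.mp hk) f x hx]
  rw [h1, ← hx, eq_comm]
  exact Ideal.Quotient.eq.mpr (sub_gammaTrunc_Phi_mem K n x)

theorem PhiHat_GammaHat (K : KacMoodyDatum I 𝔥)
    (hΦ : evalIdeal K 1 ≤ Ideal.comap (Phi K 1) (Yhat.ge K 1))
    (hΓ : ∀ n, ∀ y ∈ Yangian.grade K n, Gamma K y ∈ evalIdeal K 1 ^ n) (g : Yhat K) :
    PhiHat hΦ (GammaHat K hΓ g) = g := by
  refine Yhat.ext_comp fun k => ?_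
  rw [comp_PhiHat K hΦ (Nat.lt_succ_self k) (GammaHat K hΓ g) (gammaTrunc K (k + 1) g) rfl,
    gammaTrunc, map_sum]
  have h1 : ∀ s : Finset ℕ, Yhat.comp K k (∑ j ∈ s, Phi K 1 (Gamma K (Yhat.comp K j g))) =
      ∑ j ∈ s, if k = j then Yhat.comp K j g else 0 := by
    intro s
    rw [Yhat.comp, map_sum, map_sum]
    exact Finset.sum_congr rfl fun j _ => comp_Phi_Gamma K (Yhat.comp_mem K j g) k
  rw [h1, Finset.sum_ite_eq, if_pos (Finset.mem_range.mpr (Nat.lt_succ_self k))]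

end YD

end

theorem corollary5p6 {I : Type*} {𝔥 : Type*} [Fintype I] [DecidableEq I] [AddCommGroup 𝔥]
    [Module ℂ 𝔥] (K : YD.KacMoodyDatum I 𝔥) (c : ℂˣ) :
    (∀ (a : ℂˣ) (x : YD.YangianDouble K),
      YD.Phi K c x = YD.chiY K (a / c) (YD.Phi K a (YD.chi K (c / a) x))) ∧
    ∃ hΦ : ∀ a : ℂˣ, YD.evalIdeal K a ≤ Ideal.comap (YD.Phi K a) (YD.Yhat.ge K 1),
      ∃ hΓ : ∀ n, ∀ y ∈ YD.Yangian.grade K n, YD.Gamma K y ∈ YD.evalIdeal K 1 ^ n,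
        Function.Bijective (YD.PhiHat (hΦ c)) ∧
        (∀ f : YD.DYhat K c, YD.PhiHat (hΦ c) f =
          YD.chiY K (1 / c) (YD.PhiHat (hΦ 1) (YD.chiHat K c c 1 (mul_one c) f))) ∧
        Function.LeftInverse
          (fun g : YD.Yhat K =>
            YD.chiHat K (1 / c) 1 c (div_mul_cancel 1 c) (YD.GammaHat K hΓ (YD.chiY K c g)))
          (YD.PhiHat (hΦ c)) ∧
        Function.RightInverse
          (fun g : YD.Yhat K =>
            YD.chiHat K (1 / c) 1 c (div_mul_cancel 1 c) (YD.GammaHat K hΓ (YD.chiY K c g)))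
          (YD.PhiHat (hΦ c)) := by
  refine ⟨fun a x => YD.Phi_eq_chiY_Phi_chi K a c x, YD.evalIdeal_le_comap_Phi K,
    YD.Gamma_mem_pow K, ?_⟩
  have h0 := YD.PhiHat_eq_chiY_PhiHat_chiHat K (c := c) (YD.evalIdeal_le_comap_Phi K)
  have h1 : c * (1 / c) = 1 := mul_div_cancel c 1
  have h2 : 1 / c * c = 1 := div_mul_cancel 1 c
  have hl : Function.LeftInverse
      (fun g : YD.Yhat K => YD.chiHat K (1 / c) 1 c (div_mul_cancel 1 c)
        (YD.GammaHat K (YD.Gamma_mem_pow K) (YD.chiY K c g)))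
      (YD.PhiHat (YD.evalIdeal_le_comap_Phi K c)) := by
    intro f
    simp only [h0]
    rw [YD.chiY_chiY K h1, YD.GammaHat_PhiHat, YD.chiHat_chiHat K _ _ h2]
  have hr : Function.RightInverse
      (fun g : YD.Yhat K => YD.chiHat K (1 / c) 1 c (div_mul_cancel 1 c)
        (YD.GammaHat K (YD.Gamma_mem_pow K) (YD.chiY K c g)))
      (YD.PhiHat (YD.evalIdeal_le_comap_Phi K c)) := by
    intro g
    rw [h0, YD.chiHat_chiHat K _ _ h1, YD.PhiHat_GammaHat, YD.chiY_chiY K h2]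
  exact ⟨⟨hl.injective, hr.surjective⟩, h0, hl, hr⟩
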